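/- Consider one of the following two kinds of networks $\mathcal G$. (E) Edge-network: a finite directed graph whose edges $\Omega_i$, $1\le i\le N$, are bounded open intervals, each joining two distinct vertices (an in-vertex, with $n_i=-1$, and an out-vertex, with $n_i=+1$). $\Gamma$ is the set of vertices belonging to at least three edges, $I_\gamma=\{i:\gamma\in\overline{\Omega_i}\}$, and $\partial\mathcal G=\bigcup_i\partial\Omega_i\setminus\Gamma$. (P) Plane-network: finitely many planar polygonal domains $\Omega_i$, $1\le i\le N$, each isometrically embedded in $\mathbb R^3$, with a finite set $\Gamma$ of nondegenerate segments, each contained in at least three of the closed surfaces and lying in the boundary of every surface whose closure contains it; $I_\gamma=\{i:\gamma\subset\overline{\Omega_i}\}$, $\partial\mathcal G=\bigcup_i\partial\Omega_i\setminus\bigcup_{\gamma\in\Gamma}\gamma$, and $\boldsymbol n_i$ is the outward unit normal of $\Omega_i$ in its plane. Put $D_\gamma=\{(i,j):i<j,\ i,j\in I_\gamma\}$. Let $\kappa_i\in L^\infty(\Omega_i)$ with $\kappa_i\ge\kappa_{\min}>0$ a.e., and $\boldsymbol\sigma_i(v)=\kappa_i\nabla v_i$. Let $\mathcal T_{h,i}$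 be meshes of the $\Omega_i$: in case (E) partitions into intervals such that any two intervals sharing an interior mesh point or a bifurcation have lengths of ratio at most $\sigma$; in case (P) conforming triangulations, each triangle $K$ containing a ball of diameter at least $\operatorname{diam}(K)/\sigma$, that match at the bifurcations: each $\gamma\in\Gamma$ is a union of mesh edges of $\mathcal T_{h,i}$ for every $i\in I_\gamma$, and these edges are the same for all $i\in I_\gamma$; they form the set $\mathcal F_h^\gamma$. Assume that $\kappa_i$ has one-sided limits from inside each element at (almost) every point of the faces of that element; these are its traces. Let $\mathcal F_{h,i}^{\rm int}$ be the interior mesh faces (points in case (E), edges in case (P)) of $\mathcal T_{h,i}$ and $\mathcal F_{h,i}^{\partial\mathcal G}$ those contained in the boundary of $\Omega_i$ and belonging to $\partial\mathcal G$ (in case (P): the mesh edges in $\partial\Omega_i$ not contained in a segment of $\Gamma$). In case (P), $h_F$ is the length of $F$; in case (E), $h_F$ is the largest length of the mesh intervals of $\mathcal T_{h,i}$ containing $F$, and $h_\gamma$ is the largest length of the mesh intervals that have $\gamma$ as an end point. $V_h^p$ is the space of functions whose restriction to each element is a polynomial of degree at most $p$. On an interior face shared by $K_1,K_2$, with unit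 normal $\boldsymbol n_F$ pointing from $K_1$ to $K_2$, put $[v]=v|_{K_1}-v|_{K_2}$ and $\{v\}=\frac12(v|_{K_1}+v|_{K_2})$; on a face in $\partial\mathcal G$, $\boldsymbol n_F=\boldsymbol n_i$. At $\gamma\in\Gamma$ put $[v]_{(i,j)}=v_i-v_j$, $\{\boldsymbol w\}_{(i,j)}=\boldsymbol w_i\cdot\boldsymbol n_i-\boldsymbol w_j\cdot\boldsymbol n_j$, $$\{\boldsymbol\sigma(w)\}\odot[v]=\frac1{\operatorname{card}I_\gamma}\sum_{(i,j)\in D_\gamma}\{\boldsymbol\sigma(w)\}_{(i,j)}[v]_{(i,j)},\qquad [w]\odot[v]=\sum_{(i,j)\in D_\gamma}[w]_{(i,j)}[v]_{(i,j)}.$$ With $\epsilon_i,\epsilon\in\{-1,0,1\}$ and positive penalty parameters $\eta_{F,i},\eta_\gamma$, define $$\begin{aligned}a_i(w,v)=&\sum_{K\in\mathcal T_{h,i}}\int_K\kappa_i\nabla w_i\cdot\nabla v_i-\sum_{F\in\mathcal F_{h,i}^{\rm int}}\int_F\{\kappa_i\nabla w_i\cdot\boldsymbol n_F\}[v_i]-\epsilon_i\sum_{F\in\mathcal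 F_{h,i}^{\rm int}}\int_F\{\kappa_i\nabla v_i\cdot\boldsymbol n_F\}[w_i]+\sum_{F\in\mathcal F_{h,i}^{\rm int}}\frac{\eta_{F,i}}{h_F}\int_F[w_i][v_i]\\&-\sum_{F\in\mathcal F_{h,i}^{\partial\mathcal G}}\int_F\kappa_i\nabla w_i\cdot\boldsymbol n_F\,v_i-\epsilon_i\sum_{F\in\mathcal F_{h,i}^{\partial\mathcal G}}\int_F\kappa_i\nabla v_i\cdot\boldsymbol n_F\,w_i+\sum_{F\in\mathcal F_{h,i}^{\partial\mathcal G}}\frac{\eta_{F,i}}{h_F}\int_Fw_iv_i,\end{aligned}$$ $$\begin{aligned}a(w,v)=&\sum_ia_i(w,v)-\sum_{\gamma\in\Gamma}\sum_{F\in\mathcal F_h^\gamma}\int_F\{\boldsymbol\sigma(w)\}\odot[v]-\epsilon\sum_{\gamma\in\Gamma}\sum_{F\in\mathcal F_h^\gamma}\int_F\{\boldsymbol\sigma(v)\}\odot[w]+\sum_{\gamma\in\Gamma}\eta_\gamma\sum_{F\in\mathcal F_h^\gamma}\frac1{h_F}\int_F[w]\odot[v],\end{aligned}$$ $$\|v\|_{\rm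 DG}^2=\sum_i\Big(\sum_{K\in\mathcal T_{h,i}}\|\nabla v_i\|_{L^2(K)}^2+\sum_{F\in\mathcal F_{h,i}^{\rm int}}\frac{\eta_{F,i}}{h_F}\|[v_i]\|_{L^2(F)}^2+\sum_{F\in\mathcal F_{h,i}^{\partial\mathcal G}}\frac{\eta_{F,i}}{h_F}\|v_i\|_{L^2(F)}^2\Big)+\sum_{\gamma\in\Gamma}\eta_\gamma\sum_{F\in\mathcal F_h^\gamma}\frac1{h_F}\sum_{(i,j)\in D_\gamma}\|[v]_{(i,j)}\|_{L^2(F)}^2,$$ where in case (E) $\nabla$ is the derivative, integrals over a face $F$ are values at the point $F$, $\mathcal F_h^\gamma=\{\gamma\}$, and the weight $1/h_F$ at $\gamma$ is $1/h_\gamma$. Then for every network, every coefficient $\kappa$, every $p\ge0$ and every $\sigma$ there are $\eta_0>0$ and $C>0$ such that the following holds for all meshes as above with regularity constant $\sigma$, all choices of $\epsilon_i,\epsilon\in\{-1,0,1\}$, and all penalty parameters with $\eta_{F,i}>0$ if $\epsilon_i=-1$ (NIPG), $\eta_{F,i}\ge\eta_0$ if $\epsilon_i\in\{0,1\}$, and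 $\eta_\gamma\ge\eta_0$: 1. (Coercivity) $\|v_h\|_{\rm DG}^2\le C\,a(v_h,v_h)$ for all $v_h\in V_h^p$. 2. (Well-posedness) If moreover every $\Omega_i$ can be joined, through a chain of domains in which consecutive ones share a bifurcation of $\Gamma$, to some $\Omega_j$ whose boundary meets $\partial\mathcal G$ (for instance, if the network is connected through its bifurcations and $\partial\mathcal G\ne\emptyset$), then for all $f_i\in L^2(\Omega_i)$ there is a unique $u_h\in V_h^p$ with $a(u_h,v_h)=\sum_i\int_{\Omega_i}f_iv_h$ for all $v_h\in V_h^p$. -/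

import Mathlib

open Set Filter Topology MeasureTheory

noncomputable section

/-! ## Edge-networks -/

namespace EdgeDG

/-- A directed graph with finitely many edges and vertices.  Each edge `i` carries its own
coordinate system, in which it is the interval `(left i, right i)`; `vin i` and `vout i` are the
vertices of the graph located at the left and the right end of the interval. -/
structure Network where
  N : ℕ
  numVert : ℕ
  left : Fin N → ℝ
  right : Fin N → ℝ
  left_lt_right : ∀ i, left i < right i
  vin : Fin N → Fin numVert
  vout : Fin N → Fin numVert
  vin_ne_vout : ∀ i, vin i ≠ vout i

namespace Network

variable (G : Network)

/-- `I_γ`: the edges that have `γ` as a vertex. -/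
def I (γ : Fin G.numVert) : Finset (Fin G.N) :=
  Finset.univ.filter fun i => G.vin i = γ ∨ G.vout i = γ

/-- `D_γ`: the ordered pairs `i < j` in `I_γ`. -/
def D (γ : Fin G.numVert) : Finset (Fin G.N × Fin G.N) :=
  (G.I γ ×ˢ G.I γ).filter fun ij => ij.1 < ij.2

/-- The bifurcation nodes: the vertices that belong to at least three edges. -/
def bifs : Finset (Fin G.numVert) :=
  Finset.univ.filter fun γ => 3 ≤ (G.I γ).card

/-- The two ends of edge `i` are labelled by a Boolean: `false` is the in-vertex (left end),
`true` is the out-vertex (right end). -/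
def vert (i : Fin G.N) (b : Bool) : Fin G.numVert := cond b (G.vout i) (G.vin i)

/-- The coordinate of an end of edge `i`. -/
def endPt (i : Fin G.N) (b : Bool) : ℝ := cond b (G.right i) (G.left i)

/-- The normal `n_i`: `-1` at the in-vertex and `+1` at the out-vertex. -/
def nrm (b : Bool) : ℝ := cond b 1 (-1)

/-- The end of edge `i` at which the vertex `γ` lies (for `i ∈ I_γ`). -/
def endAt (i : Fin G.N) (γ : Fin G.numVert) : Bool := decide (G.vout i = γ)

/-- The ends of the edge `i` that belong to `∂G`. -/
def bdryFaces (i : Fin G.N) : Finset Bool :=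
  Finset.univ.filter fun b => G.vert i b ∉ G.bifs

/-- Two edges are linked if they share a bifurcation node. -/
def Linked (i j : Fin G.N) : Prop := ∃ γ ∈ G.bifs, i ∈ G.I γ ∧ j ∈ G.I γ

/-- Every edge is joined, through a chain of edges sharing bifurcation nodes, to an edge with an
end in `∂G`, the set of end points of edges that are not bifurcations. -/
def ReachesBoundary : Prop :=
  ∀ i, ∃ j, Relation.ReflTransGen G.Linked i j ∧ ∃ b, G.vert j b ∉ G.bifs

/-- The diffusion coefficient: `κ i` is a representative of an element of `L^∞` of the edge `i`,
bounded below by a positive constant. -/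
def IsCoefficient (κ : Fin G.N → ℝ → ℝ) : Prop :=
  (∀ i, Measurable (κ i)) ∧
  (∃ c > 0, ∀ i, ∀ᵐ x ∂(volume.restrict (Ioo (G.left i) (G.right i))), c ≤ κ i x) ∧
  (∃ c, ∀ i, ∀ᵐ x ∂(volume.restrict (Ioo (G.left i) (G.right i))), κ i x ≤ c)

end Network

/-- A mesh: the edge `i` is cut at `left i = pt i 0 < pt i 1 < ⋯ < pt i (n i) = right i`. -/
structure Mesh (G : Network) where
  n : Fin G.N → ℕ
  n_pos : ∀ i, 0 < n i
  pt : ∀ i, Fin (n i + 1) → ℝ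
  strictMono : ∀ i, StrictMono (pt i)
  pt_zero : ∀ i, pt i 0 = G.left i
  pt_last : ∀ i, pt i (Fin.last (n i)) = G.right i

namespace Mesh

variable {G : Network} (M : Mesh G)

/-- Left end point of the mesh interval `K`. -/
def lo (i : Fin G.N) (K : Fin (M.n i)) : ℝ := M.pt i K.castSucc

/-- Right end point of the mesh interval `K`. -/
def hi (i : Fin G.N) (K : Fin (M.n i)) : ℝ := M.pt i K.succ

/-- Length of the mesh interval `K`. -/
def len (i : Fin G.N) (K : Fin (M.n i)) : ℝ := M.hi i K - M.lo i K

/-- The mesh interval at an end of the edge `i`. -/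
def endElem (i : Fin G.N) (b : Bool) : Fin (M.n i) :=
  cond b ⟨M.n i - 1, Nat.sub_lt (M.n_pos i) Nat.one_pos⟩ ⟨0, M.n_pos i⟩

/-- The interior mesh points of the edge `i`, given by the pair of successive intervals `(K, K')`
sharing the point; the point is `hi i K = lo i K'`. -/
def intFaces (i : Fin G.N) : Finset (Fin (M.n i) × Fin (M.n i)) :=
  Finset.univ.filter fun KK => KK.1.val + 1 = KK.2.val

/-- `h_F` at an interior mesh point: the larger length of the two neighbouring intervals. -/
def hInt (i : Fin G.N) (F : Fin (M.n i) × Fin (M.n i)) : ℝ := max (M.len i F.1) (M.len i F.2)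

/-- `h_F` at an end of the edge `i`. -/
def hBdry (i : Fin G.N) (b : Bool) : ℝ := M.len i (M.endElem i b)

/-- `h_γ`: the largest length of the mesh intervals that have `γ` as an end point. -/
def hBif (γ : Fin G.numVert) : ℝ := ⨆ i : {i // i ∈ G.I γ}, M.hBdry i.1 (G.endAt i.1 γ)

/-- Mesh regularity: any two mesh intervals that share a mesh point (an interior mesh point or a
bifurcation node) have lengths of ratio at most `σ`. -/
def ShapeRegular (σ : ℝ) : Prop :=
  (∀ i, ∀ F ∈ M.intFaces i,
    M.len i F.1 ≤ σ * M.len i F.2 ∧ M.len i F.2 ≤ σ * M.len i F.1) ∧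
  (∀ γ ∈ G.bifs, ∀ i ∈ G.I γ, ∀ j ∈ G.I γ,
    M.hBdry i (G.endAt i γ) ≤ σ * M.hBdry j (G.endAt j γ))

/-- The coefficient has one-sided limits at the mesh points. -/
def HasTraces (κ : Fin G.N → ℝ → ℝ) : Prop :=
  ∀ i K, ∀ x ∈ ({M.lo i K, M.hi i K} : Set ℝ),
    ∃ l, Tendsto (κ i) (𝓝[Ioo (M.lo i K) (M.hi i K)] x) (𝓝 l)

/-- The value at `x` of the coefficient, seen from inside the mesh interval `K`. -/
def kTrace (κ : Fin G.N → ℝ → ℝ) (i : Fin G.N) (K : Fin (M.n i)) (x : ℝ) : ℝ :=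
  limUnder (𝓝[Ioo (M.lo i K) (M.hi i K)] x) (κ i)

/-- The DG space `V_h^p`: a polynomial of degree at most `p` on every mesh interval. -/
abbrev V (p : ℕ) : Type :=
  (i : Fin G.N) → (K : Fin (M.n i)) → Polynomial.degreeLE ℝ (p : WithBot ℕ)

variable {M} {p : ℕ}

/-- `v|_K` at `x`. -/
def val (v : M.V p) (i : Fin G.N) (K : Fin (M.n i)) (x : ℝ) : ℝ :=
  (v i K : Polynomial ℝ).eval x

/-- `∂v|_K / ∂s` at `x`. -/
def dval (v : M.V p) (i : Fin G.N) (K : Fin (M.n i)) (x : ℝ) : ℝ :=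
  (v i K : Polynomial ℝ).derivative.eval x

/-- The trace of `κ_i ∂v/∂s` at `x` from inside the mesh interval `K`. -/
def flux (κ : Fin G.N → ℝ → ℝ) (v : M.V p) (i : Fin G.N) (K : Fin (M.n i)) (x : ℝ) : ℝ :=
  M.kTrace κ i K x * dval v i K x

/-- Jump at an interior mesh point. -/
def jumpInt (v : M.V p) (i : Fin G.N) (F : Fin (M.n i) × Fin (M.n i)) : ℝ :=
  val v i F.1 (M.hi i F.1) - val v i F.2 (M.hi i F.1)

/-- Average of `κ_i ∂v/∂s` at an interior mesh point. -/
def avgInt (κ : Fin G.N → ℝ → ℝ) (v : M.V p) (i : Fin G.N)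
    (F : Fin (M.n i) × Fin (M.n i)) : ℝ :=
  (1 / 2) * flux κ v i F.1 (M.hi i F.1) + (1 / 2) * flux κ v i F.2 (M.hi i F.1)

/-- `v_i` at an end of the edge `i`. -/
def valEnd (v : M.V p) (i : Fin G.N) (b : Bool) : ℝ := val v i (M.endElem i b) (G.endPt i b)

/-- `κ_i ∂v_i/∂s n_i` at an end of the edge `i`. -/
def fluxEnd (κ : Fin G.N → ℝ → ℝ) (v : M.V p) (i : Fin G.N) (b : Bool) : ℝ :=
  flux κ v i (M.endElem i b) (G.endPt i b) * Network.nrm b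

/-- Generalized jump `[v]_(i,j)` at the bifurcation `γ`. -/
def jumpBif (v : M.V p) (γ : Fin G.numVert) (ij : Fin G.N × Fin G.N) : ℝ :=
  valEnd v ij.1 (G.endAt ij.1 γ) - valEnd v ij.2 (G.endAt ij.2 γ)

/-- Generalized average `{σ(v)}_(i,j)` at the bifurcation `γ`. -/
def avgBif (κ : Fin G.N → ℝ → ℝ) (v : M.V p) (γ : Fin G.numVert) (ij : Fin G.N × Fin G.N) : ℝ :=
  fluxEnd κ v ij.1 (G.endAt ij.1 γ) - fluxEnd κ v ij.2 (G.endAt ij.2 γ)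

/-- `{σ(w)} ⊙ [v]` at the bifurcation `γ`. -/
def avgJump (κ : Fin G.N → ℝ → ℝ) (w v : M.V p) (γ : Fin G.numVert) : ℝ :=
  (1 / ((G.I γ).card : ℝ)) * ∑ ij ∈ G.D γ, avgBif κ w γ ij * jumpBif v γ ij

/-- `[w] ⊙ [v]` at the bifurcation `γ`. -/
def jumpJump (w v : M.V p) (γ : Fin G.numVert) : ℝ :=
  ∑ ij ∈ G.D γ, jumpBif w γ ij * jumpBif v γ ij

/-- The interior penalty form `a_i` on the edge `i`; `ηF i F` is the penalty parameter at the
mesh point of coordinate `F`. -/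
def aEdge (κ : Fin G.N → ℝ → ℝ) (ε : Fin G.N → ℝ) (ηF : Fin G.N → ℝ → ℝ) (i : Fin G.N)
    (w v : M.V p) : ℝ :=
  (∑ K, ∫ x in (M.lo i K)..(M.hi i K), κ i x * dval w i K x * dval v i K x)
  - (∑ F ∈ M.intFaces i, avgInt κ w i F * jumpInt v i F)
  - ε i * (∑ F ∈ M.intFaces i, avgInt κ v i F * jumpInt w i F)
  + (∑ F ∈ M.intFaces i, ηF i (M.hi i F.1) / M.hInt i F * (jumpInt w i F * jumpInt v i F))
  + (∑ b ∈ G.bdryFaces i, ηF i (G.endPt i b) / M.hBdry i b * (valEnd w i b * valEnd v i b))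
  - (∑ b ∈ G.bdryFaces i, fluxEnd κ w i b * valEnd v i b)
  - ε i * (∑ b ∈ G.bdryFaces i, fluxEnd κ v i b * valEnd w i b)

/-- The DG bilinear form of the edge-network. -/
def a (κ : Fin G.N → ℝ → ℝ) (ε : Fin G.N → ℝ) (ε₀ : ℝ) (ηF : Fin G.N → ℝ → ℝ)
    (ηΓ : Fin G.numVert → ℝ) (w v : M.V p) : ℝ :=
  (∑ i, aEdge κ ε ηF i w v)
  - (∑ γ ∈ G.bifs, avgJump κ w v γ)
  - ε₀ * (∑ γ ∈ G.bifs, avgJump κ v w γ)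
  + (∑ γ ∈ G.bifs, ηΓ γ / M.hBif γ * jumpJump w v γ)

/-- The square of the DG semi-norm on the edge `i`. -/
def dgSqEdge (ηF : Fin G.N → ℝ → ℝ) (i : Fin G.N) (v : M.V p) : ℝ :=
  (∑ K, ∫ x in (M.lo i K)..(M.hi i K), dval v i K x ^ 2)
  + (∑ F ∈ M.intFaces i, ηF i (M.hi i F.1) / M.hInt i F * jumpInt v i F ^ 2)
  + (∑ b ∈ G.bdryFaces i, ηF i (G.endPt i b) / M.hBdry i b * valEnd v i b ^ 2)

/-- The DG norm. -/
def dgNorm (ηF : Fin G.N → ℝ → ℝ) (ηΓ : Fin G.numVert → ℝ) (v : M.V p) : ℝ :=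
  Real.sqrt ((∑ i, dgSqEdge ηF i v)
    + ∑ γ ∈ G.bifs, ηΓ γ / M.hBif γ * ∑ ij ∈ G.D γ, jumpBif v γ ij ^ 2)

/-- The right-hand side `∑ i, ∫_{Ω_i} f_i v`. -/
def load (f : Fin G.N → ℝ → ℝ) (v : M.V p) : ℝ :=
  ∑ i, ∑ K, ∫ x in (M.lo i K)..(M.hi i K), f i x * val v i K x

end Mesh

end EdgeDG

/-! ## Plane-networks -/

namespace PlaneDG

/-- The plane, in which every surface has its own coordinate system. -/
abbrev E2 : Type := EuclideanSpace ℝ (Fin 2)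

/-- The ambient space. -/
abbrev E3 : Type := EuclideanSpace ℝ (Fin 3)

/-- The closed segment with the given unordered pair of end points. -/
def seg {E : Type} [AddCommGroup E] [Module ℝ E] (s : Sym2 E) : Set E :=
  convexHull ℝ {x | x ∈ s}

/-! ### Triangles -/

/-- A nondegenerate triangle, given by its three vertices. -/
abbrev Tri : Type := Affine.Triangle ℝ E2

namespace Tri

/-- The closed triangle. -/
def carrier (T : Tri) : Set E2 := convexHull ℝ (range T.points)

/-- The first end point of the edge opposite to vertex `e`. -/
def fst (T : Tri) (e : Fin 3) : E2 := T.points (e + 1)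

/-- The second end point of the edge opposite to vertex `e`. -/
def snd (T : Tri) (e : Fin 3) : E2 := T.points (e + 2)

/-- The edge opposite to vertex `e`, as an unordered pair of end points. -/
def edge (T : Tri) (e : Fin 3) : Sym2 E2 := s(T.fst e, T.snd e)

/-- The length of the edge opposite to vertex `e`. -/
def len (T : Tri) (e : Fin 3) : ℝ := dist (T.fst e) (T.snd e)

/-- The vector from the line through the edge to which vertex `e` is opposite, orthogonal to that
line and pointing away from vertex `e`. -/
def outward (T : Tri) (e : Fin 3) : E2 :=
  (T.fst e - T.points e)
    - (inner ℝ (T.snd e - T.fst e) (T.fst e - T.points e) / ‖T.snd e - T.fst e‖ ^ 2)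
      • (T.snd e - T.fst e)

/-- The outward unit normal on the edge opposite to vertex `e`. -/
def normal (T : Tri) (e : Fin 3) : E2 := ‖T.outward e‖⁻¹ • T.outward e

/-- Affine parametrization of the edge opposite to vertex `e` by `[0, 1]`. -/
def edgePt (T : Tri) (e : Fin 3) (t : ℝ) : E2 := AffineMap.lineMap (T.fst e) (T.snd e) t

/-- The integral of `g` over the edge opposite to vertex `e`, with respect to arc length. -/
def edgeInt (T : Tri) (e : Fin 3) (g : E2 → ℝ) : ℝ :=
  T.len e * ∫ t in (0 : ℝ)..1, g (T.edgePt e t)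

end Tri

/-- A polygonal domain: a connected open set that is the interior of its closure and whose
closure is a finite union of triangles. -/
def IsPolygonalDomain (Ω : Set E2) : Prop :=
  IsOpen Ω ∧ IsConnected Ω ∧ interior (closure Ω) = Ω ∧
    ∃ S : Set Tri, S.Finite ∧ closure Ω = ⋃ T ∈ S, T.carrier

/-- A network of planar polygonal surfaces.  The surface `i` is the polygonal domain `dom i` in
its own coordinate plane, embedded in space by the isometry `emb i`.  The bifurcations are
nondegenerate segments; each belongs to at least three surfaces and lies in the boundary of the
surfaces it belongs to. -/
structure Network where
  N : ℕ
  dom : Fin N → Set E2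
  polygonal : ∀ i, IsPolygonalDomain (dom i)
  emb : Fin N → E2 →ᵃⁱ[ℝ] E3
  bifs : Finset (Sym2 E3)
  nondegenerate : ∀ γ ∈ bifs, ¬ γ.IsDiag
  three_le : ∀ γ ∈ bifs, 3 ≤ {i | seg γ ⊆ emb i '' closure (dom i)}.ncard
  subset_boundary : ∀ γ ∈ bifs, ∀ i, seg γ ⊆ emb i '' closure (dom i) →
    seg γ ⊆ emb i '' frontier (dom i)

namespace Network

variable (G : Network)

open Classical in
/-- `I_γ`: the surfaces whose closure contains `γ`. -/
def I (γ : Sym2 E3) : Finset (Fin G.N) :=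
  Finset.univ.filter fun i => seg γ ⊆ G.emb i '' closure (G.dom i)

/-- `D_γ`: the ordered pairs `i < j` in `I_γ`. -/
def D (γ : Sym2 E3) : Finset (Fin G.N × Fin G.N) :=
  (G.I γ ×ˢ G.I γ).filter fun ij => ij.1 < ij.2

/-- The union of all bifurcations. -/
def bifSet : Set E3 := ⋃ γ ∈ G.bifs, seg γ

/-- Two surfaces are linked if they share a bifurcation. -/
def Linked (i j : Fin G.N) : Prop := ∃ γ ∈ G.bifs, i ∈ G.I γ ∧ j ∈ G.I γ

/-- Every surface is joined, through a chain of surfaces sharing bifurcations, to a surface whose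
boundary has a part in `∂G`, the boundaries of the surfaces without the bifurcations. -/
def ReachesBoundary : Prop :=
  ∀ i, ∃ j, Relation.ReflTransGen G.Linked i j ∧
    ((G.emb j '' frontier (G.dom j)) \ G.bifSet).Nonempty

/-- The diffusion coefficient: `κ i` is a representative of an element of `L^∞` of the surface
`i`, bounded below by a positive constant. -/
def IsCoefficient (κ : Fin G.N → E2 → ℝ) : Prop :=
  (∀ i, Measurable (κ i)) ∧
  (∃ c > 0, ∀ i, ∀ᵐ x ∂(volume.restrict (G.dom i)), c ≤ κ i x) ∧
  (∃ c, ∀ i, ∀ᵐ x ∂(volume.restrict (G.dom i)), κ i x ≤ c)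

end Network

/-- A conforming triangulation of every surface.  The triangulations match at the bifurcations:
each bifurcation is partitioned by the mesh edges of any surface that contains it, and any two
such surfaces give the same partition. -/
structure Mesh (G : Network) where
  n : Fin G.N → ℕ
  tri : ∀ i, Fin (n i) → Tri
  cover : ∀ i, ⋃ K, (tri i K).carrier = closure (G.dom i)
  disjoint_interior : ∀ i, Pairwise fun K K' =>
    Disjoint (interior (tri i K).carrier) (interior (tri i K').carrier)
  conforming : ∀ i, Pairwise fun K K' =>
    (tri i K).carrier ∩ (tri i K').carrier
      = convexHull ℝ (range (tri i K).points ∩ range (tri i K').points)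
  bif_partition : ∀ γ ∈ G.bifs, ∀ i ∈ G.I γ, ∀ y ∈ seg γ, ∃ K e,
    seg (((tri i K).edge e).map (G.emb i)) ⊆ seg γ ∧ y ∈ seg (((tri i K).edge e).map (G.emb i))
  bif_match : ∀ γ ∈ G.bifs, ∀ i ∈ G.I γ, ∀ j ∈ G.I γ, ∀ K e,
    seg (((tri i K).edge e).map (G.emb i)) ⊆ seg γ →
      ∃ K' e', ((tri j K').edge e').map (G.emb j) = ((tri i K).edge e).map (G.emb i)

namespace Mesh

variable {G : Network} (M : Mesh G)

/-- A local edge of the mesh of surface `i`: a triangle and one of its edges (labelled by the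
opposite vertex). -/
abbrev Loc (i : Fin G.N) : Type := Fin (M.n i) × Fin 3

/-- The mesh edge (in the coordinate plane) of a local edge. -/
def edge {i : Fin G.N} (F : M.Loc i) : Sym2 E2 := (M.tri i F.1).edge F.2

/-- The mesh edge, embedded in space. -/
def edge3 {i : Fin G.N} (F : M.Loc i) : Sym2 E3 := (M.edge F).map (G.emb i)

/-- `h_F`: the length of the edge. -/
def len {i : Fin G.N} (F : M.Loc i) : ℝ := (M.tri i F.1).len F.2

/-- The outward unit normal of the triangle on the edge. -/
def normal {i : Fin G.N} (F : M.Loc i) : E2 := (M.tri i F.1).normal F.2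

/-- `∫_F g` (arc length). -/
def faceInt {i : Fin G.N} (F : M.Loc i) (g : E2 → ℝ) : ℝ := (M.tri i F.1).edgeInt F.2 g

open Classical in
/-- The interior mesh edges of surface `i`.  An interior edge is shared by two triangles `K < K'`
and is represented by its two local edges, the first one on `K`; the fixed unit normal `n_F` is
the one pointing from `K` to `K'`. -/
def intFaces (i : Fin G.N) : Finset (M.Loc i × M.Loc i) :=
  Finset.univ.filter fun F => F.1.1 < F.2.1 ∧ M.edge F.1 = M.edge F.2

open Classical in
/-- The mesh edges of surface `i` that belong to `∂G`: those in the boundary of the surface and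
not in a bifurcation. -/
def bdryFaces (i : Fin G.N) : Finset (M.Loc i) :=
  Finset.univ.filter fun F =>
    seg (M.edge F) ⊆ frontier (G.dom i) ∧ ∀ γ ∈ G.bifs, ¬ seg (M.edge3 F) ⊆ seg γ

open Classical in
/-- The mesh edges in the bifurcation `γ`, for a pair `(i, j)` in `D_γ`.  Since `γ` lies in the
boundaries of both surfaces and the meshes match, every mesh edge in `γ` is the edge of exactly
one triangle of surface `i` and of exactly one triangle of surface `j`; it is represented by these
two local edges. -/
def bifFaces (γ : Sym2 E3) (i j : Fin G.N) : Finset (M.Loc i × M.Loc j) :=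
  Finset.univ.filter fun F => M.edge3 F.1 = M.edge3 F.2 ∧ seg (M.edge3 F.1) ⊆ seg γ

/-- Shape regularity: every triangle contains a ball of diameter at least `diam K / σ`. -/
def ShapeRegular (σ : ℝ) : Prop :=
  ∀ i K, ∃ c r, Metric.closedBall c r ⊆ (M.tri i K).carrier ∧
    Metric.diam (M.tri i K).carrier ≤ σ * (2 * r) ∧ 0 ≤ r

/-- The coefficient has, from inside every triangle, a limit at almost every point of the edges of
that triangle. -/
def HasTraces (κ : Fin G.N → E2 → ℝ) : Prop :=
  ∀ i K e, ∀ᵐ t ∂(volume.restrict (Icc (0 : ℝ) 1)),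
    ∃ l, Tendsto (κ i) (𝓝[interior (M.tri i K).carrier] ((M.tri i K).edgePt e t)) (𝓝 l)

/-- The value at `x` of the coefficient, seen from inside the triangle `K`. -/
def kTrace (κ : Fin G.N → E2 → ℝ) (i : Fin G.N) (K : Fin (M.n i)) (x : E2) : ℝ :=
  limUnder (𝓝[interior (M.tri i K).carrier] x) (κ i)

/-- The DG space `V_h^p`: a polynomial of total degree at most `p` on every triangle. -/
abbrev V (p : ℕ) : Type :=
  (i : Fin G.N) → (K : Fin (M.n i)) → MvPolynomial.restrictTotalDegree (Fin 2) ℝ p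

variable {M} {p : ℕ}

/-- `v|_K` at `x`. -/
def val (v : M.V p) (i : Fin G.N) (K : Fin (M.n i)) (x : E2) : ℝ :=
  MvPolynomial.eval (fun k => x k) (v i K : MvPolynomial (Fin 2) ℝ)

/-- `∇v|_K` at `x`. -/
def grad (v : M.V p) (i : Fin G.N) (K : Fin (M.n i)) (x : E2) : E2 :=
  WithLp.toLp 2 fun l =>
    MvPolynomial.eval (fun k => x k) (MvPolynomial.pderiv l (v i K : MvPolynomial (Fin 2) ℝ))

/-- The trace of `κ_i ∇v · n` at `x` from inside the triangle `K`. -/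
def flux (κ : Fin G.N → E2 → ℝ) (v : M.V p) (i : Fin G.N) (K : Fin (M.n i)) (n : E2) (x : E2) :
    ℝ :=
  M.kTrace κ i K x * inner ℝ (grad v i K x) n

/-- Jump on an interior edge. -/
def jumpInt (v : M.V p) (i : Fin G.N) (F : M.Loc i × M.Loc i) (x : E2) : ℝ :=
  val v i F.1.1 x - val v i F.2.1 x

/-- Average of `κ_i ∇v · n_F` on an interior edge. -/
def avgInt (κ : Fin G.N → E2 → ℝ) (v : M.V p) (i : Fin G.N) (F : M.Loc i × M.Loc i) (x : E2) :
    ℝ :=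
  (1 / 2) * flux κ v i F.1.1 (M.normal F.1) x + (1 / 2) * flux κ v i F.2.1 (M.normal F.1) x

/-- The point of the coordinate plane of surface `j` that is the same point in space as the point
`x` of the coordinate plane of surface `i`. -/
def transfer (G : Network) (i j : Fin G.N) (x : E2) : E2 :=
  Function.invFun (G.emb j) (G.emb i x)

/-- Generalized jump `[v]_(i,j)` on a mesh edge in a bifurcation; `x` is in the coordinates of
surface `i`. -/
def jumpBif (v : M.V p) (i j : Fin G.N) (F : M.Loc i × M.Loc j) (x : E2) : ℝ :=
  val v i F.1.1 x - val v j F.2.1 (transfer G i j x)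

/-- Generalized average `{σ(v)}_(i,j)` on a mesh edge in a bifurcation. -/
def avgBif (κ : Fin G.N → E2 → ℝ) (v : M.V p) (i j : Fin G.N) (F : M.Loc i × M.Loc j) (x : E2) :
    ℝ :=
  flux κ v i F.1.1 (M.normal F.1) x - flux κ v j F.2.1 (M.normal F.2) (transfer G i j x)

/-- `∑_F ∫_F {σ(w)} ⊙ [v]` over the mesh edges `F` in the bifurcation `γ`. -/
def avgJump (κ : Fin G.N → E2 → ℝ) (w v : M.V p) (γ : Sym2 E3) : ℝ :=
  (1 / ((G.I γ).card : ℝ)) * ∑ ij ∈ G.D γ, ∑ F ∈ M.bifFaces γ ij.1 ij.2,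
    M.faceInt F.1 fun x => avgBif κ w ij.1 ij.2 F x * jumpBif v ij.1 ij.2 F x

/-- `∑_F h_F⁻¹ ∫_F [w] ⊙ [v]` over the mesh edges `F` in the bifurcation `γ`. -/
def jumpJump (w v : M.V p) (γ : Sym2 E3) : ℝ :=
  ∑ ij ∈ G.D γ, ∑ F ∈ M.bifFaces γ ij.1 ij.2,
    1 / M.len F.1 * M.faceInt F.1 fun x => jumpBif w ij.1 ij.2 F x * jumpBif v ij.1 ij.2 F x

/-- The interior penalty form `a_i` on the surface `i`; `ηF i F` is the penalty parameter of the
mesh edge `F`. -/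
def aSurf (κ : Fin G.N → E2 → ℝ) (ε : Fin G.N → ℝ) (ηF : Fin G.N → Sym2 E2 → ℝ) (i : Fin G.N)
    (w v : M.V p) : ℝ :=
  (∑ K, ∫ x in (M.tri i K).carrier, κ i x * inner ℝ (grad w i K x) (grad v i K x))
  - (∑ F ∈ M.intFaces i, M.faceInt F.1 fun x => avgInt κ w i F x * jumpInt v i F x)
  - ε i * (∑ F ∈ M.intFaces i, M.faceInt F.1 fun x => avgInt κ v i F x * jumpInt w i F x)
  + (∑ F ∈ M.intFaces i, ηF i (M.edge F.1) / M.len F.1 *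
      M.faceInt F.1 fun x => jumpInt w i F x * jumpInt v i F x)
  - (∑ F ∈ M.bdryFaces i, M.faceInt F fun x => flux κ w i F.1 (M.normal F) x * val v i F.1 x)
  - ε i * (∑ F ∈ M.bdryFaces i,
      M.faceInt F fun x => flux κ v i F.1 (M.normal F) x * val w i F.1 x)
  + (∑ F ∈ M.bdryFaces i, ηF i (M.edge F) / M.len F *
      M.faceInt F fun x => val w i F.1 x * val v i F.1 x)

/-- The DG bilinear form of the plane-network. -/
def a (κ : Fin G.N → E2 → ℝ) (ε : Fin G.N → ℝ) (ε₀ : ℝ) (ηF : Fin G.N → Sym2 E2 → ℝ)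
    (ηΓ : Sym2 E3 → ℝ) (w v : M.V p) : ℝ :=
  (∑ i, aSurf κ ε ηF i w v)
  - (∑ γ ∈ G.bifs, avgJump κ w v γ)
  - ε₀ * (∑ γ ∈ G.bifs, avgJump κ v w γ)
  + (∑ γ ∈ G.bifs, ηΓ γ * jumpJump w v γ)

/-- The square of the DG semi-norm on the surface `i`. -/
def dgSqSurf (ηF : Fin G.N → Sym2 E2 → ℝ) (i : Fin G.N) (v : M.V p) : ℝ :=
  (∑ K, ∫ x in (M.tri i K).carrier, ‖grad v i K x‖ ^ 2)
  + (∑ F ∈ M.intFaces i, ηF i (M.edge F.1) / M.len F.1 *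
      M.faceInt F.1 fun x => jumpInt v i F x ^ 2)
  + (∑ F ∈ M.bdryFaces i, ηF i (M.edge F) / M.len F * M.faceInt F fun x => val v i F.1 x ^ 2)

/-- The DG norm. -/
def dgNorm (ηF : Fin G.N → Sym2 E2 → ℝ) (ηΓ : Sym2 E3 → ℝ) (v : M.V p) : ℝ :=
  Real.sqrt ((∑ i, dgSqSurf ηF i v)
    + ∑ γ ∈ G.bifs, ηΓ γ * ∑ ij ∈ G.D γ, ∑ F ∈ M.bifFaces γ ij.1 ij.2,
        1 / M.len F.1 * M.faceInt F.1 fun x => jumpBif v ij.1 ij.2 F x ^ 2)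

/-- The right-hand side `∑ i, ∫_{Ω_i} f_i v`. -/
def load (f : Fin G.N → E2 → ℝ) (v : M.V p) : ℝ :=
  ∑ i, ∑ K, ∫ x in (M.tri i K).carrier, f i x * val v i K x

end Mesh

end PlaneDG

end

/-! On the diagonal the form is the weighted Dirichlet energy, minus `1 + ε` times the consistency
terms, plus the penalties. A consistency term pairs a flux trace with a jump, and Young's inequality
with weight `δ h` bounds it by `δ h flux² + jump² / (δ h)`. The second part is `δ⁻¹` times the
penalty with parameter one. The first part is controlled by an inverse trace inequality: for
polynomials of degree at most `p` it is at most a constant times the energy of the adjacent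
elements, where the constant depends on `p`, on the bound of `κ` and on the mesh regularity, but not
on the mesh. Since an element takes part in boundedly many faces, summation keeps the constants
uniform. A small `δ` then hides the fluxes in half of the energy, and `η₀ = 4 / δ` hides the jumps
in a quarter of the penalties. If `ε i = -1`, the consistency terms of domain `i` cancel, and no
lower bound on its penalties is needed.

The inverse inequality rests on finite dimension. On a fixed reference set the `L²` product of
polynomials is definite, so point evaluations are bounded; scaling carries this to every element. In
the plane the reference set is the unit disk: shape regularity puts a disk of comparable size inside
each triangle, so homotheties suffice.

The discrete space has finite dimension, so unique solvability follows once the DG norm is shown to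
be definite. Zero energy makes a function constant on each element, zero jumps glue the constants
inside a domain and across bifurcations, and a face in `∂G` makes them zero. In the plane this needs
two facts about triangulations. Triangles of a domain are connected through common edges, because a
connected open set minus the finitely many mesh vertices stays connected (`eq_of_eq_on_adjacent`). A
boundary point off the bifurcations lies on a mesh edge that belongs to `∂G` (`bdryFaces_nonempty`).
-/

/-! ## Bilinear forms given by formulas -/

/-- A real-valued function of two vectors is bilinear. -/
structure IsBilin {V : Type*} [AddCommGroup V] [Module ℝ V] (f : V → V → ℝ) : Prop where
  add_left : ∀ u u' v, f (u + u') v = f u v + f u' v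
  smul_left : ∀ (c : ℝ) u v, f (c • u) v = c * f u v
  add_right : ∀ u v v', f u (v + v') = f u v + f u v'
  smul_right : ∀ (c : ℝ) u v, f u (c • v) = c * f u v

/-- A real-valued function of a vector is linear. -/
structure IsLin {V : Type*} [AddCommGroup V] [Module ℝ V] (f : V → ℝ) : Prop where
  add : ∀ u u', f (u + u') = f u + f u'
  smul : ∀ (c : ℝ) u, f (c • u) = c * f u

section Bilin

variable {V : Type*} [AddCommGroup V] [Module ℝ V]

namespace IsLin

theorem sum {ι : Type*} (s : Finset ι) {f : ι → V → ℝ} (hf : ∀ i ∈ s, IsLin (f i)) :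
    IsLin fun v => ∑ i ∈ s, f i v where
  add u u' := by
    rw [← Finset.sum_add_distrib]; exact Finset.sum_congr rfl fun i hi => (hf i hi).add u u'
  smul c u := by
    rw [Finset.mul_sum]; exact Finset.sum_congr rfl fun i hi => (hf i hi).smul c u

theorem sub {f g : V → ℝ} (hf : IsLin f) (hg : IsLin g) : IsLin fun v => f v - g v where
  add u u' := by rw [hf.add, hg.add]; ring
  smul c u := by rw [hf.smul, hg.smul]; ring

theorem add' {f g : V → ℝ} (hf : IsLin f) (hg : IsLin g) : IsLin fun v => f v + g v where
  add u u' := by rw [hf.add, hg.add]; ring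
  smul c u := by rw [hf.smul, hg.smul]; ring

theorem const_mul {f : V → ℝ} (hf : IsLin f) (r : ℝ) : IsLin fun v => r * f v where
  add u u' := by rw [hf.add]; ring
  smul c u := by rw [hf.smul]; ring

theorem mul_const {f : V → ℝ} (hf : IsLin f) (r : ℝ) : IsLin fun v => f v * r where
  add u u' := by rw [hf.add]; ring
  smul c u := by rw [hf.smul]; ring

theorem mul {f g : V → ℝ} (hf : IsLin f) (hg : IsLin g) : IsBilin fun u v => f u * g v where
  add_left u u' v := by rw [hf.add]; ring
  smul_left c u v := by rw [hf.smul]; ring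
  add_right u v v' := by rw [hg.add]; ring
  smul_right c u v := by rw [hg.smul]; ring

theorem integral {α : Type*} [MeasurableSpace α] {μ : Measure α} {f : α → V → ℝ}
    (hf : ∀ t, IsLin (f t)) (hi : ∀ v, Integrable (fun t => f t v) μ) :
    IsLin fun v => ∫ t, f t v ∂μ where
  add u u' := by
    rw [← integral_add (hi u) (hi u')]; exact integral_congr_ae (.of_forall fun t => (hf t).add u u')
  smul c u := by
    rw [← integral_const_mul]; exact integral_congr_ae (.of_forall fun t => (hf t).smul c u)

end IsLin

namespace IsBilin

theorem sum {ι : Type*} (s : Finset ι) {f : ι → V → V → ℝ} (hf : ∀ i ∈ s, IsBilin (f i)) :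
    IsBilin fun u v => ∑ i ∈ s, f i u v where
  add_left u u' v := by
    rw [← Finset.sum_add_distrib]; exact Finset.sum_congr rfl fun i hi => (hf i hi).add_left u u' v
  smul_left c u v := by
    rw [Finset.mul_sum]; exact Finset.sum_congr rfl fun i hi => (hf i hi).smul_left c u v
  add_right u v v' := by
    rw [← Finset.sum_add_distrib]; exact Finset.sum_congr rfl fun i hi => (hf i hi).add_right u v v'
  smul_right c u v := by
    rw [Finset.mul_sum]; exact Finset.sum_congr rfl fun i hi => (hf i hi).smul_right c u v

theorem swap {f : V → V → ℝ} (hf : IsBilin f) : IsBilin fun u v => f v u :=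
  ⟨fun u u' v => hf.add_right v u u', fun c u v => hf.smul_right c v u,
    fun u v v' => hf.add_left v v' u, fun c u v => hf.smul_left c v u⟩

theorem sub {f g : V → V → ℝ} (hf : IsBilin f) (hg : IsBilin g) :
    IsBilin fun u v => f u v - g u v where
  add_left u u' v := by rw [hf.add_left, hg.add_left]; ring
  smul_left c u v := by rw [hf.smul_left, hg.smul_left]; ring
  add_right u v v' := by rw [hf.add_right, hg.add_right]; ring
  smul_right c u v := by rw [hf.smul_right, hg.smul_right]; ring

theorem add {f g : V → V → ℝ} (hf : IsBilin f) (hg : IsBilin g) :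
    IsBilin fun u v => f u v + g u v where
  add_left u u' v := by rw [hf.add_left, hg.add_left]; ring
  smul_left c u v := by rw [hf.smul_left, hg.smul_left]; ring
  add_right u v v' := by rw [hf.add_right, hg.add_right]; ring
  smul_right c u v := by rw [hf.smul_right, hg.smul_right]; ring

theorem const_mul {f : V → V → ℝ} (hf : IsBilin f) (r : ℝ) : IsBilin fun u v => r * f u v where
  add_left u u' v := by rw [hf.add_left]; ring
  smul_left c u v := by rw [hf.smul_left]; ring
  add_right u v v' := by rw [hf.add_right]; ring
  smul_right c u v := by rw [hf.smul_right]; ring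

/-- Additivity of the Bochner integral needs integrable integrands. This is why measurability and
boundedness of the coefficient and of its traces have to be established later. -/
theorem integral {α : Type*} [MeasurableSpace α] {μ : Measure α} {f : α → V → V → ℝ}
    (hf : ∀ t, IsBilin (f t)) (hi : ∀ u v, Integrable (fun t => f t u v) μ) :
    IsBilin fun u v => ∫ t, f t u v ∂μ where
  add_left u u' v := by
    rw [← integral_add (hi u v) (hi u' v)]
    exact integral_congr_ae (.of_forall fun t => (hf t).add_left u u' v)
  smul_left c u v := by
    rw [← integral_const_mul]; exact integral_congr_ae (.of_forall fun t => (hf t).smul_left c u v)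
  add_right u v v' := by
    rw [← integral_add (hi u v) (hi u v')]
    exact integral_congr_ae (.of_forall fun t => (hf t).add_right u v v')
  smul_right c u v := by
    rw [← integral_const_mul]; exact integral_congr_ae (.of_forall fun t => (hf t).smul_right c u v)

/-- The linear map into the dual space given by a bilinear form. -/
def toLin {f : V → V → ℝ} (hf : IsBilin f) : V →ₗ[ℝ] V →ₗ[ℝ] ℝ :=
  LinearMap.mk₂ ℝ f hf.add_left hf.smul_left hf.add_right hf.smul_right

theorem toLin_apply {f : V → V → ℝ} (hf : IsBilin f) (u v : V) : hf.toLin u v = f u v := rfl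

/-- A definite bilinear form on a finite-dimensional space represents every linear functional. -/
theorem existsUnique_of_definite [Module.Finite ℝ V] {f : V → V → ℝ} (hf : IsBilin f)
    (hd : ∀ u, f u u = 0 → u = 0) {ℓ : V → ℝ} (hℓ : IsLin ℓ) : ∃! u, ∀ v, f u v = ℓ v := by
  have hinj : Function.Injective hf.toLin := by
    rw [← LinearMap.ker_eq_bot, LinearMap.ker_eq_bot']
    intro u hu
    refine hd u ?_
    rw [← hf.toLin_apply, hu, LinearMap.zero_apply]
  -- Definiteness gives injectivity into the dual; equal dimensions turn it into surjectivity.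
  have hfr : Module.finrank ℝ V = Module.finrank ℝ (V →ₗ[ℝ] ℝ) :=
    (Subspace.dual_finrank_eq (K := ℝ) (V := V)).symm
  obtain ⟨u, hu⟩ := (LinearMap.injective_iff_surjective_of_finrank_eq_finrank hfr).1 hinj
    (⟨⟨ℓ, hℓ.add⟩, hℓ.smul⟩ : V →ₗ[ℝ] ℝ)
  refine ⟨u, fun v => LinearMap.congr_fun hu v, fun w hw => hinj ?_⟩
  rw [hu]
  ext v
  exact hw v

/-- Every linear functional on a finite-dimensional space is bounded with respect to a symmetric
positive definite bilinear form. -/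
theorem exists_sq_le [Module.Finite ℝ V] {f : V → V → ℝ} (hf : IsBilin f)
    (hs : ∀ u v, f u v = f v u) (hn : ∀ u, 0 ≤ f u u) (hd : ∀ u, f u u = 0 → u = 0) {ℓ : V → ℝ}
    (hℓ : IsLin ℓ) : ∃ C, 0 ≤ C ∧ ∀ v, ℓ v ^ 2 ≤ C * f v v := by
  obtain ⟨u, hu, -⟩ := hf.existsUnique_of_definite hd hℓ
  -- `u` is the Riesz representative of `ℓ`, so Cauchy–Schwarz gives its squared norm as the
  -- constant.
  refine ⟨f u u, hn u, fun v => ?_⟩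
  rw [← hu v]
  have := LinearMap.BilinForm.apply_sq_le_of_symm hf.toLin hn ⟨hs⟩ u v
  exact this

end IsBilin

end Bilin

/-! ### Absorption of the consistency terms -/

/-- Expansion of a weighted square. The weight `s` will be `δ` times a mesh size, which turns the
two terms into an inverse trace term and a penalty term. -/
theorem two_mul_abs_mul_le {a b s : ℝ} (hs : 0 < s) : 2 * |a * b| ≤ s * a ^ 2 + b ^ 2 / s := by
  have h : 0 ≤ (s * |a| - |b|) ^ 2 / s := by positivity
  have : (s * |a| - |b|) ^ 2 / s = s * a ^ 2 + b ^ 2 / s - 2 * |a * b| := by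
    rw [abs_mul, ← sq_abs a, ← sq_abs b]; field_simp; ring
  linarith

/-- Absorption of the consistency terms `x`, `y` by the energies `g` and the penalties `j`, `z`. -/
theorem interior_penalty_coercive {ι : Type*} [Fintype ι] {c y z ε₀ : ℝ} {A g x j ε : ι → ℝ}
    (hA : ∀ i, c * g i ≤ A i) (hz : 0 ≤ z) (hj : ∀ i, 0 ≤ j i)
    (hε : ∀ i, ε i ∈ ({-1, 0, 1} : Set ℝ)) (hε₀ : ε₀ ∈ ({-1, 0, 1} : Set ℝ)) (hg : ∀ i, 0 ≤ c * g i)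
    (hx : ∀ i, ε i = 0 ∨ ε i = 1 → 2 * |x i| ≤ c / 4 * g i + j i / 4)
    (hy : 2 * |y| ≤ c / 4 * ∑ i, g i + z / 4) :
    c / 2 * ∑ i, g i + (3 / 4) * (∑ i, j i + z) ≤
      ∑ i, (A i - (1 + ε i) * x i + j i) - (1 + ε₀) * y + z := by
  -- The terms `x i` use up a quarter of the energy and of their own penalties; the term `y` will
  -- use another quarter of the energy.
  have h1 : ∑ i, (3 * c / 4 * g i + 3 / 4 * j i) ≤ ∑ i, (A i - (1 + ε i) * x i + j i) := by
    refine Finset.sum_le_sum fun i _ => ?_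
    have := hA i
    have := hg i
    have := hj i
    rcases hε i with h | h | h
    · rw [h]; linarith
    · have := hx i (.inl h)
      rw [h]
      have := le_abs_self (x i)
      have := abs_nonneg (x i)
      linarith
    · have := hx i (.inr h)
      rw [h]
      have := le_abs_self (x i)
      linarith
  have h2 : (1 + ε₀) * y ≤ 2 * |y| := by
    have := le_abs_self y
    have := abs_nonneg y
    rcases hε₀ with h | h | h <;> rw [h] <;> linarith
  rw [Finset.sum_add_distrib, ← Finset.mul_sum, ← Finset.mul_sum] at h1
  linarith

/-! ## Limits and integrals of functions on open sets -/

section Generic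

variable {X : Type*} [TopologicalSpace X] [MeasurableSpace X] {μ : Measure X}
  [μ.IsOpenPosMeasure]

/-- Values outside `[a, b]` occur only on a null subset of `U`, while each neighbourhood of `x`
meets `U` in a nonempty open set, which has positive measure. So values inside `[a, b]` occur
arbitrarily close to `x`. This turns the essential bounds of `κ` into pointwise bounds of its
traces. -/
theorem mem_Icc_of_tendsto_nhdsWithin {κ : X → ℝ} {U : Set X} (hU : IsOpen U) {x : X}
    (hx : x ∈ closure U) {a b l : ℝ} (hκ : ∀ᵐ y ∂(μ.restrict U), κ y ∈ Icc a b)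
    (hl : Tendsto κ (𝓝[U] x) (𝓝 l)) : l ∈ Icc a b := by
  refine isClosed_Icc.mem_of_frequently_of_tendsto ?_ hl
  intro hne
  rw [eventually_nhdsWithin_iff, eventually_nhds_iff] at hne
  obtain ⟨O, hO, hOo, hxO⟩ := hne
  have hpos : μ (O ∩ U) ≠ 0 := ((hOo.inter hU).measure_pos μ (mem_closure_iff.1 hx O hOo hxO)).ne'
  have h1 : μ.restrict U {y | ¬ κ y ∈ Icc a b} = 0 := hκ
  have h2 : O ∩ U ⊆ {y | ¬ κ y ∈ Icc a b} := fun y hy => hO y hy.1 hy.2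
  have h3 := measure_mono_null h2 h1
  rw [Measure.restrict_eq_self μ inter_subset_right] at h3
  exact hpos h3

/-- The integrand vanishes almost everywhere, and continuity on the open set removes the exceptional
set. `s` will be a closed element or a half-open interval, `U` its interior. -/
theorem eqOn_zero_of_setIntegral_eq_zero {f : X → ℝ} {U s : Set X} (hU : IsOpen U) (hUs : U ⊆ s)
    (hf : ContinuousOn f U) (h0 : ∀ x, 0 ≤ f x) (hi : IntegrableOn f s μ)
    (h : ∫ x in s, f x ∂μ = 0) : EqOn f 0 U := by
  have h1 := (setIntegral_eq_zero_iff_of_nonneg_ae (.of_forall h0) hi).1 h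
  exact Measure.eqOn_open_of_ae_eq (ae_restrict_of_ae_restrict_of_subset hUs h1) hU hf
    continuousOn_const

end Generic

/-! ## Polynomials of one variable on an interval -/

theorem finite_degreeLE (p : ℕ) :
    Module.Finite ℝ (Polynomial.degreeLE ℝ (p : WithBot ℕ)) := by
  have : Polynomial.degreeLE ℝ (p : WithBot ℕ) = Polynomial.degreeLT ℝ (p + 1) := by
    ext q
    rw [Polynomial.mem_degreeLE, Polynomial.mem_degreeLT, ← Polynomial.natDegree_le_iff_degree_le,
      ← Nat.lt_succ_iff]
    by_cases hq : q = 0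
    · simp [hq]
    · rw [← Polynomial.natDegree_lt_iff_degree_lt hq]
  rw [this]
  exact Module.Finite.of_basis (Polynomial.degreeLT.basis ℝ (p + 1))

/-- A polynomial with zero `L²(0,1)` norm has infinitely many roots, so the `L²` product is
definite, and evaluation at an end point is a bounded functional by `IsBilin.exists_sq_le`. -/
theorem exists_eval_sq_le_integral (p : ℕ) : ∃ C, 0 ≤ C ∧
    ∀ q ∈ Polynomial.degreeLE ℝ (p : WithBot ℕ), ∀ x ∈ ({0, 1} : Set ℝ),
      q.eval x ^ 2 ≤ C * ∫ t in (0 : ℝ)..1, q.eval t ^ 2 := by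
  let V := Polynomial.degreeLE ℝ (p : WithBot ℕ)
  have hfin : Module.Finite ℝ V := finite_degreeLE p
  have heval : ∀ x : ℝ, IsLin fun q : V => (q : Polynomial ℝ).eval x := fun x =>
    ⟨fun q r => by simp, fun c q => by simp⟩
  have hcont : ∀ q r : V, Continuous fun t => (q : Polynomial ℝ).eval t * (r : Polynomial ℝ).eval t :=
    fun q r => by fun_prop
  have hb : IsBilin fun q r : V =>
      ∫ t in Ioc (0 : ℝ) 1, (q : Polynomial ℝ).eval t * (r : Polynomial ℝ).eval t :=
    IsBilin.integral (fun t => (heval t).mul (heval t)) fun q r =>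
      ((hcont q r).continuousOn.integrableOn_compact isCompact_Icc).mono_set Ioc_subset_Icc_self
  have hd : ∀ q : V, ∫ t in Ioc (0 : ℝ) 1, (q : Polynomial ℝ).eval t * (q : Polynomial ℝ).eval t = 0
      → q = 0 := by
    intro q hq
    have h := eqOn_zero_of_setIntegral_eq_zero isOpen_Ioo Ioo_subset_Ioc_self
      (hcont q q).continuousOn (fun x => mul_self_nonneg _)
      (((hcont q q).continuousOn.integrableOn_compact isCompact_Icc).mono_set Ioc_subset_Icc_self) hq
    refine Subtype.ext (Polynomial.eq_zero_of_infinite_isRoot _ ((Ioo_infinite one_pos).mono ?_))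
    intro x hx
    exact mul_self_eq_zero.1 (h hx)
  have key := fun x => hb.exists_sq_le (fun q r => by simp_rw [mul_comm])
    (fun q => integral_nonneg fun t => mul_self_nonneg _) hd (heval x)
  obtain ⟨C₀, h₀, hC₀⟩ := key 0
  obtain ⟨C₁, h₁, hC₁⟩ := key 1
  refine ⟨C₀ + C₁, by positivity, fun q hq x hx => ?_⟩
  have e : ∫ t in (0 : ℝ)..1, q.eval t ^ 2 = ∫ t in Ioc (0 : ℝ) 1, q.eval t * q.eval t := by
    rw [intervalIntegral.integral_of_le zero_le_one]; simp_rw [sq]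
  have hn : 0 ≤ ∫ t in Ioc (0 : ℝ) 1, q.eval t * q.eval t :=
    integral_nonneg fun t => mul_self_nonneg _
  rw [e, add_mul]
  have := mul_nonneg h₀ hn
  have := mul_nonneg h₁ hn
  rcases hx with rfl | rfl
  · have := hC₀ ⟨q, hq⟩; simp only at this; linarith
  · have := hC₁ ⟨q, hq⟩; simp only at this; linarith

/-- Inverse trace inequality on an interval. -/
theorem exists_length_mul_eval_sq_le (p : ℕ) : ∃ C, 0 ≤ C ∧
    ∀ q ∈ Polynomial.degreeLE ℝ (p : WithBot ℕ), ∀ a b : ℝ, a < b → ∀ x ∈ ({a, b} : Set ℝ),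
      (b - a) * q.eval x ^ 2 ≤ C * ∫ t in a..b, q.eval t ^ 2 := by
  obtain ⟨C, hC, h⟩ := exists_eval_sq_le_integral p
  refine ⟨C, hC, fun q hq a b hab x hx => ?_⟩
  have hba : 0 < b - a := sub_pos.2 hab
  -- The affine substitution from `[0, 1]` to `[a, b]` keeps the degree bound and produces the
  -- factor `b - a`.
  let r : Polynomial ℝ := Polynomial.C a + Polynomial.C (b - a) * Polynomial.X
  have hr : q.comp r ∈ Polynomial.degreeLE ℝ (p : WithBot ℕ) := by
    rw [Polynomial.mem_degreeLE, ← Polynomial.natDegree_le_iff_degree_le] at hq ⊢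
    refine Polynomial.natDegree_comp_le.trans ?_
    have : r.natDegree ≤ 1 := by simp only [r]; compute_degree
    nlinarith
  have he : ∀ t, (q.comp r).eval t = q.eval (a + (b - a) * t) := fun t => by simp [r]
  have hi : ∫ t in (0 : ℝ)..1, (q.comp r).eval t ^ 2 = (b - a)⁻¹ * ∫ t in a..b, q.eval t ^ 2 := by
    simp_rw [he]
    rw [intervalIntegral.integral_comp_add_mul (fun t => q.eval t ^ 2) hba.ne' a]
    simp
  have : q.eval x ^ 2 ≤ C * ((b - a)⁻¹ * ∫ t in a..b, q.eval t ^ 2) := by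
    rw [← hi]
    rcases hx with rfl | rfl
    · have := h _ hr 0 (by simp); rwa [he, mul_zero, add_zero] at this
    · have := h _ hr 1 (by simp); rwa [he, mul_one, add_sub_cancel] at this
  calc (b - a) * q.eval x ^ 2 ≤ (b - a) * (C * ((b - a)⁻¹ * ∫ t in a..b, q.eval t ^ 2)) := by gcongr
    _ = C * ∫ t in a..b, q.eval t ^ 2 := by field_simp

/-! ## Edge-networks -/

namespace EdgeDG.Mesh

variable {G : Network} {M : Mesh G} {p : ℕ}

theorem lo_lt_hi (M : Mesh G) (i : Fin G.N) (K : Fin (M.n i)) : M.lo i K < M.hi i K :=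
  M.strictMono i K.castSucc_lt_succ

theorem len_pos (M : Mesh G) (i : Fin G.N) (K : Fin (M.n i)) : 0 < M.len i K :=
  sub_pos.2 (M.lo_lt_hi i K)

theorem left_le_lo (M : Mesh G) (i : Fin G.N) (K : Fin (M.n i)) : G.left i ≤ M.lo i K := by
  rw [← M.pt_zero i]; exact (M.strictMono i).monotone (Fin.zero_le _)

theorem hi_le_right (M : Mesh G) (i : Fin G.N) (K : Fin (M.n i)) : M.hi i K ≤ G.right i := by
  rw [← M.pt_last i]; exact (M.strictMono i).monotone (Fin.le_last _)

theorem Ioo_subset (M : Mesh G) (i : Fin G.N) (K : Fin (M.n i)) :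
    Ioo (M.lo i K) (M.hi i K) ⊆ Ioo (G.left i) (G.right i) :=
  Ioo_subset_Ioo (M.left_le_lo i K) (M.hi_le_right i K)

theorem ae_of_ae_edge (M : Mesh G) {i : Fin G.N} (K : Fin (M.n i)) {P : ℝ → Prop}
    (h : ∀ᵐ x ∂(volume.restrict (Ioo (G.left i) (G.right i))), P x) :
    ∀ᵐ x ∂(volume.restrict (Ioc (M.lo i K) (M.hi i K))), P x := by
  rw [← Measure.restrict_congr_set (Ioo_ae_eq_Ioc (a := M.lo i K) (b := M.hi i K) (μ := volume))]
  exact ae_restrict_of_ae_restrict_of_subset (M.Ioo_subset i K) h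

theorem hi_eq_lo {i : Fin G.N} {F : Fin (M.n i) × Fin (M.n i)} (hF : F ∈ M.intFaces i) :
    M.hi i F.1 = M.lo i F.2 := by
  have h : F.1.val + 1 = F.2.val := (Finset.mem_filter.1 hF).2
  rw [hi, lo]
  congr 1
  ext
  simp [h]

theorem endPt_mem (M : Mesh G) (i : Fin G.N) (b : Bool) :
    G.endPt i b ∈ ({M.lo i (M.endElem i b), M.hi i (M.endElem i b)} : Set ℝ) := by
  cases b
  · left
    rw [Network.endPt, cond_false, ← M.pt_zero i, lo, endElem, cond_false]
    rfl
  · right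
    rw [Set.mem_singleton_iff, Network.endPt, cond_true, ← M.pt_last i, hi, endElem, cond_true]
    congr 1
    ext
    simp only [Fin.val_last, Fin.succ_mk]
    have := M.n_pos i
    omega

theorem hBdry_pos (M : Mesh G) (i : Fin G.N) (b : Bool) : 0 < M.hBdry i b := M.len_pos i _

theorem hInt_pos (M : Mesh G) (i : Fin G.N) (F : Fin (M.n i) × Fin (M.n i)) : 0 < M.hInt i F :=
  lt_max_of_lt_left (M.len_pos i _)

theorem hBdry_le_hBif (M : Mesh G) {γ : Fin G.numVert} {i : Fin G.N} (hi : i ∈ G.I γ) :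
    M.hBdry i (G.endAt i γ) ≤ M.hBif γ :=
  le_ciSup (f := fun i : {i // i ∈ G.I γ} => M.hBdry i.1 (G.endAt i.1 γ))
    (Set.finite_range _).bddAbove ⟨i, hi⟩

theorem I_nonempty {γ : Fin G.numVert} (hγ : γ ∈ G.bifs) : (G.I γ).Nonempty := by
  have : 3 ≤ (G.I γ).card := (Finset.mem_filter.1 hγ).2
  exact Finset.card_pos.1 (by omega)

theorem hBif_pos (M : Mesh G) {γ : Fin G.numVert} (hγ : γ ∈ G.bifs) : 0 < M.hBif γ := by
  obtain ⟨i, hi⟩ := I_nonempty hγ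
  exact (M.hBdry_pos i _).trans_le (M.hBdry_le_hBif hi)

theorem hBif_le {σ : ℝ} (hσ : M.ShapeRegular σ) {γ : Fin G.numVert} (hγ : γ ∈ G.bifs)
    {i : Fin G.N} (hi : i ∈ G.I γ) : M.hBif γ ≤ σ * M.hBdry i (G.endAt i γ) := by
  have : Nonempty {i // i ∈ G.I γ} := ⟨⟨i, hi⟩⟩
  exact ciSup_le fun j => hσ.2 γ hγ j.1 j.2 i hi

/-- `σ` compares the two neighbours, and `1 ≤ s` covers the one that attains the maximum. -/
theorem hInt_le {σ s : ℝ} (hσ : M.ShapeRegular σ) (h1 : 1 ≤ s) (hs : σ ≤ s) {i : Fin G.N}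
    {F : Fin (M.n i) × Fin (M.n i)} (hF : F ∈ M.intFaces i) :
    M.hInt i F ≤ s * M.len i F.1 ∧ M.hInt i F ≤ s * M.len i F.2 := by
  obtain ⟨h, h'⟩ := hσ.1 i F hF
  have l1 := M.len_pos i F.1
  have l2 := M.len_pos i F.2
  exact ⟨max_le (by nlinarith) (by nlinarith), max_le (by nlinarith) (by nlinarith)⟩

theorem mem_D {γ : Fin G.numVert} {ij : Fin G.N × Fin G.N} (h : ij ∈ G.D γ) :
    ij.1 ∈ G.I γ ∧ ij.2 ∈ G.I γ :=
  Finset.mem_product.1 (Finset.mem_filter.1 h).1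

/-- The end points are in the closure of the open interval, so the filter is nontrivial and
`limUnder` is the limit granted by `HasTraces`; essential bounds pass to it. -/
theorem abs_kTrace_le {κ : Fin G.N → ℝ → ℝ} (hκ : M.HasTraces κ) {c : ℝ}
    (hc : ∀ i, ∀ᵐ x ∂(volume.restrict (Ioo (G.left i) (G.right i))), κ i x ∈ Icc (-c) c)
    (i : Fin G.N) (K : Fin (M.n i)) {x : ℝ} (hx : x ∈ ({M.lo i K, M.hi i K} : Set ℝ)) :
    |M.kTrace κ i K x| ≤ c := by
  have hcl : x ∈ closure (Ioo (M.lo i K) (M.hi i K)) := by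
    rw [closure_Ioo (M.lo_lt_hi i K).ne]
    rcases hx with rfl | rfl
    exacts [left_mem_Icc.2 (M.lo_lt_hi i K).le, right_mem_Icc.2 (M.lo_lt_hi i K).le]
  obtain ⟨l, hl⟩ := hκ i K x hx
  have : (𝓝[Ioo (M.lo i K) (M.hi i K)] x).NeBot := mem_closure_iff_nhdsWithin_neBot.1 hcl
  have e : M.kTrace κ i K x = l := hl.limUnder_eq
  rw [e, abs_le]
  exact mem_Icc_of_tendsto_nhdsWithin isOpen_Ioo hcl
    (ae_restrict_of_ae_restrict_of_subset (M.Ioo_subset i K) (hc i)) hl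

/-! ### Edge-networks: inverse trace inequality and consistency terms -/

/-- The Dirichlet energy of a mesh function on a mesh interval. -/
noncomputable def energy (v : M.V p) (i : Fin G.N) (K : Fin (M.n i)) : ℝ :=
  ∫ x in (M.lo i K)..(M.hi i K), dval v i K x ^ 2

theorem energy_nonneg (v : M.V p) (i : Fin G.N) (K : Fin (M.n i)) : 0 ≤ energy v i K :=
  intervalIntegral.integral_nonneg (M.lo_lt_hi i K).le fun _ _ => sq_nonneg _

theorem derivative_mem (v : M.V p) (i : Fin G.N) (K : Fin (M.n i)) :
    (v i K : Polynomial ℝ).derivative ∈ Polynomial.degreeLE ℝ (p : WithBot ℕ) :=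
  Polynomial.mem_degreeLE.2
    ((Polynomial.degree_derivative_le).trans (Polynomial.mem_degreeLE.1 (v i K).2))

/-- The flux satisfies an inverse trace inequality with constant `C`. -/
def FluxBound (κ : Fin G.N → ℝ → ℝ) (M : Mesh G) (p : ℕ) (C : ℝ) : Prop :=
  ∀ (v : M.V p) (i : Fin G.N) (K : Fin (M.n i)), ∀ x ∈ ({M.lo i K, M.hi i K} : Set ℝ),
    M.len i K * flux κ v i K x ^ 2 ≤ C * energy v i K

/-- The polynomial inverse inequality is applied to the derivative, and the trace of `κ` costs a
factor `c ^ 2`. The constant is chosen before the mesh. -/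
theorem exists_fluxBound {κ : Fin G.N → ℝ → ℝ} {c : ℝ}
    (hc : ∀ i, ∀ᵐ x ∂(volume.restrict (Ioo (G.left i) (G.right i))), κ i x ∈ Icc (-c) c) (p : ℕ) :
    ∃ C, 0 ≤ C ∧ ∀ M : Mesh G, M.HasTraces κ → FluxBound κ M p C := by
  obtain ⟨C, hC, h⟩ := exists_length_mul_eval_sq_le p
  refine ⟨c ^ 2 * C, by positivity, fun M hM v i K x hx => ?_⟩
  have h1 := h _ (derivative_mem v i K) _ _ (M.lo_lt_hi i K) x hx
  have h2 : M.kTrace κ i K x ^ 2 ≤ c ^ 2 := by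
    rw [← sq_abs]
    exact pow_le_pow_left₀ (abs_nonneg _) (abs_kTrace_le hM hc i K hx) 2
  calc M.len i K * flux κ v i K x ^ 2
      = M.kTrace κ i K x ^ 2 * (M.len i K * dval v i K x ^ 2) := by rw [flux]; ring
    _ ≤ c ^ 2 * (C * energy v i K) := by
      refine mul_le_mul h2 h1 ?_ (sq_nonneg _)
      have := (M.len_pos i K).le
      positivity
    _ = c ^ 2 * C * energy v i K := by ring

/-- The consistency term of an edge. -/
noncomputable def consEdge (κ : Fin G.N → ℝ → ℝ) (i : Fin G.N) (w v : M.V p) : ℝ :=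
  (∑ F ∈ M.intFaces i, avgInt κ w i F * jumpInt v i F)
    + ∑ b ∈ G.bdryFaces i, fluxEnd κ w i b * valEnd v i b

/-- The penalty term of an edge. -/
noncomputable def penEdge (ηF : Fin G.N → ℝ → ℝ) (i : Fin G.N) (v : M.V p) : ℝ :=
  (∑ F ∈ M.intFaces i, ηF i (M.hi i F.1) / M.hInt i F * jumpInt v i F ^ 2)
    + ∑ b ∈ G.bdryFaces i, ηF i (G.endPt i b) / M.hBdry i b * valEnd v i b ^ 2

/-- The penalty term of the bifurcations. -/
noncomputable def penBif (ηΓ : Fin G.numVert → ℝ) (v : M.V p) : ℝ :=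
  ∑ γ ∈ G.bifs, ηΓ γ / M.hBif γ * ∑ ij ∈ G.D γ, jumpBif v γ ij ^ 2

theorem energy_le_sum (v : M.V p) (i : Fin G.N) (K : Fin (M.n i)) :
    energy v i K ≤ ∑ K, energy v i K :=
  Finset.single_le_sum (f := fun K => energy v i K) (fun K _ => energy_nonneg v i K)
    (Finset.mem_univ K)

theorem penEdge_nonneg {ηF : Fin G.N → ℝ → ℝ} {i : Fin G.N} (h : ∀ F, 0 < ηF i F) (v : M.V p) :
    0 ≤ penEdge ηF i v := by
  refine add_nonneg (Finset.sum_nonneg fun F _ => ?_) (Finset.sum_nonneg fun b _ => ?_)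
  · exact mul_nonneg (div_nonneg (h _).le (M.hInt_pos i F).le) (sq_nonneg _)
  · exact mul_nonneg (div_nonneg (h _).le (M.hBdry_pos i b).le) (sq_nonneg _)

theorem penBif_nonneg {ηΓ : Fin G.numVert → ℝ} (h : ∀ γ, 0 < ηΓ γ) (v : M.V p) :
    0 ≤ penBif ηΓ v := by
  refine Finset.sum_nonneg fun γ hγ => ?_
  exact mul_nonneg (div_nonneg (h _).le (M.hBif_pos hγ).le)
    (Finset.sum_nonneg fun _ _ => sq_nonneg _)

/-- Young's inequality with weight `δ h_F`. The square of an average is at most half the sum of the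
squares, and mesh regularity replaces `h_F` by the length of the interval on either side, where the
flux bound applies. -/
theorem two_mul_abs_avgInt_mul_jumpInt_le {κ : Fin G.N → ℝ → ℝ} {C σ s : ℝ}
    (hM : FluxBound κ M p C) (hσ : M.ShapeRegular σ) (h1 : 1 ≤ s) (hs : σ ≤ s) {δ : ℝ}
    (hδ : 0 < δ) (v : M.V p) {i : Fin G.N} {F : Fin (M.n i) × Fin (M.n i)}
    (hF : F ∈ M.intFaces i) :
    2 * |avgInt κ v i F * jumpInt v i F| ≤
      δ * (s * C / 2 * (energy v i F.1 + energy v i F.2))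
        + δ⁻¹ * (1 / M.hInt i F * jumpInt v i F ^ 2) := by
  have hp := M.hInt_pos i F
  refine (two_mul_abs_mul_le (mul_pos hδ hp)).trans (add_le_add ?_ (le_of_eq ?_))
  · obtain ⟨l1, l2⟩ := hInt_le hσ h1 hs hF
    have e1 := hM v i F.1 _ (Or.inr rfl : M.hi i F.1 ∈ ({M.lo i F.1, M.hi i F.1} : Set ℝ))
    have e2 := hM v i F.2 (M.hi i F.1) (by rw [hi_eq_lo hF]; exact .inl rfl)
    have a1 : avgInt κ v i F ^ 2 ≤
        1 / 2 * (flux κ v i F.1 (M.hi i F.1) ^ 2 + flux κ v i F.2 (M.hi i F.1) ^ 2) := by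
      rw [avgInt]
      nlinarith [sq_nonneg (flux κ v i F.1 (M.hi i F.1) - flux κ v i F.2 (M.hi i F.1))]
    rw [mul_assoc]
    refine mul_le_mul_of_nonneg_left ?_ hδ.le
    calc M.hInt i F * avgInt κ v i F ^ 2
        ≤ M.hInt i F *
          (1 / 2 * (flux κ v i F.1 (M.hi i F.1) ^ 2 + flux κ v i F.2 (M.hi i F.1) ^ 2)) := by gcongr
      _ = 1 / 2 * (M.hInt i F * flux κ v i F.1 (M.hi i F.1) ^ 2
          + M.hInt i F * flux κ v i F.2 (M.hi i F.1) ^ 2) := by ring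
      _ ≤ 1 / 2 * (s * M.len i F.1 * flux κ v i F.1 (M.hi i F.1) ^ 2
          + s * M.len i F.2 * flux κ v i F.2 (M.hi i F.1) ^ 2) := by gcongr
      _ ≤ _ := by nlinarith
  · field_simp

theorem mul_fluxEnd_sq_le {κ : Fin G.N → ℝ → ℝ} {C : ℝ} (hM : FluxBound κ M p C) (v : M.V p)
    (i : Fin G.N) (b : Bool) :
    M.hBdry i b * fluxEnd κ v i b ^ 2 ≤ C * energy v i (M.endElem i b) := by
  refine le_trans (le_of_eq ?_) (hM v i _ _ (M.endPt_mem i b))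
  have : Network.nrm b ^ 2 = 1 := by cases b <;> norm_num [Network.nrm]
  rw [hBdry, fluxEnd, mul_pow, this, mul_one]

theorem sum_comp_le_sum_univ {ι κ : Type*} [Fintype κ] [DecidableEq κ] {f : κ → ℝ}
    (hf : ∀ k, 0 ≤ f k) {s : Finset ι} {g : ι → κ} (hg : Set.InjOn g s) :
    ∑ x ∈ s, f (g x) ≤ ∑ k, f k := by
  rw [← Finset.sum_image (f := f) hg]
  exact Finset.sum_le_sum_of_subset_of_nonneg (Finset.subset_univ _) fun k _ _ => hf k

/-- The factor 3 is 1 from the interior points, where every interval occurs at most once on each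
side and the average contributes one half, plus 2 from the two ends of the edge. -/
theorem two_mul_abs_consEdge_le {κ : Fin G.N → ℝ → ℝ} {C σ s : ℝ} (hC : 0 ≤ C)
    (hM : FluxBound κ M p C) (hσ : M.ShapeRegular σ) (h1 : 1 ≤ s) (hs : σ ≤ s) {δ : ℝ}
    (hδ : 0 < δ) (v : M.V p) (i : Fin G.N) :
    2 * |consEdge κ i v v| ≤
      δ * (3 * s * C) * ∑ K, energy v i K + δ⁻¹ * penEdge (fun _ _ => 1) i v := by
  set g := ∑ K, energy v i K with hg
  have g0 : 0 ≤ g := Finset.sum_nonneg fun K _ => energy_nonneg v i K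
  clear_value g
  have hle : ∀ K, energy v i K ≤ g := fun K => hg ▸ energy_le_sum v i K
  -- An interval is the left neighbour of at most one interior point, and in `hsum2` the right
  -- neighbour of at most one.
  have hsum1 : ∑ F ∈ M.intFaces i, energy v i F.1 ≤ g := by
    rw [hg]
    refine sum_comp_le_sum_univ (g := Prod.fst) (fun K => energy_nonneg v i K) ?_
    · intro F hF F' hF' h
      have h1 : F.1.val + 1 = F.2.val := (Finset.mem_filter.1 hF).2
      have h2 : F'.1.val + 1 = F'.2.val := (Finset.mem_filter.1 hF').2
      refine Prod.ext h (Fin.ext ?_)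
      rw [← h1, ← h2, show F.1 = F'.1 from h]
  have hsum2 : ∑ F ∈ M.intFaces i, energy v i F.2 ≤ g := by
    rw [hg]
    refine sum_comp_le_sum_univ (g := Prod.snd) (fun K => energy_nonneg v i K) ?_
    · intro F hF F' hF' h
      have h1 : F.1.val + 1 = F.2.val := (Finset.mem_filter.1 hF).2
      have h2 : F'.1.val + 1 = F'.2.val := (Finset.mem_filter.1 hF').2
      refine Prod.ext (Fin.ext ?_) h
      have : F.2.val = F'.2.val := congrArg _ h
      omega
  have hint : 2 * |∑ F ∈ M.intFaces i, avgInt κ v i F * jumpInt v i F| ≤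
      δ * (s * C) * g + δ⁻¹ * ∑ F ∈ M.intFaces i, 1 / M.hInt i F * jumpInt v i F ^ 2 := by
    calc _ ≤ 2 * ∑ F ∈ M.intFaces i, |avgInt κ v i F * jumpInt v i F| := by
          gcongr; exact Finset.abs_sum_le_sum_abs _ _
      _ ≤ ∑ F ∈ M.intFaces i, (δ * (s * C / 2 * (energy v i F.1 + energy v i F.2))
          + δ⁻¹ * (1 / M.hInt i F * jumpInt v i F ^ 2)) := by
          rw [Finset.mul_sum]
          exact Finset.sum_le_sum fun F hF =>
            two_mul_abs_avgInt_mul_jumpInt_le hM hσ h1 hs hδ v hF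
      _ = δ * (s * C / 2) * (∑ F ∈ M.intFaces i, energy v i F.1
            + ∑ F ∈ M.intFaces i, energy v i F.2)
          + δ⁻¹ * ∑ F ∈ M.intFaces i, 1 / M.hInt i F * jumpInt v i F ^ 2 := by
          rw [Finset.sum_add_distrib, ← Finset.mul_sum, ← Finset.mul_sum, ← Finset.mul_sum,
            Finset.sum_add_distrib]
          ring
      _ ≤ δ * (s * C / 2) * (g + g)
          + δ⁻¹ * ∑ F ∈ M.intFaces i, 1 / M.hInt i F * jumpInt v i F ^ 2 := by gcongr
      _ = _ := by ring
  have hbd : 2 * |∑ b ∈ G.bdryFaces i, fluxEnd κ v i b * valEnd v i b| ≤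
      δ * (2 * s * C) * g + δ⁻¹ * ∑ b ∈ G.bdryFaces i, 1 / M.hBdry i b * valEnd v i b ^ 2 := by
    calc _ ≤ 2 * ∑ b ∈ G.bdryFaces i, |fluxEnd κ v i b * valEnd v i b| := by
          gcongr; exact Finset.abs_sum_le_sum_abs _ _
      _ ≤ ∑ b ∈ G.bdryFaces i, (δ * (s * C * g)
          + δ⁻¹ * (1 / M.hBdry i b * valEnd v i b ^ 2)) := by
          rw [Finset.mul_sum]
          refine Finset.sum_le_sum fun b _ => ?_
          have hp := M.hBdry_pos i b
          refine (two_mul_abs_mul_le (mul_pos hδ hp)).trans (add_le_add ?_ (le_of_eq ?_))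
          · rw [mul_assoc]
            refine mul_le_mul_of_nonneg_left ((mul_fluxEnd_sq_le hM v i b).trans ?_) hδ.le
            have := hle (M.endElem i b)
            calc C * energy v i (M.endElem i b) ≤ C * g := by gcongr
              _ ≤ s * (C * g) := le_mul_of_one_le_left (by positivity) h1
              _ = s * C * g := by ring
          · field_simp
      _ = (G.bdryFaces i).card * (δ * (s * C * g))
          + δ⁻¹ * ∑ b ∈ G.bdryFaces i, 1 / M.hBdry i b * valEnd v i b ^ 2 := by
          rw [Finset.sum_add_distrib, Finset.sum_const, nsmul_eq_mul, Finset.mul_sum]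
      _ ≤ 2 * (δ * (s * C * g))
          + δ⁻¹ * ∑ b ∈ G.bdryFaces i, 1 / M.hBdry i b * valEnd v i b ^ 2 := by
          have : ((G.bdryFaces i).card : ℝ) ≤ 2 := by
            exact_mod_cast (Finset.card_le_univ _).trans (by simp)
          gcongr
      _ = _ := by ring
  have := abs_add_le (∑ F ∈ M.intFaces i, avgInt κ v i F * jumpInt v i F)
    (∑ b ∈ G.bdryFaces i, fluxEnd κ v i b * valEnd v i b)
  rw [consEdge, penEdge, mul_add]
  linarith

/-- The weight `1 / card I_γ` is at most 1 and is dropped. Mesh regularity at the bifurcation bounds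
`h_γ` by `s` times the length of every end interval, so each of the two fluxes in a pair is
controlled by the energy. A squared difference is at most twice the sum of squares, which gives the
4, and there are at most `N ^ 2` pairs. -/
theorem two_mul_abs_avgJump_le {κ : Fin G.N → ℝ → ℝ} {C σ s : ℝ} (hC : 0 ≤ C)
    (hM : FluxBound κ M p C) (hσ : M.ShapeRegular σ) (h1 : 1 ≤ s) (hs : σ ≤ s) {δ : ℝ}
    (hδ : 0 < δ) (v : M.V p) {γ : Fin G.numVert} (hγ : γ ∈ G.bifs) :
    2 * |avgJump κ v v γ| ≤ δ * (4 * G.N ^ 2 * s * C) * ∑ i, ∑ K, energy v i K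
      + δ⁻¹ * (1 / M.hBif γ * ∑ ij ∈ G.D γ, jumpBif v γ ij ^ 2) := by
  set g := ∑ i, ∑ K, energy v i K with hg
  have g0 : 0 ≤ g := Finset.sum_nonneg fun i _ => Finset.sum_nonneg fun K _ => energy_nonneg v i K
  have hle : ∀ i K, energy v i K ≤ g := fun i K =>
    (energy_le_sum v i K).trans (Finset.single_le_sum (f := fun i => ∑ K, energy v i K)
      (fun i _ => Finset.sum_nonneg fun K _ => energy_nonneg v i K) (Finset.mem_univ i))
  clear_value g
  have hp := M.hBif_pos hγ
  have hcard : |1 / ((G.I γ).card : ℝ)| ≤ 1 := by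
    have : (1 : ℝ) ≤ (G.I γ).card := by exact_mod_cast Finset.card_pos.2 (I_nonempty hγ)
    rw [abs_of_nonneg (by positivity)]
    exact (div_le_one (by positivity)).2 this
  have hfl : ∀ i ∈ G.I γ, M.hBif γ * fluxEnd κ v i (G.endAt i γ) ^ 2 ≤ s * C * g := by
    intro i hi
    calc _ ≤ s * M.hBdry i (G.endAt i γ) * fluxEnd κ v i (G.endAt i γ) ^ 2 := by
          have := hBif_le hσ hγ hi
          have := (M.hBdry_pos i (G.endAt i γ)).le
          gcongr
          nlinarith
      _ = s * (M.hBdry i (G.endAt i γ) * fluxEnd κ v i (G.endAt i γ) ^ 2) := by ring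
      _ ≤ s * (C * g) := by
          refine mul_le_mul_of_nonneg_left ?_ (by positivity)
          exact (mul_fluxEnd_sq_le hM v i _).trans (mul_le_mul_of_nonneg_left (hle _ _) hC)
      _ = _ := by ring
  calc 2 * |avgJump κ v v γ| ≤ 2 * ∑ ij ∈ G.D γ, |avgBif κ v γ ij * jumpBif v γ ij| := by
        rw [avgJump, abs_mul]
        refine mul_le_mul_of_nonneg_left ?_ zero_le_two
        exact (mul_le_of_le_one_left (abs_nonneg _) hcard).trans (Finset.abs_sum_le_sum_abs _ _)
    _ ≤ ∑ ij ∈ G.D γ, (δ * (4 * s * C * g) + δ⁻¹ * (1 / M.hBif γ * jumpBif v γ ij ^ 2)) := by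
        rw [Finset.mul_sum]
        refine Finset.sum_le_sum fun ij hij => ?_
        refine (two_mul_abs_mul_le (mul_pos hδ hp)).trans (add_le_add ?_ (le_of_eq ?_))
        · rw [mul_assoc]
          refine mul_le_mul_of_nonneg_left ?_ hδ.le
          have a1 := hfl _ (mem_D hij).1
          have a2 := hfl _ (mem_D hij).2
          have : avgBif κ v γ ij ^ 2 ≤ 2 * (fluxEnd κ v ij.1 (G.endAt ij.1 γ) ^ 2
              + fluxEnd κ v ij.2 (G.endAt ij.2 γ) ^ 2) := by
            rw [avgBif]
            nlinarith [sq_nonneg (fluxEnd κ v ij.1 (G.endAt ij.1 γ)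
              + fluxEnd κ v ij.2 (G.endAt ij.2 γ))]
          nlinarith
        · field_simp
    _ = (G.D γ).card * (δ * (4 * s * C * g))
        + δ⁻¹ * (1 / M.hBif γ * ∑ ij ∈ G.D γ, jumpBif v γ ij ^ 2) := by
        rw [Finset.sum_add_distrib, Finset.sum_const, nsmul_eq_mul, Finset.mul_sum, Finset.mul_sum]
    _ ≤ (G.N ^ 2 : ℝ) * (δ * (4 * s * C * g))
        + δ⁻¹ * (1 / M.hBif γ * ∑ ij ∈ G.D γ, jumpBif v γ ij ^ 2) := by
        have : ((G.D γ).card : ℝ) ≤ (G.N ^ 2 : ℝ) := by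
          have := Finset.card_le_univ (G.D γ)
          rw [Fintype.card_prod, Fintype.card_fin, ← sq] at this
          exact_mod_cast this
        gcongr
    _ = _ := by ring

theorem two_mul_abs_sum_avgJump_le {κ : Fin G.N → ℝ → ℝ} {C σ s : ℝ} (hC : 0 ≤ C)
    (hM : FluxBound κ M p C) (hσ : M.ShapeRegular σ) (h1 : 1 ≤ s) (hs : σ ≤ s) {δ : ℝ}
    (hδ : 0 < δ) (v : M.V p) :
    2 * |∑ γ ∈ G.bifs, avgJump κ v v γ| ≤
      δ * (4 * G.N ^ 2 * G.numVert * s * C) * ∑ i, ∑ K, energy v i K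
        + δ⁻¹ * penBif (fun _ => 1) v := by
  have g0 : 0 ≤ ∑ i, ∑ K, energy v i K :=
    Finset.sum_nonneg fun i _ => Finset.sum_nonneg fun K _ => energy_nonneg v i K
  have hγ' := fun γ hγ => two_mul_abs_avgJump_le hC hM hσ h1 hs hδ v (γ := γ) hγ
  generalize ∑ i, ∑ K, energy v i K = g at *
  calc _ ≤ 2 * ∑ γ ∈ G.bifs, |avgJump κ v v γ| := by
        gcongr; exact Finset.abs_sum_le_sum_abs _ _
    _ ≤ ∑ γ ∈ G.bifs, (δ * (4 * G.N ^ 2 * s * C) * g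
      + δ⁻¹ * (1 / M.hBif γ * ∑ ij ∈ G.D γ, jumpBif v γ ij ^ 2)) := by
        rw [Finset.mul_sum]
        exact Finset.sum_le_sum fun γ hγ => hγ' γ hγ
    _ = G.bifs.card * (δ * (4 * G.N ^ 2 * s * C) * g)
        + δ⁻¹ * penBif (fun _ => 1) v := by
        rw [Finset.sum_add_distrib, Finset.sum_const, nsmul_eq_mul, penBif, Finset.mul_sum]
    _ ≤ G.numVert * (δ * (4 * G.N ^ 2 * s * C) * g)
        + δ⁻¹ * penBif (fun _ => 1) v := by
        have : (G.bifs.card : ℝ) ≤ G.numVert := by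
          exact_mod_cast (Finset.card_le_univ _).trans (by simp)
        gcongr
    _ = _ := by ring

end EdgeDG.Mesh

/-- The summand `2 / b` restores the full energy and `4 / 3` the full penalty; the cross terms are
nonnegative. -/
theorem le_mul_of_energy_le {b g q x : ℝ} (hb : 0 < b) (hg : 0 ≤ g) (hq : 0 ≤ q)
    (h : b / 2 * g + 3 / 4 * q ≤ x) : g + q ≤ (2 / b + 4 / 3) * x := by
  have h1 : (2 / b + 4 / 3) * (b / 2 * g + 3 / 4 * q) = g + q + (3 / (2 * b) * q + 2 / 3 * b * g) := by
    field_simp; ring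
  have h2 : (2 / b + 4 / 3) * (b / 2 * g + 3 / 4 * q) ≤ (2 / b + 4 / 3) * x := by gcongr
  have : 0 ≤ 3 / (2 * b) * q + 2 / 3 * b * g := by positivity
  linarith

/-! ### Edge-networks: coercivity and well-posedness -/

namespace EdgeDG.Mesh

variable {G : Network} {M : Mesh G} {p : ℕ}

theorem dgNorm_sq {ηF : Fin G.N → ℝ → ℝ} {ηΓ : Fin G.numVert → ℝ} (hF : ∀ i F, 0 < ηF i F)
    (hΓ : ∀ γ, 0 < ηΓ γ) (v : M.V p) :
    dgNorm ηF ηΓ v ^ 2 = ∑ i, ∑ K, energy v i K + (∑ i, penEdge ηF i v + penBif ηΓ v) := by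
  have e : ∀ i, dgSqEdge ηF i v = ∑ K, energy v i K + penEdge ηF i v := fun i => by
    rw [dgSqEdge, penEdge, add_assoc]; rfl
  have h0 : 0 ≤ ∑ i, ∑ K, energy v i K + (∑ i, penEdge ηF i v + penBif ηΓ v) :=
    add_nonneg (Finset.sum_nonneg fun i _ => Finset.sum_nonneg fun K _ => energy_nonneg v i K)
      (add_nonneg (Finset.sum_nonneg fun i _ => penEdge_nonneg (hF i) v) (penBif_nonneg hΓ v))
  rw [dgNorm]
  simp_rw [e]
  rw [Finset.sum_add_distrib, add_assoc]
  exact Real.sq_sqrt h0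

/-- For equal arguments the consistency terms and their symmetrizing counterparts coincide, whence
the factors `1 + ε`. -/
theorem a_self (κ : Fin G.N → ℝ → ℝ) (ε : Fin G.N → ℝ) (ε₀ : ℝ) (ηF : Fin G.N → ℝ → ℝ)
    (ηΓ : Fin G.numVert → ℝ) (v : M.V p) :
    a κ ε ε₀ ηF ηΓ v v =
      ∑ i, ((∑ K, ∫ x in (M.lo i K)..(M.hi i K), κ i x * dval v i K x * dval v i K x)
        - (1 + ε i) * consEdge κ i v v + penEdge ηF i v)
      - (1 + ε₀) * (∑ γ ∈ G.bifs, avgJump κ v v γ) + penBif ηΓ v := by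
  have e : ∀ i, aEdge κ ε ηF i v v =
      (∑ K, ∫ x in (M.lo i K)..(M.hi i K), κ i x * dval v i K x * dval v i K x)
        - (1 + ε i) * consEdge κ i v v + penEdge ηF i v := fun i => by
    rw [aEdge, consEdge, penEdge]
    simp_rw [sq]
    ring
  rw [a, penBif]
  simp_rw [e, jumpJump, ← sq]
  ring

theorem continuous_val (v : M.V p) (i : Fin G.N) (K : Fin (M.n i)) : Continuous (val v i K) :=
  (v i K : Polynomial ℝ).continuous

theorem continuous_dval (v : M.V p) (i : Fin G.N) (K : Fin (M.n i)) : Continuous (dval v i K) :=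
  (v i K : Polynomial ℝ).derivative.continuous

theorem integrableOn_coeff_mul {κ : Fin G.N → ℝ → ℝ} (hm : ∀ i, Measurable (κ i)) {c : ℝ}
    (hc : ∀ i, ∀ᵐ x ∂(volume.restrict (Ioo (G.left i) (G.right i))), κ i x ∈ Icc (-c) c)
    (i : Fin G.N) (K : Fin (M.n i)) {f : ℝ → ℝ} (hf : Continuous f) :
    IntegrableOn (fun x => κ i x * f x) (Ioc (M.lo i K) (M.hi i K)) := by
  have hfi : IntegrableOn f (Ioc (M.lo i K) (M.hi i K)) :=
    (hf.continuousOn.integrableOn_compact isCompact_Icc).mono_set Ioc_subset_Icc_self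
  refine Integrable.bdd_mul (c := c) hfi (hm i).aestronglyMeasurable ?_
  filter_upwards [M.ae_of_ae_edge K (hc i)] with x hx
  exact abs_le.2 hx

theorem mul_energy_le {κ : Fin G.N → ℝ → ℝ} (hm : ∀ i, Measurable (κ i)) {b c : ℝ}
    (hc : ∀ i, ∀ᵐ x ∂(volume.restrict (Ioo (G.left i) (G.right i))), κ i x ∈ Icc (-c) c)
    (hb : ∀ i, ∀ᵐ x ∂(volume.restrict (Ioo (G.left i) (G.right i))), b ≤ κ i x)
    (v : M.V p) (i : Fin G.N) (K : Fin (M.n i)) :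
    b * energy v i K ≤ ∫ x in (M.lo i K)..(M.hi i K), κ i x * dval v i K x * dval v i K x := by
  rw [energy, intervalIntegral.integral_of_le (M.lo_lt_hi i K).le,
    intervalIntegral.integral_of_le (M.lo_lt_hi i K).le, ← integral_const_mul]
  simp_rw [mul_assoc]
  have hd := continuous_dval v i K
  refine integral_mono_ae ?_ (integrableOn_coeff_mul hm hc i K (hd.mul hd)) ?_
  · exact (((hd.pow 2).const_mul b).continuousOn.integrableOn_compact isCompact_Icc).mono_set
      Ioc_subset_Icc_self
  · filter_upwards [M.ae_of_ae_edge K (hb i)] with x hx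
    simp only [sq]
    exact mul_le_mul_of_nonneg_right hx (mul_self_nonneg _)

theorem penEdge_one_le {ηF : Fin G.N → ℝ → ℝ} {i : Fin G.N} {η₀ : ℝ} (h : ∀ F, η₀ ≤ ηF i F)
    (v : M.V p) : η₀ * penEdge (fun _ _ => 1) i v ≤ penEdge ηF i v := by
  rw [penEdge, penEdge, mul_add, Finset.mul_sum, Finset.mul_sum]
  refine add_le_add (Finset.sum_le_sum fun F _ => ?_) (Finset.sum_le_sum fun b _ => ?_)
  · rw [← mul_assoc, mul_one_div]
    have := (M.hInt_pos i F).le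
    gcongr
    apply h
  · rw [← mul_assoc, mul_one_div]
    have := (M.hBdry_pos i b).le
    gcongr
    apply h

theorem penBif_one_le {ηΓ : Fin G.numVert → ℝ} {η₀ : ℝ} (h : ∀ γ, η₀ ≤ ηΓ γ) (v : M.V p) :
    η₀ * penBif (fun _ => 1) v ≤ penBif ηΓ v := by
  rw [penBif, penBif, Finset.mul_sum]
  refine Finset.sum_le_sum fun γ hγ => ?_
  rw [← mul_assoc, mul_one_div]
  have := (M.hBif_pos hγ).le
  have : 0 ≤ ∑ ij ∈ G.D γ, jumpBif v γ ij ^ 2 := Finset.sum_nonneg fun _ _ => sq_nonneg _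
  gcongr
  apply h

theorem isBilin_a {κ : Fin G.N → ℝ → ℝ} (hm : ∀ i, Measurable (κ i)) {c : ℝ}
    (hc : ∀ i, ∀ᵐ x ∂(volume.restrict (Ioo (G.left i) (G.right i))), κ i x ∈ Icc (-c) c)
    (ε : Fin G.N → ℝ) (ε₀ : ℝ) (ηF : Fin G.N → ℝ → ℝ) (ηΓ : Fin G.numVert → ℝ) :
    IsBilin fun w v : M.V p => a κ ε ε₀ ηF ηΓ w v := by
  have hval : ∀ i K x, IsLin fun v : M.V p => val v i K x := fun i K x =>
    ⟨fun u u' => by simp [val], fun r u => by simp [val]⟩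
  have hdval : ∀ i K x, IsLin fun v : M.V p => dval v i K x := fun i K x =>
    ⟨fun u u' => by simp [dval], fun r u => by simp [dval]⟩
  have hflux : ∀ i K x, IsLin fun v : M.V p => flux κ v i K x := fun i K x =>
    (hdval i K x).const_mul _
  have hjump : ∀ i F, IsLin fun v : M.V p => jumpInt v i F := fun i F => (hval _ _ _).sub (hval _ _ _)
  have havg : ∀ i F, IsLin fun v : M.V p => avgInt κ v i F := fun i F =>
    ((hflux _ _ _).const_mul _).add' ((hflux _ _ _).const_mul _)
  have hend : ∀ i b, IsLin fun v : M.V p => valEnd v i b := fun i b => hval _ _ _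
  have hfend : ∀ i b, IsLin fun v : M.V p => fluxEnd κ v i b := fun i b => (hflux _ _ _).mul_const _
  have hjbif : ∀ γ ij, IsLin fun v : M.V p => jumpBif v γ ij := fun γ ij => (hend _ _).sub (hend _ _)
  have habif : ∀ γ ij, IsLin fun v : M.V p => avgBif κ v γ ij := fun γ ij =>
    (hfend _ _).sub (hfend _ _)
  have hI : ∀ i, IsBilin fun w v : M.V p => ∑ F ∈ M.intFaces i, avgInt κ w i F * jumpInt v i F :=
    fun i => .sum _ fun F _ => (havg i F).mul (hjump i F)
  have hB : ∀ i, IsBilin fun w v : M.V p => ∑ b ∈ G.bdryFaces i, fluxEnd κ w i b * valEnd v i b :=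
    fun i => .sum _ fun b _ => (hfend i b).mul (hend i b)
  have hAJ : ∀ γ, IsBilin fun w v : M.V p => avgJump κ w v γ := fun γ =>
    (IsBilin.sum _ fun ij _ => (habif γ ij).mul (hjbif γ ij)).const_mul _
  have hV : ∀ i K, IsBilin fun w v : M.V p =>
      ∫ x in (M.lo i K)..(M.hi i K), κ i x * dval w i K x * dval v i K x := fun i K => by
    simp_rw [intervalIntegral.integral_of_le (M.lo_lt_hi i K).le]
    refine IsBilin.integral (fun x => ((hdval i K x).const_mul _).mul (hdval i K x)) fun w v => ?_
    simp_rw [mul_assoc]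
    exact integrableOn_coeff_mul hm hc i K ((continuous_dval w i K).mul (continuous_dval v i K))
  refine ((IsBilin.sub (.sub (.sum _ fun i _ => ?_) (.sum _ fun γ _ => hAJ γ))
    (.const_mul (.sum _ fun γ _ => (hAJ γ).swap) _))).add (.sum _ fun γ _ => .const_mul
      (.sum _ fun ij _ => (hjbif γ ij).mul (hjbif γ ij)) _)
  exact (((((IsBilin.sum _ fun K _ => hV i K).sub (hI i)).sub ((hI i).swap.const_mul _)).add
    (.sum _ fun F _ => ((hjump i F).mul (hjump i F)).const_mul _)).add
    (.sum _ fun b _ => ((hend i b).mul (hend i b)).const_mul _)).sub (hB i) |>.sub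
    ((hB i).swap.const_mul _)

theorem isLin_load {f : Fin G.N → ℝ → ℝ}
    (hf : ∀ i, MemLp (f i) 2 (volume.restrict (Ioo (G.left i) (G.right i)))) :
    IsLin fun v : M.V p => load f v := by
  refine .sum _ fun i _ => .sum _ fun K _ => ?_
  simp_rw [intervalIntegral.integral_of_le (M.lo_lt_hi i K).le, integral_Ioc_eq_integral_Ioo]
  refine IsLin.integral (fun x => IsLin.const_mul ⟨fun u u' => by simp [val],
    fun r u => by simp [val]⟩ _) fun v => ?_
  have h1 : IntegrableOn (f i) (Ioo (G.left i) (G.right i)) := (hf i).integrable one_le_two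
  exact (h1.mono_set (M.Ioo_subset i K)).mul_continuousOn_of_subset
    (continuous_val v i K).continuousOn measurableSet_Ioo isCompact_Icc Ioo_subset_Icc_self

/-- The derivative vanishes on an interval, hence has infinitely many roots and is zero. -/
theorem exists_eq_C_of_energy_eq_zero {v : M.V p} {i : Fin G.N} {K : Fin (M.n i)}
    (h : energy v i K = 0) : ∃ k, (v i K : Polynomial ℝ) = Polynomial.C k := by
  have hd := continuous_dval v i K
  rw [energy, intervalIntegral.integral_of_le (M.lo_lt_hi i K).le] at h
  have h0 := eqOn_zero_of_setIntegral_eq_zero isOpen_Ioo Ioo_subset_Ioc_self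
    (hd.pow 2).continuousOn (fun x => sq_nonneg _)
    (((hd.pow 2).continuousOn.integrableOn_compact isCompact_Icc).mono_set Ioc_subset_Icc_self) h
  have h1 : (v i K : Polynomial ℝ).derivative = 0 :=
    Polynomial.eq_zero_of_infinite_isRoot _ ((Ioo_infinite (M.lo_lt_hi i K)).mono fun x hx =>
      pow_eq_zero_iff two_ne_zero |>.1 (h0 hx))
  exact ⟨_, Polynomial.eq_C_of_natDegree_eq_zero
    (Polynomial.derivative_eq_zero.1 h1)⟩

/-- All contributions to the squared norm are nonnegative, so each is zero. The energies leave one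
constant per interval, the jumps identify the constants along edges and across bifurcations, and a
boundary end forces the value zero, which propagates along the chain. -/
theorem eq_zero_of_dgNorm_eq_zero (hG : G.ReachesBoundary) {ηF : Fin G.N → ℝ → ℝ}
    {ηΓ : Fin G.numVert → ℝ} (hF : ∀ i F, 0 < ηF i F) (hΓ : ∀ γ, 0 < ηΓ γ) {v : M.V p}
    (hv : dgNorm ηF ηΓ v ^ 2 = 0) : v = 0 := by
  have gnn : ∀ i, 0 ≤ ∑ K, energy v i K := fun i => Finset.sum_nonneg fun K _ => energy_nonneg v i K
  have pnn : ∀ i, 0 ≤ penEdge ηF i v := fun i => penEdge_nonneg (hF i) v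
  have bnn := penBif_nonneg hΓ v
  have gs : 0 ≤ ∑ i, ∑ K, energy v i K := Finset.sum_nonneg fun i _ => gnn i
  have ps : 0 ≤ ∑ i, penEdge ηF i v := Finset.sum_nonneg fun i _ => pnn i
  rw [dgNorm_sq hF hΓ] at hv
  have hg0 : ∑ i, ∑ K, energy v i K = 0 := by linarith
  have hp0 : ∑ i, penEdge ηF i v = 0 := by linarith
  have hb0 : penBif ηΓ v = 0 := by linarith
  have hconst : ∀ i K, ∃ k, (v i K : Polynomial ℝ) = Polynomial.C k := fun i K => by
    apply exists_eq_C_of_energy_eq_zero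
    have := (Finset.sum_eq_zero_iff_of_nonneg fun i _ => gnn i).1 hg0 i (Finset.mem_univ i)
    exact (Finset.sum_eq_zero_iff_of_nonneg fun K _ => energy_nonneg v i K).1 this K
      (Finset.mem_univ K)
  choose k hk using hconst
  have hval : ∀ i K x, val v i K x = k i K := fun i K x => by rw [val, hk, Polynomial.eval_C]
  have hpi : ∀ i, penEdge ηF i v = 0 := fun i =>
    (Finset.sum_eq_zero_iff_of_nonneg fun i _ => pnn i).1 hp0 i (Finset.mem_univ i)
  have sq0 : ∀ {a b : ℝ}, 0 < a → a * b ^ 2 = 0 → b = 0 := fun ha h =>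
    pow_eq_zero_iff two_ne_zero |>.1 ((mul_eq_zero.1 h).resolve_left ha.ne')
  have hstep : ∀ i, ∀ F ∈ M.intFaces i, k i F.1 = k i F.2 := by
    intro i F hFi
    have nn : ∀ F ∈ M.intFaces i, 0 ≤ ηF i (M.hi i F.1) / M.hInt i F * jumpInt v i F ^ 2 :=
      fun F _ => mul_nonneg (div_pos (hF _ _) (M.hInt_pos i F)).le (sq_nonneg _)
    have h1 : ∑ F ∈ M.intFaces i, ηF i (M.hi i F.1) / M.hInt i F * jumpInt v i F ^ 2 = 0 := by
      refine le_antisymm ?_ (Finset.sum_nonneg nn)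
      rw [← hpi i, penEdge]
      exact le_add_of_nonneg_right (Finset.sum_nonneg fun b _ =>
        mul_nonneg (div_pos (hF _ _) (M.hBdry_pos i b)).le (sq_nonneg _))
    have h2 := sq0 (div_pos (hF _ _) (M.hInt_pos i F))
      ((Finset.sum_eq_zero_iff_of_nonneg nn).1 h1 F hFi)
    rwa [jumpInt, hval, hval, sub_eq_zero] at h2
  -- The constant is carried along the edge, each interval being compared with the first one.
  have hfirst : ∀ i K, k i K = k i ⟨0, M.n_pos i⟩ := by
    rintro i ⟨m, hm⟩
    induction m with
    | zero => rfl
    | succ m ih =>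
      rw [← ih (by omega)]
      exact (hstep i (⟨m, by omega⟩, ⟨m + 1, hm⟩) (Finset.mem_filter.2 ⟨Finset.mem_univ _, rfl⟩)).symm
  have hend : ∀ i b, valEnd v i b = k i ⟨0, M.n_pos i⟩ := fun i b => by
    rw [valEnd, hval, hfirst]
  have hlt : ∀ γ ∈ G.bifs, ∀ ij ∈ G.D γ, k ij.1 ⟨0, M.n_pos _⟩ = k ij.2 ⟨0, M.n_pos _⟩ := by
    intro γ hγ ij hij
    have nn : ∀ γ ∈ G.bifs, 0 ≤ ηΓ γ / M.hBif γ * ∑ ij ∈ G.D γ, jumpBif v γ ij ^ 2 := fun γ hγ =>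
      mul_nonneg (div_pos (hΓ γ) (M.hBif_pos hγ)).le (Finset.sum_nonneg fun _ _ => sq_nonneg _)
    have h1 := (Finset.sum_eq_zero_iff_of_nonneg nn).1 hb0 γ hγ
    have h2 := (mul_eq_zero.1 h1).resolve_left (div_pos (hΓ γ) (M.hBif_pos hγ)).ne'
    have h3 := (Finset.sum_eq_zero_iff_of_nonneg fun _ _ => sq_nonneg _).1 h2 ij hij
    rw [pow_eq_zero_iff two_ne_zero, jumpBif, hend, hend, sub_eq_zero] at h3
    exact h3
  have hlink : ∀ i j, G.Linked i j → k i ⟨0, M.n_pos i⟩ = k j ⟨0, M.n_pos j⟩ := by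
    rintro i j ⟨γ, hγ, hi, hj⟩
    -- `D_γ` lists only pairs with `i < j`, whereas being linked is symmetric.
    rcases lt_trichotomy i j with h | rfl | h
    · exact hlt γ hγ (i, j) (Finset.mem_filter.2 ⟨Finset.mem_product.2 ⟨hi, hj⟩, h⟩)
    · rfl
    · exact (hlt γ hγ (j, i) (Finset.mem_filter.2 ⟨Finset.mem_product.2 ⟨hj, hi⟩, h⟩)).symm
  have hbd : ∀ j, (∃ b, G.vert j b ∉ G.bifs) → k j ⟨0, M.n_pos j⟩ = 0 := by
    rintro j ⟨b, hb⟩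
    have hbm : b ∈ G.bdryFaces j := Finset.mem_filter.2 ⟨Finset.mem_univ _, hb⟩
    have nn : ∀ b ∈ G.bdryFaces j, 0 ≤ ηF j (G.endPt j b) / M.hBdry j b * valEnd v j b ^ 2 :=
      fun b _ => mul_nonneg (div_pos (hF _ _) (M.hBdry_pos j b)).le (sq_nonneg _)
    have h1 : ∑ b ∈ G.bdryFaces j, ηF j (G.endPt j b) / M.hBdry j b * valEnd v j b ^ 2 = 0 := by
      refine le_antisymm ?_ (Finset.sum_nonneg nn)
      rw [← hpi j, penEdge]
      exact le_add_of_nonneg_left (Finset.sum_nonneg fun F _ =>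
        mul_nonneg (div_pos (hF _ _) (M.hInt_pos j F)).le (sq_nonneg _))
    have h2 := sq0 (div_pos (hF _ _) (M.hBdry_pos j b))
      ((Finset.sum_eq_zero_iff_of_nonneg nn).1 h1 b hbm)
    rwa [hend] at h2
  have hall : ∀ i, k i ⟨0, M.n_pos i⟩ = 0 := by
    intro i
    obtain ⟨j, hij, hj⟩ := hG i
    rw [← hbd j hj]
    clear hj
    induction hij with
    | refl => rfl
    | tail _ h ih => rw [ih, hlink _ _ h]
  funext i K
  apply Subtype.ext
  rw [hk, hfirst, hall, map_zero]
  rfl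

theorem coercive_and_wellposed {κ : Fin G.N → ℝ → ℝ} (hκ : G.IsCoefficient κ) (p : ℕ) (σ : ℝ) :
    ∃ η₀ > 0, ∃ C > 0, ∀ M : Mesh G, M.ShapeRegular σ → M.HasTraces κ →
      ∀ (ε : Fin G.N → ℝ) (ε₀ : ℝ) (ηF : Fin G.N → ℝ → ℝ) (ηΓ : Fin G.numVert → ℝ),
        (∀ i, ε i ∈ ({-1, 0, 1} : Set ℝ)) → ε₀ ∈ ({-1, 0, 1} : Set ℝ) →
        (∀ i, ε i = -1 → ∀ F, 0 < ηF i F) →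
        (∀ i, ε i = 0 ∨ ε i = 1 → ∀ F, η₀ ≤ ηF i F) →
        (∀ γ, η₀ ≤ ηΓ γ) →
        (∀ v : M.V p, dgNorm ηF ηΓ v ^ 2 ≤ C * a κ ε ε₀ ηF ηΓ v v) ∧
        (G.ReachesBoundary → ∀ f : Fin G.N → ℝ → ℝ,
          (∀ i, MemLp (f i) 2 (volume.restrict (Ioo (G.left i) (G.right i)))) →
          ∃! u : M.V p, ∀ v : M.V p, a κ ε ε₀ ηF ηΓ u v = load f v) := by
  obtain ⟨hm, ⟨b, hb0, hb⟩, ⟨c, hc'⟩⟩ := hκ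
  -- The lower bound `-c` comes from `0 < b ≤ κ ≤ c`; this symmetric form is a bound on `|κ|`.
  have hc : ∀ i, ∀ᵐ x ∂(volume.restrict (Ioo (G.left i) (G.right i))), κ i x ∈ Icc (-c) c := by
    intro i
    filter_upwards [hb i, hc' i] with x h1 h2
    exact ⟨by linarith, h2⟩
  obtain ⟨B, hB, hflux⟩ := exists_fluxBound hc p
  -- `σ` is an arbitrary real number, and the face estimates need a factor that is at least 1.
  let s := max σ 1
  -- The sum of the constants in the two consistency bounds; the added 1 keeps it positive when `B =
  -- 0`.
  let R : ℝ := 3 * s * B + 4 * G.N ^ 2 * G.numVert * s * B + 1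
  have hs1 : 1 ≤ s := le_max_right _ _
  have hR : 0 < R := by positivity
  -- Each consistency bound then uses at most `b / 4` of the energy.
  let δ : ℝ := b / (4 * R)
  have hδ : 0 < δ := by positivity
  have hδR : δ * R = b / 4 := by simp only [δ]; field_simp
  have hδ1 : δ * (3 * s * B) ≤ b / 4 := by
    rw [← hδR]
    refine mul_le_mul_of_nonneg_left ?_ hδ.le
    have : 0 ≤ 4 * (G.N : ℝ) ^ 2 * G.numVert * s * B := by positivity
    simp only [R]; linarith
  have hδ2 : δ * (4 * G.N ^ 2 * G.numVert * s * B) ≤ b / 4 := by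
    rw [← hδR]
    refine mul_le_mul_of_nonneg_left ?_ hδ.le
    have : 0 ≤ 3 * s * B := by positivity
    simp only [R]; linarith
  -- With `η₀ = 4 δ⁻¹`, a unit-parameter penalty multiplied by `δ⁻¹` is at most a quarter of the
  -- actual penalty.
  refine ⟨4 * δ⁻¹, by positivity, 2 / b + 4 / 3, by positivity, ?_⟩
  intro M hσ hT ε ε₀ ηF ηΓ hε hε₀ hN hη hηΓ
  have hδi : 0 < δ⁻¹ := inv_pos.2 hδ
  have hF : ∀ i F, 0 < ηF i F := fun i F => by
    rcases hε i with h | h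
    · exact hN i h F
    · exact lt_of_lt_of_le (by positivity) (hη i h F)
  have hΓ : ∀ γ, 0 < ηΓ γ := fun γ => lt_of_lt_of_le (by positivity) (hηΓ γ)
  have hcoer : ∀ v : M.V p, dgNorm ηF ηΓ v ^ 2 ≤ (2 / b + 4 / 3) * a κ ε ε₀ ηF ηΓ v v := by
    intro v
    have gnn : ∀ i, 0 ≤ ∑ K, energy v i K := fun i =>
      Finset.sum_nonneg fun K _ => energy_nonneg v i K
    have key := interior_penalty_coercive (c := b) (y := ∑ γ ∈ G.bifs, avgJump κ v v γ)
      (z := penBif ηΓ v) (ε₀ := ε₀) (ε := ε)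
      (A := fun i => ∑ K, ∫ x in (M.lo i K)..(M.hi i K), κ i x * dval v i K x * dval v i K x)
      (g := fun i => ∑ K, energy v i K) (x := fun i => consEdge κ i v v)
      (j := fun i => penEdge ηF i v)
      (fun i => by
        rw [Finset.mul_sum]
        exact Finset.sum_le_sum fun K _ => mul_energy_le hm hc hb v i K)
      (penBif_nonneg hΓ v) (fun i => penEdge_nonneg (hF i) v) hε hε₀
      (fun i => mul_nonneg hb0.le (gnn i))
      (fun i hi => by
        refine (two_mul_abs_consEdge_le hB (hflux M hT) hσ hs1 (le_max_left _ _) hδ v i).trans ?_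
        refine add_le_add (mul_le_mul_of_nonneg_right hδ1 (gnn i)) ?_
        have := penEdge_one_le (hη i hi) v
        linarith)
      (by
        refine (two_mul_abs_sum_avgJump_le hB (hflux M hT) hσ hs1 (le_max_left _ _) hδ v).trans ?_
        refine add_le_add (mul_le_mul_of_nonneg_right hδ2 (Finset.sum_nonneg fun i _ => gnn i)) ?_
        have := penBif_one_le hηΓ v
        linarith)
    rw [← a_self κ ε ε₀ ηF ηΓ v] at key
    rw [dgNorm_sq hF hΓ]
    have g0 : 0 ≤ ∑ i, ∑ K, energy v i K := Finset.sum_nonneg fun i _ => gnn i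
    have q0 : 0 ≤ ∑ i, penEdge ηF i v + penBif ηΓ v :=
      add_nonneg (Finset.sum_nonneg fun i _ => penEdge_nonneg (hF i) v) (penBif_nonneg hΓ v)
    exact le_mul_of_energy_le hb0 g0 q0 key
  have hfin := finite_degreeLE p
  refine ⟨hcoer, fun hG f hf => (isBilin_a hm hc ε ε₀ ηF ηΓ).existsUnique_of_definite ?_
    (isLin_load hf)⟩
  intro u hu
  have h1 := hcoer u
  rw [hu, mul_zero] at h1
  exact eq_zero_of_dgNorm_eq_zero hG hF hΓ (le_antisymm h1 (sq_nonneg _))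

end EdgeDG.Mesh

/-! ## Triangles -/

namespace PlaneDG

theorem seg_mk {E : Type} [AddCommGroup E] [Module ℝ E] (a b : E) : seg s(a, b) = segment ℝ a b := by
  rw [seg, ← convexHull_pair]
  congr 1
  ext x
  simp

theorem seg_map {E F : Type} [NormedAddCommGroup E] [NormedSpace ℝ E] [NormedAddCommGroup F]
    [NormedSpace ℝ F] (f : E →ᵃ[ℝ] F) (s : Sym2 E) : seg (s.map f) = f '' seg s := by
  induction s with
  | _ a b => rw [Sym2.map_mk, seg_mk, seg_mk, image_segment]

namespace Tri

variable (T T' : Tri)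

theorem affineSpan_eq_top : affineSpan ℝ (range T.points) = ⊤ := by
  rw [T.independent.affineSpan_eq_top_iff_card_eq_finrank_add_one]
  simp

/-- The vertices of a triangle as an affine basis of the plane. -/
noncomputable def basis : AffineBasis (Fin 3) ℝ E2 := ⟨T.points, T.independent, T.affineSpan_eq_top⟩

/-- The barycentric coordinate of the vertex `e`. -/
noncomputable def bary (e : Fin 3) : E2 →ᵃ[ℝ] ℝ := T.basis.coord e

theorem carrier_eq : T.carrier = {x | ∀ e, 0 ≤ T.bary e x} := T.basis.convexHull_eq_nonneg_coord

theorem interior_carrier_eq : interior T.carrier = {x | ∀ e, 0 < T.bary e x} :=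
  T.basis.interior_convexHull

theorem continuous_bary (e : Fin 3) : Continuous (T.bary e) := continuous_barycentric_coord T.basis e

theorem bary_points (e k : Fin 3) : T.bary e (T.points k) = if e = k then 1 else 0 :=
  T.basis.coord_apply e k

theorem bary_self (e : Fin 3) : T.bary e (T.points e) = 1 := by simp [bary_points]

theorem map_eq_sum (f : E2 →ᵃ[ℝ] ℝ) (x : E2) : f x = ∑ k, T.bary k x * f (T.points k) := by
  have h := T.basis.affineCombination_coord_eq_self x
  have hs := T.basis.sum_coord_apply_eq_one x
  conv_lhs => rw [← h, Finset.map_affineCombination _ _ _ hs,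
    Finset.affineCombination_eq_linear_combination _ _ _ hs]
  rfl

/-- Indices are taken modulo 3: `e` is the apex and `e + 1`, `e + 2` are the ends of the opposite
edge. This avoids a distinction of cases for the three edges. -/
theorem sum_eq_rotate (e : Fin 3) (g : Fin 3 → ℝ) : ∑ k, g k = g e + g (e + 1) + g (e + 2) := by
  rw [Fin.sum_univ_three]
  fin_cases e <;> simp [Fin.isValue] <;> try ring_nf

theorem ne_add_one (e : Fin 3) : e ≠ e + 1 := by revert e; decide
theorem ne_add_two (e : Fin 3) : e ≠ e + 2 := by revert e; decide
theorem add_one_ne_add_two (e : Fin 3) : e + 1 ≠ e + 2 := by revert e; decide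

theorem forall_rotate (e : Fin 3) {P : Fin 3 → Prop} (h0 : P e) (h1 : P (e + 1)) (h2 : P (e + 2)) :
    ∀ k, P k := by
  intro k
  have : ∀ e k : Fin 3, k = e ∨ k = e + 1 ∨ k = e + 2 := by decide
  have := this e k
  rcases this with rfl | rfl | rfl <;> assumption

theorem bary_edgePt (e k : Fin 3) (t : ℝ) :
    T.bary k (T.edgePt e t) =
      (1 - t) * T.bary k (T.points (e + 1)) + t * T.bary k (T.points (e + 2)) := by
  rw [edgePt, AffineMap.apply_lineMap, AffineMap.lineMap_apply_ring']
  simp only [fst, snd]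
  ring

theorem bary_edgePt_zero (e : Fin 3) (t : ℝ) : T.bary e (T.edgePt e t) = 0 := by
  rw [bary_edgePt, bary_points, bary_points, if_neg (ne_add_one e), if_neg (ne_add_two e)]; ring

theorem bary_edgePt_one (e : Fin 3) (t : ℝ) : T.bary (e + 1) (T.edgePt e t) = 1 - t := by
  rw [bary_edgePt, bary_points, bary_points, if_pos rfl, if_neg (add_one_ne_add_two e)]; ring

theorem bary_edgePt_two (e : Fin 3) (t : ℝ) : T.bary (e + 2) (T.edgePt e t) = t := by
  rw [bary_edgePt, bary_points, bary_points, if_neg (add_one_ne_add_two e).symm, if_pos rfl]; ring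

theorem edgePt_mem {e : Fin 3} {t : ℝ} (ht : t ∈ Icc (0 : ℝ) 1) : T.edgePt e t ∈ T.carrier := by
  rw [carrier_eq]
  refine forall_rotate e ?_ ?_ ?_
  · rw [bary_edgePt_zero]
  · rw [bary_edgePt_one]; linarith [ht.2]
  · rw [bary_edgePt_two]; exact ht.1

theorem continuous_edgePt (e : Fin 3) : Continuous (T.edgePt e) := AffineMap.lineMap_continuous

theorem isCompact_carrier : IsCompact T.carrier := (Set.finite_range _).isCompact_convexHull ℝ

theorem convex_carrier : Convex ℝ T.carrier := convex_convexHull ℝ _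

theorem points_mem (k : Fin 3) : T.points k ∈ T.carrier := subset_convexHull ℝ _ ⟨k, rfl⟩

theorem interior_nonempty : (interior T.carrier).Nonempty :=
  ⟨_, T.basis.centroid_mem_interior_convexHull⟩

theorem ext_bary {x y : E2} (h : ∀ k, T.bary k x = T.bary k y) : x = y :=
  T.basis.ext_elem h

theorem sum_bary (x : E2) : ∑ k, T.bary k x = 1 := T.basis.sum_coord_apply_eq_one x

/-- On the line through edge `e` the barycentric coordinate of `e + 2` is the edge parameter. -/
theorem edgePt_eq {e : Fin 3} {x : E2} (h : T.bary e x = 0) : T.edgePt e (T.bary (e + 2) x) = x := by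
  refine T.ext_bary (forall_rotate e ?_ ?_ ?_)
  · rw [bary_edgePt_zero, h]
  · rw [bary_edgePt_one, ← T.sum_bary x, sum_eq_rotate e, h]; ring
  · rw [bary_edgePt_two]

theorem seg_edge (e : Fin 3) : seg (T.edge e) = T.edgePt e '' Icc 0 1 := by
  rw [edge, seg_mk, segment_eq_image_lineMap]
  rfl

theorem mem_seg_edge {e : Fin 3} {x : E2} (hx : x ∈ T.carrier) (h : T.bary e x = 0) :
    x ∈ seg (T.edge e) := by
  rw [seg_edge]
  rw [carrier_eq] at hx
  refine ⟨T.bary (e + 2) x, ⟨hx _, ?_⟩, T.edgePt_eq h⟩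
  have := T.sum_bary x
  rw [sum_eq_rotate e, h] at this
  linarith [hx (e + 1)]

variable {T T'}

theorem edgePt_eq_or {e e' : Fin 3} (h : T.edge e = T'.edge e') :
    (∀ t, T.edgePt e t = T'.edgePt e' t) ∨ ∀ t, T.edgePt e t = T'.edgePt e' (1 - t) := by
  rcases Sym2.eq_iff.1 h with ⟨h1, h2⟩ | ⟨h1, h2⟩
  · exact .inl fun t => by rw [edgePt, h1, h2]; rfl
  · exact .inr fun t => by rw [edgePt, h1, h2, edgePt, AffineMap.lineMap_apply_one_sub]

/-- The barycentric coordinates of two triangles that vanish on a common edge are proportional. -/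
theorem bary_eq_mul {e e' : Fin 3} (h : T.edge e = T'.edge e') (x : E2) :
    T'.bary e' x = T.bary e x * T'.bary e' (T.points e) := by
  -- The coordinate of `T'` vanishes at both ends of the edge, so only the apex term survives in its
  -- expansion over the vertices of `T`.
  have hz : T'.bary e' (T.points (e + 1)) = 0 ∧ T'.bary e' (T.points (e + 2)) = 0 := by
    have h0 : T'.bary e' (T'.points (e' + 1)) = 0 := by rw [bary_points, if_neg (ne_add_one e')]
    have h1 : T'.bary e' (T'.points (e' + 2)) = 0 := by rw [bary_points, if_neg (ne_add_two e')]
    rcases Sym2.eq_iff.1 h with ⟨a, b⟩ | ⟨a, b⟩ <;> simp only [fst, snd] at a b <;> rw [a, b]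
    exacts [⟨h0, h1⟩, ⟨h1, h0⟩]
  rw [T.map_eq_sum (T'.bary e') x, sum_eq_rotate e, hz.1, hz.2]
  ring

/-- Otherwise the coordinate of `T'` would vanish identically, although it is 1 at its own apex. The
sign of this number tells whether the two triangles lie on the same side of the edge. -/
theorem bary_apex_ne_zero {e e' : Fin 3} (h : T.edge e = T'.edge e') :
    T'.bary e' (T.points e) ≠ 0 := by
  intro h0
  have := bary_eq_mul h (T'.points e')
  rw [h0, bary_self] at this
  linarith

theorem bary_pos_of_mem_openEdge {e e' : Fin 3} (h : T.edge e = T'.edge e') {t : ℝ}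
    (ht : t ∈ Ioo (0 : ℝ) 1) :
    0 < T'.bary (e' + 1) (T.edgePt e t) ∧ 0 < T'.bary (e' + 2) (T.edgePt e t) := by
  rcases edgePt_eq_or h with h | h <;> rw [h, bary_edgePt_one, bary_edgePt_two]
  · exact ⟨by linarith [ht.2], ht.1⟩
  · exact ⟨by linarith [ht.1], by linarith [ht.2]⟩

theorem eventually_bary_pos {e e' : Fin 3} (h : T.edge e = T'.edge e') {t : ℝ}
    (ht : t ∈ Ioo (0 : ℝ) 1) :
    ∀ᶠ x in 𝓝 (T.edgePt e t), 0 < T'.bary (e' + 1) x ∧ 0 < T'.bary (e' + 2) x :=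
  ((T'.continuous_bary _).continuousAt.eventually (lt_mem_nhds (bary_pos_of_mem_openEdge h ht).1)).and
    ((T'.continuous_bary _).continuousAt.eventually (lt_mem_nhds (bary_pos_of_mem_openEdge h ht).2))

/-- Two triangles on the same side of a common edge overlap. -/
theorem not_disjoint_interior {e e' : Fin 3} (h : T.edge e = T'.edge e')
    (hs : 0 < T'.bary e' (T.points e)) :
    ¬ Disjoint (interior T.carrier) (interior T'.carrier) := by
  have ht : (1 / 2 : ℝ) ∈ Ioo (0 : ℝ) 1 := by norm_num
  -- A path from the midpoint of the edge to the apex of `T`, along which the coordinate of `e`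
  -- equals `s`. Near the midpoint the coordinates of the edge's ends are positive for both
  -- triangles, so a small `s` gives a common interior point.
  let g : ℝ → E2 := fun s => AffineMap.lineMap (T.edgePt e (1 / 2)) (T.points e) s
  have hg : Tendsto g (𝓝[>] 0) (𝓝 (T.edgePt e (1 / 2))) := by
    have : Continuous g := AffineMap.lineMap_continuous
    have h0 : g 0 = T.edgePt e (1 / 2) := AffineMap.lineMap_apply_zero _ _
    rw [← h0]
    exact this.continuousAt.tendsto.mono_left nhdsWithin_le_nhds
  have hb : ∀ s, T.bary e (g s) = s := fun s => by
    simp only [g]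
    rw [AffineMap.apply_lineMap, bary_edgePt_zero, bary_self, AffineMap.lineMap_apply_ring']
    ring
  obtain ⟨s, h1, h2, h3⟩ := ((hg.eventually (eventually_bary_pos (T := T) (T' := T) rfl ht)).and
    ((hg.eventually (eventually_bary_pos h ht)).and self_mem_nhdsWithin)).exists
  refine Set.not_disjoint_iff.2 ⟨g s, ?_, ?_⟩
  · rw [interior_carrier_eq]
    exact forall_rotate e (by rw [hb]; exact h3) h1.1 h1.2
  · rw [interior_carrier_eq]
    exact forall_rotate e' (by rw [bary_eq_mul h, hb]; exact mul_pos h3 hs) h2.1 h2.2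

/-- Two triangles on opposite sides of a common edge cover a neighbourhood of the points of the
open edge. -/
theorem union_mem_nhds {e e' : Fin 3} (h : T.edge e = T'.edge e')
    (hs : T'.bary e' (T.points e) < 0) {t : ℝ} (ht : t ∈ Ioo (0 : ℝ) 1) :
    T.carrier ∪ T'.carrier ∈ 𝓝 (T.edgePt e t) := by
  filter_upwards [eventually_bary_pos (T := T) (T' := T) (e := e) rfl ht, eventually_bary_pos h ht]
    with x h1 h2
  -- Near the point only the sign of this coordinate decides membership, and the coordinate of `T'`
  -- has the opposite sign.
  rcases le_total 0 (T.bary e x) with hx | hx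
  · left
    rw [carrier_eq]
    exact forall_rotate e hx h1.1.le h1.2.le
  · right
    rw [carrier_eq]
    exact forall_rotate e' (by rw [bary_eq_mul h]; exact mul_nonneg_of_nonpos_of_nonpos hx hs.le)
      h2.1.le h2.2.le

theorem edge_injective (T : Tri) : Function.Injective T.edge := by
  intro e e' h
  have := bary_apex_ne_zero h
  rw [bary_points] at this
  by_contra hne
  exact this (if_neg fun h => hne h.symm)

theorem len_pos (T : Tri) (e : Fin 3) : 0 < T.len e :=
  dist_pos.2 fun h => add_one_ne_add_two e (T.independent.injective h)

theorem len_le_diam (T : Tri) (e : Fin 3) : T.len e ≤ Metric.diam T.carrier :=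
  Metric.dist_le_diam_of_mem T.isCompact_carrier.isBounded (T.points_mem _) (T.points_mem _)

/-- The bound holds even for a zero vector, so `outward` need not be shown to be nonzero. -/
theorem norm_normal_le (T : Tri) (e : Fin 3) : ‖T.normal e‖ ≤ 1 := by
  rw [normal, norm_smul, norm_inv, norm_norm]
  exact inv_mul_le_one

theorem edgeInt_eq (T : Tri) (e : Fin 3) (g : E2 → ℝ) :
    T.edgeInt e g = T.len e * ∫ t in Icc (0 : ℝ) 1, g (T.edgePt e t) := by
  rw [edgeInt, intervalIntegral.integral_of_le zero_le_one, integral_Icc_eq_integral_Ioc]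

end Tri

end PlaneDG

/-! ## Polynomials of two variables -/

theorem IsLin.eq_sum_basis {ι V : Type*} [Fintype ι] [AddCommGroup V] [Module ℝ V] {f : V → ℝ}
    (hf : IsLin f) (b : Module.Basis ι ℝ V) (v : V) : f v = ∑ k, f (b k) * b.repr v k := by
  let L : V →ₗ[ℝ] ℝ := ⟨⟨f, hf.add⟩, hf.smul⟩
  have h : L v = ∑ k, b.repr v k • L (b k) := by
    conv_lhs => rw [← b.sum_repr v, map_sum]
    simp_rw [map_smul]
  exact h.trans (Finset.sum_congr rfl fun k _ => mul_comm _ _)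

namespace PlaneDG

/-- The value of a polynomial at a point of the plane. -/
noncomputable def polyVal (q : MvPolynomial (Fin 2) ℝ) (x : E2) : ℝ :=
  MvPolynomial.eval (fun k => x k) q

theorem continuous_polyVal (q : MvPolynomial (Fin 2) ℝ) : Continuous (polyVal q) :=
  (MvPolynomial.continuous_eval q).comp (by fun_prop)

theorem isLin_polyVal (x : E2) : IsLin fun q : MvPolynomial (Fin 2) ℝ => polyVal q x :=
  ⟨fun q r => by simp [polyVal], fun c q => by simp [polyVal, MvPolynomial.smul_eval]⟩

/-- An open set contains a product of infinite sets, and a polynomial vanishing on such a product is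
zero. -/
theorem eq_zero_of_polyVal_eq_zero {q : MvPolynomial (Fin 2) ℝ} {U : Set E2} (hU : IsOpen U)
    (hne : U.Nonempty) (h : ∀ x ∈ U, polyVal q x = 0) : q = 0 := by
  obtain ⟨x, hx⟩ := hne
  have hc : Continuous fun y : Fin 2 → ℝ => (WithLp.toLp 2 y : E2) := by fun_prop
  obtain ⟨u, hu, hs⟩ := isOpen_pi_iff'.1 (hU.preimage hc) (fun k => x k) hx
  refine MvPolynomial.funext_set u (fun i => infinite_of_mem_nhds (x i)
    ((hu i).1.mem_nhds (hu i).2)) fun y hy => ?_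
  rw [map_zero]
  exact h _ (hs hy)

theorem pderiv_mem_restrictTotalDegree {q : MvPolynomial (Fin 2) ℝ} {p : ℕ}
    (hq : q ∈ MvPolynomial.restrictTotalDegree (Fin 2) ℝ p) (l : Fin 2) :
    MvPolynomial.pderiv l q ∈ MvPolynomial.restrictTotalDegree (Fin 2) ℝ p := by
  rw [MvPolynomial.mem_restrictTotalDegree] at hq ⊢
  refine Finset.sup_le fun m hm => ?_
  rw [MvPolynomial.mem_support_iff, MvPolynomial.coeff_pderiv] at hm
  have h1 := MvPolynomial.le_totalDegree (MvPolynomial.mem_support_iff.2 (left_ne_zero_of_mul hm))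
  refine le_trans ?_ (h1.trans hq)
  rw [Finsupp.sum_add_index' (by simp) (by simp)]
  exact Nat.le_add_right _ _

/-- The coefficient of a nonconstant monomial containing the variable `l` reappears in the
derivative by `l`, multiplied by a positive integer. -/
theorem eq_C_of_pderiv_eq_zero {q : MvPolynomial (Fin 2) ℝ}
    (h : ∀ l, MvPolynomial.pderiv l q = 0) : q = MvPolynomial.C (MvPolynomial.coeff 0 q) := by
  ext m
  rw [MvPolynomial.coeff_C]
  split_ifs with hm
  · rw [hm]
  · obtain ⟨l, hl⟩ := Finsupp.ne_iff.1 (Ne.symm hm)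
    have h1 := MvPolynomial.coeff_pderiv (i := l) q (m - Finsupp.single l 1)
    have e : m - Finsupp.single l 1 + Finsupp.single l 1 = m := by
      refine tsub_add_cancel_of_le (Finsupp.single_le_iff.2 ?_)
      exact Nat.one_le_iff_ne_zero.2 hl
    rw [h, MvPolynomial.coeff_zero, e] at h1
    refine (mul_eq_zero.1 h1.symm).resolve_right ?_
    positivity

/-- Composition of a polynomial with the homothety `y ↦ c + r y`. -/
theorem exists_comp_homothety {q : MvPolynomial (Fin 2) ℝ} {p : ℕ}
    (hq : q ∈ MvPolynomial.restrictTotalDegree (Fin 2) ℝ p) (c : E2) (r : ℝ) :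
    ∃ q' ∈ MvPolynomial.restrictTotalDegree (Fin 2) ℝ p, ∀ y, polyVal q' y = polyVal q (c + r • y) := by
  let g : Fin 2 → MvPolynomial (Fin 2) ℝ := fun k =>
    MvPolynomial.C (c k) + MvPolynomial.C r * MvPolynomial.X k
  refine ⟨MvPolynomial.aeval g q, ?_, fun y => ?_⟩
  · rw [MvPolynomial.mem_restrictTotalDegree] at hq ⊢
    have hg : ∀ k, (g k).totalDegree ≤ 1 := fun k => by
      refine (MvPolynomial.totalDegree_add _ _).trans (max_le (by simp) ?_)
      refine (MvPolynomial.totalDegree_mul _ _).trans ?_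
      simp
    rw [MvPolynomial.aeval_def, MvPolynomial.eval₂_eq']
    refine MvPolynomial.totalDegree_finsetSum_le fun m hm => ?_
    refine (MvPolynomial.totalDegree_mul _ _).trans ?_
    rw [MvPolynomial.algebraMap_eq, MvPolynomial.totalDegree_C, zero_add]
    refine (MvPolynomial.totalDegree_finsetProd _ _).trans ?_
    refine le_trans (Finset.sum_le_sum (g := fun k => m k) fun k _ => ?_) ?_
    · exact (MvPolynomial.totalDegree_pow _ _).trans
        ((Nat.mul_le_mul_left _ (hg k)).trans (by simp))
    · refine le_trans (le_of_eq ?_) ((MvPolynomial.le_totalDegree hm).trans hq)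
      rw [Finsupp.sum_fintype _ _ fun _ => rfl]
  · refine (MvPolynomial.eval₂Hom_bind₁ _ _ _ _).trans ?_
    rw [polyVal, MvPolynomial.eval]
    congr 2
    ext k
    simp [g]

/-- The bound must be uniform over a continuum of points `y`, so the coordinates in a basis are
bounded instead of each evaluation: Cauchy–Schwarz separates them from the values of the basis
polynomials, which are bounded on a compact ball. -/
theorem exists_polyVal_sq_le_integral (p : ℕ) (R : ℝ) : ∃ C, 0 ≤ C ∧
    ∀ q ∈ MvPolynomial.restrictTotalDegree (Fin 2) ℝ p, ∀ y : E2, ‖y‖ ≤ R →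
      polyVal q y ^ 2 ≤ C * ∫ x in Metric.closedBall (0 : E2) 1, polyVal q x ^ 2 := by
  let V := MvPolynomial.restrictTotalDegree (Fin 2) ℝ p
  let B := Metric.closedBall (0 : E2) 1
  have hBc : IsCompact B := isCompact_closedBall _ _
  have hlin : ∀ x, IsLin fun q : V => polyVal q x := fun x =>
    ⟨fun q r => (isLin_polyVal x).add q r, fun c q => (isLin_polyVal x).smul c q⟩
  have hint : ∀ q r : V, IntegrableOn (fun x => polyVal q x * polyVal r x) B := fun q r =>
    ((continuous_polyVal q).mul (continuous_polyVal r)).continuousOn.integrableOn_compact hBc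
  have hb : IsBilin fun q r : V => ∫ x in B, polyVal q x * polyVal r x :=
    IsBilin.integral (fun t => (hlin t).mul (hlin t)) hint
  have hd : ∀ q : V, ∫ x in B, polyVal q x * polyVal q x = 0 → q = 0 := by
    intro q hq
    have h := eqOn_zero_of_setIntegral_eq_zero Metric.isOpen_ball Metric.ball_subset_closedBall
      ((continuous_polyVal q).mul (continuous_polyVal q)).continuousOn
      (fun x => mul_self_nonneg _) (hint q q) hq
    exact Subtype.ext (eq_zero_of_polyVal_eq_zero Metric.isOpen_ball
      (Metric.nonempty_ball.2 one_pos) fun x hx => mul_self_eq_zero.1 (h hx))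
  let b := Module.finBasis ℝ V
  have key := fun k => hb.exists_sq_le (fun q r => by simp_rw [mul_comm])
    (fun q => integral_nonneg fun t => mul_self_nonneg _) hd
    (ℓ := fun q => b.repr q k) ⟨fun q r => by simp, fun c q => by simp⟩
  choose A hA0 hA using key
  let S : E2 → ℝ := fun y => (∑ k, polyVal (b k) y ^ 2) * ∑ k, A k
  have hS : Continuous S :=
    (continuous_finsetSum _ fun k _ => (continuous_polyVal _).pow 2).mul continuous_const
  obtain ⟨C, hC⟩ := (isCompact_closedBall (0 : E2) R).exists_bound_of_continuousOn hS.continuousOn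
  -- For `R < 0` the ball is empty and `C` could be negative.
  refine ⟨max C 0, le_max_right _ _, fun q hq y hy => ?_⟩
  have hy' := (le_abs_self _).trans (hC y (mem_closedBall_zero_iff.2 hy))
  have hn : 0 ≤ ∫ x in B, polyVal q x * polyVal q x := integral_nonneg fun t => mul_self_nonneg _
  have e : polyVal q y = ∑ k, polyVal (b k) y * b.repr ⟨q, hq⟩ k :=
    (hlin y).eq_sum_basis b ⟨q, hq⟩
  simp_rw [sq (polyVal q _)]
  rw [← sq]
  calc polyVal q y ^ 2 ≤ (∑ k, polyVal (b k) y ^ 2) * ∑ k, (b.repr ⟨q, hq⟩ k) ^ 2 := by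
        rw [e]; exact Finset.sum_mul_sq_le_sq_mul_sq _ _ _
    _ ≤ (∑ k, polyVal (b k) y ^ 2) * ∑ k, A k * ∫ x in B, polyVal q x * polyVal q x := by
        refine mul_le_mul_of_nonneg_left (Finset.sum_le_sum fun k _ => hA k ⟨q, hq⟩) ?_
        exact Finset.sum_nonneg fun _ _ => sq_nonneg _
    _ = S y * ∫ x in B, polyVal q x * polyVal q x := by
        rw [← Finset.sum_mul, ← mul_assoc]
    _ ≤ max C 0 * ∫ x in B, polyVal q x * polyVal q x :=
        mul_le_mul_of_nonneg_right (hy'.trans (le_max_left _ _)) hn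

theorem integral_closedBall_eq (f : E2 → ℝ) (c : E2) {r : ℝ} (hr : 0 < r) :
    ∫ x in Metric.closedBall c r, f x =
      r ^ 2 * ∫ y in Metric.closedBall (0 : E2) 1, f (c + r • y) := by
  have h1 := Measure.setIntegral_comp_smul_of_pos (volume : Measure E2) (fun x => f (c + x))
    (Metric.closedBall (0 : E2) 1) hr
  rw [smul_unitClosedBall_of_nonneg hr.le, finrank_euclideanSpace_fin] at h1
  rw [h1, smul_eq_mul, mul_inv_cancel_left₀ (by positivity)]
  have h2 := (measurePreserving_add_left (volume : Measure E2) c).setIntegral_preimage_emb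
    (MeasurableEquiv.addLeft c).measurableEmbedding f (Metric.closedBall c r)
  rw [← h2]
  congr 2
  ext x
  simp

/-- Inverse inequality: polynomials on the `R`-fold dilation of a disk. -/
theorem exists_sq_mul_polyVal_sq_le (p : ℕ) (R : ℝ) : ∃ C, 0 ≤ C ∧
    ∀ q ∈ MvPolynomial.restrictTotalDegree (Fin 2) ℝ p, ∀ (c x : E2) (r : ℝ), 0 < r →
      dist x c ≤ R * r →
      r ^ 2 * polyVal q x ^ 2 ≤ C * ∫ y in Metric.closedBall c r, polyVal q y ^ 2 := by
  obtain ⟨C, hC, h⟩ := exists_polyVal_sq_le_integral p R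
  refine ⟨C, hC, fun q hq c x r hr hx => ?_⟩
  obtain ⟨q', hq', he⟩ := exists_comp_homothety hq c r
  -- The homothety with centre `c` and ratio `r` carries the unit disk to the given disk, and this
  -- point to `x`.
  have h1 := h q' hq' (r⁻¹ • (x - c)) (by
    rw [norm_smul, norm_inv, Real.norm_of_nonneg hr.le, ← dist_eq_norm, inv_mul_le_iff₀ hr]
    linarith)
  simp_rw [he] at h1
  rw [smul_inv_smul₀ hr.ne', add_sub_cancel] at h1
  rw [integral_closedBall_eq _ c hr]
  calc _ ≤ r ^ 2 * (C * ∫ y in Metric.closedBall (0 : E2) 1, polyVal q (c + r • y) ^ 2) := by gcongr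
    _ = _ := by ring

end PlaneDG

/-! ## Meshes of plane-networks -/

/-- Two triangles may run through a common edge in opposite directions. -/
theorem measurePreserving_one_sub :
    MeasurePreserving (fun t : ℝ => 1 - t) (volume.restrict (Icc (0 : ℝ) 1))
      (volume.restrict (Icc (0 : ℝ) 1)) := by
  have h := (Measure.measurePreserving_sub_left (volume : Measure ℝ) 1).restrict_preimage
    (measurableSet_Icc (a := (0 : ℝ)) (b := 1))
  have e : (fun t : ℝ => 1 - t) ⁻¹' Icc (0 : ℝ) 1 = Icc 0 1 := by
    ext t; simp only [mem_preimage, mem_Icc]; constructor <;> rintro ⟨a, b⟩ <;> constructor <;> linarith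
  rwa [e] at h

theorem sum_fst_le {A B : Type*} [Fintype A] [DecidableEq A] {S : Finset (A × B)} {n : ℕ}
    (hS : ∀ a, (S.filter fun x => x.1 = a).card ≤ n) {f : A → ℝ} (hf : ∀ a, 0 ≤ f a) :
    ∑ x ∈ S, f x.1 ≤ n * ∑ a, f a := by
  rw [← Finset.sum_fiberwise S Prod.fst, Finset.mul_sum]
  refine Finset.sum_le_sum fun a _ => ?_
  rw [Finset.sum_congr rfl (g := fun _ => f a) fun x hx => by rw [(Finset.mem_filter.1 hx).2],
    Finset.sum_const, nsmul_eq_mul]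
  exact mul_le_mul_of_nonneg_right (by exact_mod_cast hS a) (hf a)

namespace PlaneDG.Mesh

variable {G : Network} {M : Mesh G} {p : ℕ}

theorem carrier_subset (M : Mesh G) (i : Fin G.N) (K : Fin (M.n i)) :
    (M.tri i K).carrier ⊆ closure (G.dom i) := by
  rw [← M.cover i]
  exact subset_iUnion (fun K => (M.tri i K).carrier) K

theorem interior_carrier_subset (M : Mesh G) (i : Fin G.N) (K : Fin (M.n i)) :
    interior (M.tri i K).carrier ⊆ G.dom i := by
  rw [← (G.polygonal i).2.2.1]
  exact interior_mono (M.carrier_subset i K)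

/-- The boundary of a convex set is a null set. Almost-everywhere statements on the open domain thus
reach the closed triangles. -/
theorem restrict_carrier (M : Mesh G) (i : Fin G.N) (K : Fin (M.n i)) :
    (volume : Measure E2).restrict (M.tri i K).carrier =
      volume.restrict (interior (M.tri i K).carrier) :=
  (Measure.restrict_congr_set (interior_ae_eq_of_null_frontier
    ((M.tri i K).convex_carrier.addHaar_frontier volume))).symm

theorem ae_of_ae_surf (M : Mesh G) {i : Fin G.N} (K : Fin (M.n i)) {P : E2 → Prop}
    (h : ∀ᵐ x ∂(volume.restrict (G.dom i)), P x) :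
    ∀ᵐ x ∂(volume.restrict (M.tri i K).carrier), P x := by
  rw [restrict_carrier]
  exact ae_restrict_of_ae_restrict_of_subset (M.interior_carrier_subset i K) h

/-- The point with parameter `t` on a local edge. -/
noncomputable def pt {i : Fin G.N} (F : M.Loc i) (t : ℝ) : E2 := (M.tri i F.1).edgePt F.2 t

theorem continuous_pt {i : Fin G.N} (F : M.Loc i) : Continuous (pt F) := Tri.continuous_edgePt _ _

theorem pt_mem {i : Fin G.N} (F : M.Loc i) {t : ℝ} (ht : t ∈ Icc (0 : ℝ) 1) :
    pt F t ∈ (M.tri i F.1).carrier := Tri.edgePt_mem _ ht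

theorem len_pos (M : Mesh G) {i : Fin G.N} (F : M.Loc i) : 0 < M.len F := Tri.len_pos _ _

theorem faceInt_eq (M : Mesh G) {i : Fin G.N} (F : M.Loc i) (g : E2 → ℝ) :
    M.faceInt F g = M.len F * ∫ t in Icc (0 : ℝ) 1, g (pt F t) := Tri.edgeInt_eq _ _ _

/-! ### Traces of the coefficient -/

/-- A segment from a point of the triangle to an interior point stays in the interior after its
start. This makes the trace filter nontrivial and realizes traces as limits of sequences. -/
theorem exists_tendsto_interior (T : Tri) {x : E2} (hx : x ∈ T.carrier) {z : E2}
    (hz : z ∈ interior T.carrier) :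
    Tendsto (fun n : ℕ => (AffineMap.lineMap x z (1 / ((n : ℝ) + 1)) : E2)) atTop
      (𝓝[interior T.carrier] x) := by
  refine tendsto_nhdsWithin_iff.2 ⟨?_, .of_forall fun n => ?_⟩
  · have h : Continuous fun s : ℝ => (AffineMap.lineMap x z s : E2) := AffineMap.lineMap_continuous
    have h0 := (h.tendsto 0).comp (tendsto_one_div_add_atTop_nhds_zero_nat (𝕜 := ℝ))
    rwa [AffineMap.lineMap_apply_zero] at h0
  · rw [Tri.interior_carrier_eq] at hz ⊢
    rw [Tri.carrier_eq] at hx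
    intro k
    rw [AffineMap.apply_lineMap, AffineMap.lineMap_apply_ring']
    have h1 : 0 < 1 / ((n : ℝ) + 1) := by positivity
    have h2 : 1 / ((n : ℝ) + 1) ≤ 1 := by
      rw [div_le_one (by positivity)]; linarith [(Nat.cast_nonneg n : (0 : ℝ) ≤ n)]
    have := mul_pos h1 (hz k)
    have := mul_nonneg (sub_nonneg.2 h2) (hx k)
    linarith

theorem neBot_nhdsWithin_interior (T : Tri) {x : E2} (hx : x ∈ T.carrier) :
    (𝓝[interior T.carrier] x).NeBot :=
  let ⟨_, hz⟩ := T.interior_nonempty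
  (exists_tendsto_interior T hx hz).neBot

theorem ae_tendsto_kTrace {κ : Fin G.N → E2 → ℝ} (hκ : M.HasTraces κ) {i : Fin G.N}
    (F : M.Loc i) : ∀ᵐ t ∂(volume.restrict (Icc (0 : ℝ) 1)), t ∈ Icc (0 : ℝ) 1 ∧
      Tendsto (κ i) (𝓝[interior (M.tri i F.1).carrier] (pt F t)) (𝓝 (M.kTrace κ i F.1 (pt F t))) := by
  filter_upwards [hκ i F.1 F.2, ae_restrict_mem measurableSet_Icc] with t ht ht'
  have := neBot_nhdsWithin_interior _ (pt_mem F ht')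
  exact ⟨ht', tendsto_nhds_limUnder ht⟩

theorem ae_abs_kTrace_le {κ : Fin G.N → E2 → ℝ} (hκ : M.HasTraces κ) {c : ℝ}
    (hc : ∀ i, ∀ᵐ x ∂(volume.restrict (G.dom i)), κ i x ∈ Icc (-c) c) {i : Fin G.N} (F : M.Loc i) :
    ∀ᵐ t ∂(volume.restrict (Icc (0 : ℝ) 1)), |M.kTrace κ i F.1 (pt F t)| ≤ c := by
  filter_upwards [ae_tendsto_kTrace hκ F] with t ht
  have := neBot_nhdsWithin_interior _ (pt_mem F ht.1)
  exact abs_le.2 (mem_Icc_of_tendsto_nhdsWithin isOpen_interior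
    (mem_closure_iff_nhdsWithin_neBot.2 this)
    (ae_restrict_of_ae_restrict_of_subset (M.interior_carrier_subset i F.1) (hc i)) ht.2)

/-- The trace is almost everywhere the limit of the measurable functions obtained by evaluating `κ`
on edges shrunk slightly towards an interior point `z`. -/
theorem aemeasurable_kTrace {κ : Fin G.N → E2 → ℝ} (hm : ∀ i, Measurable (κ i))
    (hκ : M.HasTraces κ) {i : Fin G.N} (F : M.Loc i) :
    AEMeasurable (fun t => M.kTrace κ i F.1 (pt F t)) (volume.restrict (Icc (0 : ℝ) 1)) := by
  obtain ⟨z, hz⟩ := (M.tri i F.1).interior_nonempty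
  refine aemeasurable_of_tendsto_metrizable_ae atTop
    (f := fun (n : ℕ) t => κ i (AffineMap.lineMap (pt F t) z (1 / ((n : ℝ) + 1)))) (fun n => ?_) ?_
  · refine ((hm i).comp (Continuous.measurable ?_)).aemeasurable
    simp only [AffineMap.lineMap_apply_module]
    have := continuous_pt F
    fun_prop
  · filter_upwards [ae_tendsto_kTrace hκ F] with t ht
    exact ht.2.comp (exists_tendsto_interior _ (pt_mem F ht.1) hz)

/-! ### Mesh functions -/

theorem isLin_val (i : Fin G.N) (K : Fin (M.n i)) (x : E2) : IsLin fun v : M.V p => val v i K x :=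
  ⟨fun u v => (isLin_polyVal x).add (u i K) (v i K), fun c v => (isLin_polyVal x).smul c (v i K)⟩

theorem grad_apply (v : M.V p) (i : Fin G.N) (K : Fin (M.n i)) (x : E2) (l : Fin 2) :
    grad v i K x l = polyVal (MvPolynomial.pderiv l (v i K : MvPolynomial (Fin 2) ℝ)) x := rfl

theorem grad_add (u v : M.V p) (i : Fin G.N) (K : Fin (M.n i)) (x : E2) :
    grad (u + v) i K x = grad u i K x + grad v i K x := by
  ext l
  rw [PiLp.add_apply, grad_apply, grad_apply, grad_apply, ← (isLin_polyVal x).add, ← map_add]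
  rfl

theorem grad_smul (c : ℝ) (v : M.V p) (i : Fin G.N) (K : Fin (M.n i)) (x : E2) :
    grad (c • v) i K x = c • grad v i K x := by
  ext l
  rw [PiLp.smul_apply, grad_apply, grad_apply, smul_eq_mul, ← (isLin_polyVal x).smul]
  congr 1
  exact Derivation.map_smul _ _ _

theorem isLin_inner_grad (i : Fin G.N) (K : Fin (M.n i)) (x n : E2) :
    IsLin fun v : M.V p => inner ℝ (grad v i K x) n :=
  ⟨fun u v => by rw [grad_add, inner_add_left], fun c v => by
    rw [grad_smul, real_inner_smul_left]⟩

theorem isBilin_inner_grad (i : Fin G.N) (K : Fin (M.n i)) (x : E2) :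
    IsBilin fun u v : M.V p => inner ℝ (grad u i K x) (grad v i K x) :=
  ⟨fun u v w => by rw [grad_add, inner_add_left], fun c v w => by
    rw [grad_smul, real_inner_smul_left], fun u v w => by rw [grad_add, inner_add_right],
    fun c v w => by rw [grad_smul, real_inner_smul_right]⟩

theorem continuous_val (v : M.V p) (i : Fin G.N) (K : Fin (M.n i)) : Continuous (val v i K) :=
  continuous_polyVal _

theorem continuous_grad (v : M.V p) (i : Fin G.N) (K : Fin (M.n i)) : Continuous (grad v i K) := by
  have : ∀ l, Continuous fun x => polyVal (MvPolynomial.pderiv l (v i K : MvPolynomial (Fin 2) ℝ)) x :=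
    fun l => continuous_polyVal _
  exact (PiLp.continuous_toLp 2 _).comp (continuous_pi this)

/-- The Dirichlet energy of a mesh function on a triangle. -/
noncomputable def energy (v : M.V p) (i : Fin G.N) (K : Fin (M.n i)) : ℝ :=
  ∫ x in (M.tri i K).carrier, ‖grad v i K x‖ ^ 2

theorem energy_nonneg (v : M.V p) (i : Fin G.N) (K : Fin (M.n i)) : 0 ≤ energy v i K :=
  integral_nonneg fun _ => sq_nonneg _

theorem norm_grad_sq (v : M.V p) (i : Fin G.N) (K : Fin (M.n i)) (x : E2) :
    ‖grad v i K x‖ ^ 2 =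
      ∑ l, polyVal (MvPolynomial.pderiv l (v i K : MvPolynomial (Fin 2) ℝ)) x ^ 2 := by
  rw [EuclideanSpace.real_norm_sq_eq]
  rfl

theorem integrableOn_carrier (T : Tri) {f : E2 → ℝ} (hf : Continuous f) :
    IntegrableOn f T.carrier := hf.continuousOn.integrableOn_compact T.isCompact_carrier

/-- Inverse inequality for the gradient on a triangle. -/
theorem exists_len_sq_mul_norm_grad_sq_le (p : ℕ) (σ : ℝ) : ∃ C, 0 ≤ C ∧
    ∀ (G : Network) (M : Mesh G), M.ShapeRegular σ → ∀ (v : M.V p) (i : Fin G.N) (F : M.Loc i),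
      ∀ x ∈ (M.tri i F.1).carrier, M.len F ^ 2 * ‖grad v i F.1 x‖ ^ 2 ≤ C * energy v i F.1 := by
  -- All points of the triangle have distance at most `diam ≤ 2 σ r` from the centre of the
  -- inscribed disk, whence the dilation factor.
  obtain ⟨C, hC, h⟩ := exists_sq_mul_polyVal_sq_le p (2 * σ)
  refine ⟨(2 * σ) ^ 2 * C, by positivity, fun G M hM v i F x hx => ?_⟩
  obtain ⟨c, r, hb, hd, hr⟩ := hM i F.1
  have hl0 := M.len_pos F
  have hld : M.len F ≤ 2 * σ * r := ((M.tri i F.1).len_le_diam F.2).trans (hd.trans (by linarith))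
  -- A zero radius would give a zero diameter, contrary to the positive edge length.
  have hr0 : 0 < r := by
    rcases hr.eq_or_lt with h0 | h0
    · rw [← h0] at hld; linarith
    · exact h0
  have hc : c ∈ (M.tri i F.1).carrier := hb (Metric.mem_closedBall_self hr)
  have hxc : dist x c ≤ 2 * σ * r :=
    (Metric.dist_le_diam_of_mem (M.tri i F.1).isCompact_carrier.isBounded hx hc).trans
      (hd.trans (by linarith))
  have hint : ∀ l, IntegrableOn (fun y => polyVal (MvPolynomial.pderiv l
      (v i F.1 : MvPolynomial (Fin 2) ℝ)) y ^ 2) (M.tri i F.1).carrier := fun l =>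
    integrableOn_carrier _ ((continuous_polyVal _).pow 2)
  have hE : energy v i F.1 = ∑ l, ∫ y in (M.tri i F.1).carrier,
      polyVal (MvPolynomial.pderiv l (v i F.1 : MvPolynomial (Fin 2) ℝ)) y ^ 2 := by
    rw [energy, ← integral_finsetSum _ fun l _ => hint l]
    simp_rw [norm_grad_sq]
  have hmain : r ^ 2 * ‖grad v i F.1 x‖ ^ 2 ≤ C * energy v i F.1 := by
    rw [norm_grad_sq, hE, Finset.mul_sum, Finset.mul_sum]
    refine Finset.sum_le_sum fun l _ => ?_
    refine (h _ (pderiv_mem_restrictTotalDegree (v i F.1).2 l) c x r hr0 hxc).trans ?_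
    refine mul_le_mul_of_nonneg_left ?_ hC
    exact setIntegral_mono_set (hint l) (.of_forall fun _ => sq_nonneg _) hb.eventuallyLE
  calc M.len F ^ 2 * ‖grad v i F.1 x‖ ^ 2 ≤ (2 * σ * r) ^ 2 * ‖grad v i F.1 x‖ ^ 2 := by gcongr
    _ = (2 * σ) ^ 2 * (r ^ 2 * ‖grad v i F.1 x‖ ^ 2) := by ring
    _ ≤ (2 * σ) ^ 2 * (C * energy v i F.1) := by gcongr
    _ = _ := by ring

/-- The flux satisfies an inverse trace inequality with constant `C`. -/
def FluxBound (κ : Fin G.N → E2 → ℝ) (M : Mesh G) (p : ℕ) (C : ℝ) : Prop :=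
  ∀ (v : M.V p) (i : Fin G.N) (F : M.Loc i) (n : E2), ‖n‖ ≤ 1 →
    ∀ᵐ t ∂(volume.restrict (Icc (0 : ℝ) 1)),
      M.len F ^ 2 * flux κ v i F.1 n (pt F t) ^ 2 ≤ C * energy v i F.1

/-- The bound covers all directions of norm at most 1, because the average on an interior edge uses
the normal of the first triangle on both sides. -/
theorem exists_fluxBound {κ : Fin G.N → E2 → ℝ} {c : ℝ}
    (hc : ∀ i, ∀ᵐ x ∂(volume.restrict (G.dom i)), κ i x ∈ Icc (-c) c) (p : ℕ) (σ : ℝ) :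
    ∃ C, 0 ≤ C ∧ ∀ M : Mesh G, M.ShapeRegular σ → M.HasTraces κ → FluxBound κ M p C := by
  obtain ⟨C, hC, h⟩ := exists_len_sq_mul_norm_grad_sq_le p σ
  refine ⟨c ^ 2 * C, by positivity, fun M hσ hM v i F n hn => ?_⟩
  filter_upwards [ae_abs_kTrace_le hM hc F, ae_restrict_mem measurableSet_Icc] with t ht ht'
  have h1 := h G M hσ v i F _ (pt_mem F ht')
  have h2 : M.kTrace κ i F.1 (pt F t) ^ 2 ≤ c ^ 2 := by
    rw [← sq_abs]
    exact pow_le_pow_left₀ (abs_nonneg _) ht 2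
  have h3 : inner ℝ (grad v i F.1 (pt F t)) n ^ 2 ≤ ‖grad v i F.1 (pt F t)‖ ^ 2 := by
    rw [← sq_abs]
    refine pow_le_pow_left₀ (abs_nonneg _) ((abs_real_inner_le_norm _ _).trans ?_) 2
    exact mul_le_of_le_one_right (norm_nonneg _) hn
  calc M.len F ^ 2 * flux κ v i F.1 n (pt F t) ^ 2
      = M.kTrace κ i F.1 (pt F t) ^ 2 * (M.len F ^ 2 * inner ℝ (grad v i F.1 (pt F t)) n ^ 2) := by
        rw [flux]; ring
    _ ≤ c ^ 2 * (C * energy v i F.1) := by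
        refine mul_le_mul h2 (le_trans ?_ h1) (by positivity) (sq_nonneg _)
        gcongr
    _ = _ := by ring

/-! ### Faces shared by two triangles -/

theorem transfer_eq {i j : Fin G.N} {x y : E2} (h : G.emb i x = G.emb j y) :
    transfer G i j x = y := by
  rw [transfer, h]
  exact Function.leftInverse_invFun (G.emb j).injective y

theorem emb_pt {i : Fin G.N} (F : M.Loc i) (t : ℝ) : G.emb i (pt F t) =
    AffineMap.lineMap (G.emb i ((M.tri i F.1).fst F.2)) (G.emb i ((M.tri i F.1).snd F.2)) t :=
  (G.emb i).toAffineMap.apply_lineMap _ _ _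

/-- Two local edges that are the same segment in space have the same parametrization, up to the
orientation. -/
theorem exists_param {i j : Fin G.N} {F : M.Loc i} {F' : M.Loc j} (h : M.edge3 F = M.edge3 F') :
    ∃ τ : ℝ → ℝ, Continuous τ ∧ MeasurePreserving τ (volume.restrict (Icc (0 : ℝ) 1))
      (volume.restrict (Icc (0 : ℝ) 1)) ∧ ∀ t, transfer G i j (pt F t) = pt F' (τ t) := by
  rcases Sym2.eq_iff.1 h with ⟨h1, h2⟩ | ⟨h1, h2⟩
  · refine ⟨id, continuous_id, .id _, fun t => transfer_eq ?_⟩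
    rw [emb_pt, emb_pt, h1, h2]; rfl
  · refine ⟨fun t => 1 - t, by fun_prop, measurePreserving_one_sub, fun t => transfer_eq ?_⟩
    rw [emb_pt, emb_pt, h1, h2, AffineMap.lineMap_apply_one_sub]

theorem transfer_self (i : Fin G.N) (x : E2) : transfer G i i x = x := transfer_eq rfl

theorem edge3_eq_of_edge_eq {i : Fin G.N} {F F' : M.Loc i} (h : M.edge F = M.edge F') :
    M.edge3 F = M.edge3 F' := congrArg (Sym2.map (G.emb i)) h

theorem edge_eq_of_edge3_eq {i : Fin G.N} {F F' : M.Loc i} (h : M.edge3 F = M.edge3 F') :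
    M.edge F = M.edge F' := Sym2.map.injective (G.emb i).injective h

theorem len_eq_of_edge3_eq {i j : Fin G.N} {F : M.Loc i} {F' : M.Loc j}
    (h : M.edge3 F = M.edge3 F') : M.len F = M.len F' := by
  rw [len, len, Tri.len, Tri.len, ← (G.emb i).dist_map, ← (G.emb j).dist_map]
  rcases Sym2.eq_iff.1 h with ⟨h1, h2⟩ | ⟨h1, h2⟩ <;> rw [h1, h2]
  exact dist_comm _ _

/-- Two triangles on the same side of a common edge are equal. -/
theorem eq_of_same_side {i : Fin G.N} {F F' : M.Loc i} (h : M.edge F = M.edge F')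
    (hs : 0 < (M.tri i F'.1).bary F'.2 ((M.tri i F.1).points F.2)) : F = F' := by
  obtain ⟨K, e⟩ := F
  obtain ⟨K', e'⟩ := F'
  have hK : K = K' := by
    by_contra hne
    exact Tri.not_disjoint_interior h hs (M.disjoint_interior i hne)
  subst hK
  exact Prod.ext rfl ((M.tri i K).edge_injective h)

open Classical in
/-- A segment is an edge of at most two triangles of a surface. -/
theorem card_edge3_eq_le (M : Mesh G) (i : Fin G.N) (s : Sym2 E3) :
    (Finset.univ.filter fun F : M.Loc i => M.edge3 F = s).card ≤ 2 := by
  rcases (Finset.univ.filter fun F : M.Loc i => M.edge3 F = s).eq_empty_or_nonempty with h | ⟨F₀, h⟩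
  · rw [h]; simp
  have h0 := (Finset.mem_filter.1 h).2
  have hcard := Finset.card_le_card_of_injOn (t := (Finset.univ : Finset Bool))
    (s := Finset.univ.filter fun F : M.Loc i => M.edge3 F = s)
    -- The label says whether the triangle lies on the same side of the edge as `F₀`. Triangles with
    -- the same label are on the same side of each other, hence equal.
    (fun F => decide (0 < (M.tri i F.1).bary F.2 ((M.tri i F₀.1).points F₀.2)))
    (fun _ _ => Finset.mem_univ _) ?_
  · simpa using hcard
  intro F hF F' hF' hFF'
  have h1 := (Finset.mem_filter.1 (Finset.mem_coe.1 hF)).2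
  have h2 := (Finset.mem_filter.1 (Finset.mem_coe.1 hF')).2
  have e1 := edge_eq_of_edge3_eq (h0.trans h1.symm)
  have e2 := edge_eq_of_edge3_eq (h0.trans h2.symm)
  refine eq_of_same_side (e1.symm.trans e2) ?_
  -- The coordinate of each apex with respect to the other triangle multiply to 1, so they have the
  -- same sign.
  have a1 := Tri.bary_eq_mul e1 ((M.tri i F.1).points F.2)
  rw [Tri.bary_self] at a1
  rw [Tri.bary_eq_mul e2 ((M.tri i F.1).points F.2)]
  have c1 := Tri.bary_apex_ne_zero e1
  have c2 := Tri.bary_apex_ne_zero e2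
  have hiff : 0 < (M.tri i F.1).bary F.2 ((M.tri i F₀.1).points F₀.2) ↔
      0 < (M.tri i F'.1).bary F'.2 ((M.tri i F₀.1).points F₀.2) := by
    simpa using hFF'
  rcases lt_or_gt_of_ne c1 with c | c
  · have c' := lt_of_le_of_ne (not_lt.1 fun h => (hiff.2 h).not_gt c) c2
    exact mul_pos_of_neg_of_neg (by nlinarith) c'
  · exact mul_pos (by nlinarith) (hiff.1 c)

/-- The factor 6 is three edges per triangle times at most two partners per edge. Interior edges and
bifurcation edges are both covered. -/
theorem sum_fst_energy_le {i j : Fin G.N} {S : Finset (M.Loc i × M.Loc j)}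
    (hS : ∀ F ∈ S, M.edge3 F.1 = M.edge3 F.2) (v : M.V p) :
    ∑ F ∈ S, energy v i F.1.1 ≤ 6 * ∑ K, energy v i K := by
  classical
  have h := sum_fst_le (S := S) (n := 2) (fun a => ?_) (f := fun F : M.Loc i => energy v i F.1)
    fun F => energy_nonneg v i F.1
  · refine h.trans (le_of_eq ?_)
    rw [Fintype.sum_prod_type]
    simp_rw [Finset.sum_const, Finset.card_univ, Fintype.card_fin, nsmul_eq_mul]
    rw [← Finset.mul_sum]
    push_cast; ring
  · refine le_trans ?_ (M.card_edge3_eq_le j (M.edge3 a))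
    refine Finset.card_le_card_of_injOn Prod.snd (fun x hx => ?_) fun x hx y hy hxy => ?_
    · obtain ⟨h1, h2⟩ := Finset.mem_filter.1 (Finset.mem_coe.1 hx)
      simp only [Finset.coe_filter, Finset.mem_univ, true_and, Set.mem_ofPred_eq]
      rw [← hS x h1, h2]
    · exact Prod.ext ((Finset.mem_filter.1 (Finset.mem_coe.1 hx)).2.trans
        (Finset.mem_filter.1 (Finset.mem_coe.1 hy)).2.symm) hxy

theorem sum_snd_energy_le {i j : Fin G.N} {S : Finset (M.Loc i × M.Loc j)}
    (hS : ∀ F ∈ S, M.edge3 F.1 = M.edge3 F.2) (v : M.V p) :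
    ∑ F ∈ S, energy v j F.2.1 ≤ 6 * ∑ K, energy v j K := by
  classical
  have h := sum_fst_energy_le (S := S.map (Equiv.prodComm _ _).toEmbedding) (p := p) (fun F hF => by
    obtain ⟨F', h', rfl⟩ := Finset.mem_map.1 hF
    exact (hS F' h').symm) v
  rwa [Finset.sum_map] at h

end PlaneDG.Mesh

namespace PlaneDG.Mesh

variable {G : Network} {M : Mesh G} {p : ℕ}

/-! ### Face integrals -/

/-- Young's inequality with weight `δ len` is applied pointwise and integrated over the edge
parameter. Only the majorant has to be integrable, so nothing is assumed on the measurability of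
`g`. -/
theorem two_mul_abs_faceInt_le {i : Fin G.N} (F : M.Loc i) {g j : E2 → ℝ} {B δ : ℝ} (hδ : 0 < δ)
    (hj : Continuous fun t => j (pt F t))
    (hg : ∀ᵐ t ∂(volume.restrict (Icc (0 : ℝ) 1)), M.len F ^ 2 * g (pt F t) ^ 2 ≤ B) :
    2 * |M.faceInt F fun x => g x * j x| ≤
      δ * B + δ⁻¹ * (1 / M.len F * M.faceInt F fun x => j x ^ 2) := by
  have hl := M.len_pos F
  have hj2 : IntegrableOn (fun t => j (pt F t) ^ 2 / (δ * M.len F)) (Icc (0 : ℝ) 1) :=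
    ((hj.pow 2).div_const _).continuousOn.integrableOn_compact isCompact_Icc
  have hc : IntegrableOn (fun _ : ℝ => δ * B / M.len F) (Icc (0 : ℝ) 1) :=
    continuous_const.continuousOn.integrableOn_compact isCompact_Icc
  have h1 : ‖∫ t in Icc (0 : ℝ) 1, 2 * (g (pt F t) * j (pt F t))‖ ≤
      ∫ t in Icc (0 : ℝ) 1, (δ * B / M.len F + j (pt F t) ^ 2 / (δ * M.len F)) := by
    refine norm_integral_le_of_norm_le (hc.add hj2) ?_
    filter_upwards [hg] with t ht
    rw [Real.norm_eq_abs, abs_mul, abs_two]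
    refine (two_mul_abs_mul_le (mul_pos hδ hl)).trans (add_le_add_left ?_ _)
    rw [le_div_iff₀ hl]
    calc δ * M.len F * g (pt F t) ^ 2 * M.len F = δ * (M.len F ^ 2 * g (pt F t) ^ 2) := by ring
      _ ≤ δ * B := by gcongr
  rw [integral_add hc hj2, integral_const_mul, Real.norm_eq_abs, abs_mul, abs_two,
    integral_const, integral_div] at h1
  simp only [measureReal_restrict_apply_univ, Real.volume_real_Icc, sub_zero, max_eq_left zero_le_one,
    one_smul] at h1
  rw [faceInt_eq, faceInt_eq, abs_mul, abs_of_pos hl]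
  calc _ = M.len F * (2 * |∫ t in Icc (0 : ℝ) 1, g (pt F t) * j (pt F t)|) := by ring
    _ ≤ M.len F * (δ * B / M.len F + (∫ t in Icc (0 : ℝ) 1, j (pt F t) ^ 2) / (δ * M.len F)) := by
        gcongr
    _ = _ := by field_simp

theorem faceInt_sq_nonneg {i : Fin G.N} (F : M.Loc i) (j : E2 → ℝ) :
    0 ≤ M.faceInt F fun x => j x ^ 2 := by
  rw [faceInt_eq]
  exact mul_nonneg (M.len_pos F).le (integral_nonneg fun _ => sq_nonneg _)

theorem continuous_jumpInt (v : M.V p) (i : Fin G.N) (F : M.Loc i × M.Loc i) :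
    Continuous (jumpInt v i F) := (continuous_val v i _).sub (continuous_val v i _)

theorem continuous_jumpBif (v : M.V p) {i j : Fin G.N} {F : M.Loc i × M.Loc j}
    (hF : M.edge3 F.1 = M.edge3 F.2) : Continuous fun t => jumpBif v i j F (pt F.1 t) := by
  obtain ⟨τ, hτ, -, h⟩ := exists_param hF
  simp_rw [jumpBif, h]
  exact ((continuous_val v i _).comp (continuous_pt _)).sub
    ((continuous_val v j _).comp ((continuous_pt _).comp hτ))

/-- The bound on surface `j` holds for almost every parameter of its own edge; the change of
parameter preserves measure, so it also holds for almost every parameter of the edge on surface `i`.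
-/
theorem ae_flux_transfer {κ : Fin G.N → E2 → ℝ} {C : ℝ} (hM : FluxBound κ M p C) (v : M.V p)
    {i j : Fin G.N} {F : M.Loc i × M.Loc j} (hF : M.edge3 F.1 = M.edge3 F.2) {n : E2}
    (hn : ‖n‖ ≤ 1) : ∀ᵐ t ∂(volume.restrict (Icc (0 : ℝ) 1)),
      M.len F.1 ^ 2 * flux κ v j F.2.1 n (transfer G i j (pt F.1 t)) ^ 2 ≤ C * energy v j F.2.1 := by
  obtain ⟨τ, -, hτ, h⟩ := exists_param hF
  filter_upwards [hτ.quasiMeasurePreserving.ae (hM v j F.2 n hn)] with t ht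
  rw [h, len_eq_of_edge3_eq hF]
  exact ht

theorem mem_intFaces {i : Fin G.N} {F : M.Loc i × M.Loc i} (hF : F ∈ M.intFaces i) :
    M.edge3 F.1 = M.edge3 F.2 :=
  edge3_eq_of_edge_eq (Finset.mem_filter.1 hF).2.2

theorem mem_bifFaces {γ : Sym2 E3} {i j : Fin G.N} {F : M.Loc i × M.Loc j}
    (hF : F ∈ M.bifFaces γ i j) : M.edge3 F.1 = M.edge3 F.2 := by
  classical
  simp only [bifFaces, Finset.mem_filter] at hF
  exact hF.2.1

theorem ae_avgInt_le {κ : Fin G.N → E2 → ℝ} {C : ℝ} (hM : FluxBound κ M p C) (v : M.V p)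
    {i : Fin G.N} {F : M.Loc i × M.Loc i} (hF : F ∈ M.intFaces i) :
    ∀ᵐ t ∂(volume.restrict (Icc (0 : ℝ) 1)), M.len F.1 ^ 2 * avgInt κ v i F (pt F.1 t) ^ 2 ≤
      C / 2 * (energy v i F.1.1 + energy v i F.2.1) := by
  have hn := (M.tri i F.1.1).norm_normal_le F.1.2
  filter_upwards [hM v i F.1 _ hn, ae_flux_transfer hM v (mem_intFaces hF) hn] with t h1 h2
  -- An interior edge is the case of two local edges on the same surface, where the transfer is the
  -- identity.
  rw [transfer_self] at h2
  simp only [avgInt, normal]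
  set a := flux κ v i F.1.1 ((M.tri i F.1.1).normal F.1.2) (pt F.1 t)
  set b := flux κ v i F.2.1 ((M.tri i F.1.1).normal F.1.2) (pt F.1 t)
  have h3 : (1 / 2 * a + 1 / 2 * b) ^ 2 ≤ 1 / 2 * (a ^ 2 + b ^ 2) := by nlinarith [sq_nonneg (a - b)]
  have := mul_le_mul_of_nonneg_left h3 (sq_nonneg (M.len F.1))
  linarith

theorem ae_avgBif_le {κ : Fin G.N → E2 → ℝ} {C : ℝ} (hM : FluxBound κ M p C) (v : M.V p)
    {i j : Fin G.N} {F : M.Loc i × M.Loc j} (hF : M.edge3 F.1 = M.edge3 F.2) :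
    ∀ᵐ t ∂(volume.restrict (Icc (0 : ℝ) 1)), M.len F.1 ^ 2 * avgBif κ v i j F (pt F.1 t) ^ 2 ≤
      2 * C * (energy v i F.1.1 + energy v j F.2.1) := by
  filter_upwards [hM v i F.1 _ ((M.tri i F.1.1).norm_normal_le F.1.2),
    ae_flux_transfer hM v hF ((M.tri j F.2.1).norm_normal_le F.2.2)] with t h1 h2
  simp only [avgBif, normal]
  set a := flux κ v i F.1.1 ((M.tri i F.1.1).normal F.1.2) (pt F.1 t)
  set b := flux κ v j F.2.1 ((M.tri j F.2.1).normal F.2.2) (transfer G i j (pt F.1 t))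
  have h3 : (a - b) ^ 2 ≤ 2 * (a ^ 2 + b ^ 2) := by nlinarith [sq_nonneg (a + b)]
  have := mul_le_mul_of_nonneg_left h3 (sq_nonneg (M.len F.1))
  linarith

/-! ### Consistency and penalty terms -/

/-- The consistency term of a surface. -/
noncomputable def consSurf (κ : Fin G.N → E2 → ℝ) (i : Fin G.N) (w v : M.V p) : ℝ :=
  (∑ F ∈ M.intFaces i, M.faceInt F.1 fun x => avgInt κ w i F x * jumpInt v i F x)
    + ∑ F ∈ M.bdryFaces i, M.faceInt F fun x => flux κ w i F.1 (M.normal F) x * val v i F.1 x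

/-- The penalty term of a surface. -/
noncomputable def penSurf (ηF : Fin G.N → Sym2 E2 → ℝ) (i : Fin G.N) (v : M.V p) : ℝ :=
  (∑ F ∈ M.intFaces i, ηF i (M.edge F.1) / M.len F.1 *
      M.faceInt F.1 fun x => jumpInt v i F x ^ 2)
    + ∑ F ∈ M.bdryFaces i, ηF i (M.edge F) / M.len F * M.faceInt F fun x => val v i F.1 x ^ 2

/-- The penalty term of a bifurcation. -/
noncomputable def penSeg (γ : Sym2 E3) (v : M.V p) : ℝ :=
  ∑ ij ∈ G.D γ, ∑ F ∈ M.bifFaces γ ij.1 ij.2,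
    1 / M.len F.1 * M.faceInt F.1 fun x => jumpBif v ij.1 ij.2 F x ^ 2

/-- The penalty term of the bifurcations. -/
noncomputable def penBif (ηΓ : Sym2 E3 → ℝ) (v : M.V p) : ℝ :=
  ∑ γ ∈ G.bifs, ηΓ γ * penSeg γ v

theorem penSurf_nonneg {ηF : Fin G.N → Sym2 E2 → ℝ} {i : Fin G.N} (h : ∀ F, 0 < ηF i F)
    (v : M.V p) : 0 ≤ penSurf ηF i v := by
  refine add_nonneg (Finset.sum_nonneg fun F _ => ?_) (Finset.sum_nonneg fun F _ => ?_)
  · exact mul_nonneg (div_nonneg (h _).le (M.len_pos _).le) (faceInt_sq_nonneg _ _)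
  · exact mul_nonneg (div_nonneg (h _).le (M.len_pos _).le) (faceInt_sq_nonneg _ _)

theorem penSeg_nonneg (γ : Sym2 E3) (v : M.V p) : 0 ≤ penSeg γ v :=
  Finset.sum_nonneg fun _ _ => Finset.sum_nonneg fun _ _ =>
    mul_nonneg (one_div_nonneg.2 (M.len_pos _).le) (faceInt_sq_nonneg _ _)

theorem penBif_nonneg {ηΓ : Sym2 E3 → ℝ} (h : ∀ γ, 0 < ηΓ γ) (v : M.V p) : 0 ≤ penBif ηΓ v :=
  Finset.sum_nonneg fun γ _ => mul_nonneg (h γ).le (penSeg_nonneg γ v)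

theorem penSurf_one_le {ηF : Fin G.N → Sym2 E2 → ℝ} {i : Fin G.N} {η₀ : ℝ} (h : ∀ F, η₀ ≤ ηF i F)
    (v : M.V p) : η₀ * penSurf (fun _ _ => 1) i v ≤ penSurf ηF i v := by
  rw [penSurf, penSurf, mul_add, Finset.mul_sum, Finset.mul_sum]
  refine add_le_add (Finset.sum_le_sum fun F _ => ?_) (Finset.sum_le_sum fun F _ => ?_)
  · rw [← mul_assoc, mul_one_div]
    exact mul_le_mul_of_nonneg_right (div_le_div_of_nonneg_right (h _) (M.len_pos _).le)
      (faceInt_sq_nonneg _ _)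
  · rw [← mul_assoc, mul_one_div]
    exact mul_le_mul_of_nonneg_right (div_le_div_of_nonneg_right (h _) (M.len_pos _).le)
      (faceInt_sq_nonneg _ _)

theorem penBif_one_le {ηΓ : Sym2 E3 → ℝ} {η₀ : ℝ} (h : ∀ γ, η₀ ≤ ηΓ γ) (v : M.V p) :
    η₀ * penBif (fun _ => 1) v ≤ penBif ηΓ v := by
  rw [penBif, penBif, Finset.mul_sum]
  refine Finset.sum_le_sum fun γ _ => ?_
  rw [one_mul]
  exact mul_le_mul_of_nonneg_right (h γ) (penSeg_nonneg γ v)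

/-- The factor 9 is `(6 + 6) / 2` from the interior edges plus 3 from the boundary edges, each
triangle having three edges. Adjacent triangles share the edge length, so no ratio of mesh sizes
enters. -/
theorem two_mul_abs_consSurf_le {κ : Fin G.N → E2 → ℝ} {C : ℝ} (hC : 0 ≤ C)
    (hM : FluxBound κ M p C) {δ : ℝ} (hδ : 0 < δ) (v : M.V p) (i : Fin G.N) :
    2 * |consSurf κ i v v| ≤
      δ * (9 * C) * ∑ K, energy v i K + δ⁻¹ * penSurf (fun _ _ => 1) i v := by
  have hsum1 := sum_fst_energy_le (fun F hF => mem_intFaces hF) v (S := M.intFaces i)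
  have hsum2 := sum_snd_energy_le (fun F hF => mem_intFaces hF) v (S := M.intFaces i)
  have hsum3 : ∑ F ∈ M.bdryFaces i, energy v i F.1 ≤ 3 * ∑ K, energy v i K := by
    refine (Finset.sum_le_sum_of_subset_of_nonneg (Finset.subset_univ _) fun F _ _ =>
      energy_nonneg v i F.1).trans (le_of_eq ?_)
    rw [Fintype.sum_prod_type]
    simp_rw [Finset.sum_const, Finset.card_univ, Fintype.card_fin, nsmul_eq_mul]
    rw [← Finset.mul_sum]
    norm_cast
  generalize ∑ K, energy v i K = g at *
  have hint : 2 * |∑ F ∈ M.intFaces i, M.faceInt F.1 fun x => avgInt κ v i F x * jumpInt v i F x| ≤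
      δ * (6 * C) * g + δ⁻¹ * ∑ F ∈ M.intFaces i,
        1 / M.len F.1 * M.faceInt F.1 fun x => jumpInt v i F x ^ 2 := by
    calc _ ≤ 2 * ∑ F ∈ M.intFaces i,
          |M.faceInt F.1 fun x => avgInt κ v i F x * jumpInt v i F x| := by
          gcongr; exact Finset.abs_sum_le_sum_abs _ _
      _ ≤ ∑ F ∈ M.intFaces i, (δ * (C / 2 * (energy v i F.1.1 + energy v i F.2.1))
          + δ⁻¹ * (1 / M.len F.1 * M.faceInt F.1 fun x => jumpInt v i F x ^ 2)) := by
          rw [Finset.mul_sum]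
          exact Finset.sum_le_sum fun F hF => two_mul_abs_faceInt_le F.1 hδ
            ((continuous_jumpInt v i F).comp (continuous_pt F.1)) (ae_avgInt_le hM v hF)
      _ = δ * (C / 2) * (∑ F ∈ M.intFaces i, energy v i F.1.1
            + ∑ F ∈ M.intFaces i, energy v i F.2.1)
          + δ⁻¹ * ∑ F ∈ M.intFaces i,
            1 / M.len F.1 * M.faceInt F.1 fun x => jumpInt v i F x ^ 2 := by
          rw [Finset.sum_add_distrib, ← Finset.mul_sum, ← Finset.mul_sum, ← Finset.mul_sum,
            Finset.sum_add_distrib]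
          ring
      _ ≤ δ * (C / 2) * (6 * g + 6 * g) + δ⁻¹ * ∑ F ∈ M.intFaces i,
            1 / M.len F.1 * M.faceInt F.1 fun x => jumpInt v i F x ^ 2 := by gcongr
      _ = _ := by ring
  have hbd : 2 * |∑ F ∈ M.bdryFaces i,
      M.faceInt F fun x => flux κ v i F.1 (M.normal F) x * val v i F.1 x| ≤
      δ * (3 * C) * g + δ⁻¹ * ∑ F ∈ M.bdryFaces i,
        1 / M.len F * M.faceInt F fun x => val v i F.1 x ^ 2 := by
    calc _ ≤ 2 * ∑ F ∈ M.bdryFaces i,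
          |M.faceInt F fun x => flux κ v i F.1 (M.normal F) x * val v i F.1 x| := by
          gcongr; exact Finset.abs_sum_le_sum_abs _ _
      _ ≤ ∑ F ∈ M.bdryFaces i, (δ * (C * energy v i F.1)
          + δ⁻¹ * (1 / M.len F * M.faceInt F fun x => val v i F.1 x ^ 2)) := by
          rw [Finset.mul_sum]
          exact Finset.sum_le_sum fun F _ => two_mul_abs_faceInt_le F hδ
            ((continuous_val v i F.1).comp (continuous_pt F)) (hM v i F _ (Tri.norm_normal_le _ _))
      _ = δ * C * ∑ F ∈ M.bdryFaces i, energy v i F.1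
          + δ⁻¹ * ∑ F ∈ M.bdryFaces i, 1 / M.len F * M.faceInt F fun x => val v i F.1 x ^ 2 := by
          rw [Finset.sum_add_distrib, ← Finset.mul_sum, ← Finset.mul_sum, ← Finset.mul_sum]
          ring
      _ ≤ δ * C * (3 * g)
          + δ⁻¹ * ∑ F ∈ M.bdryFaces i, 1 / M.len F * M.faceInt F fun x => val v i F.1 x ^ 2 := by
          gcongr
      _ = _ := by ring
  have := abs_add_le
    (∑ F ∈ M.intFaces i, M.faceInt F.1 fun x => avgInt κ v i F x * jumpInt v i F x)
    (∑ F ∈ M.bdryFaces i, M.faceInt F fun x => flux κ v i F.1 (M.normal F) x * val v i F.1 x)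
  rw [consSurf, penSurf, mul_add]
  linarith

theorem abs_one_div_card_le_one (n : ℕ) : |1 / (n : ℝ)| ≤ 1 := by
  rw [abs_of_nonneg (by positivity)]
  rcases Nat.eq_zero_or_pos n with rfl | h
  · simp
  · exact (div_le_one (by positivity)).2 (by exact_mod_cast h)

/-- The factor 24 is `2 (6 + 6)`: the 2 from squaring a difference of fluxes, the sixes from
counting edges on both surfaces. At most `N ^ 2` pairs occur. -/
theorem two_mul_abs_avgJump_le {κ : Fin G.N → E2 → ℝ} {C : ℝ} (hC : 0 ≤ C)
    (hM : FluxBound κ M p C) {δ : ℝ} (hδ : 0 < δ) (v : M.V p) (γ : Sym2 E3) :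
    2 * |avgJump κ v v γ| ≤
      δ * (24 * G.N ^ 2 * C) * ∑ i, ∑ K, energy v i K + δ⁻¹ * penSeg γ v := by
  have gnn : ∀ i, 0 ≤ ∑ K, energy v i K := fun i => Finset.sum_nonneg fun K _ => energy_nonneg v i K
  have hle : ∀ i, ∑ K, energy v i K ≤ ∑ i, ∑ K, energy v i K := fun i =>
    Finset.single_le_sum (f := fun i => ∑ K, energy v i K) (fun i _ => gnn i) (Finset.mem_univ i)
  have g0 : 0 ≤ ∑ i, ∑ K, energy v i K := Finset.sum_nonneg fun i _ => gnn i
  generalize ∑ i, ∑ K, energy v i K = g at *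
  have hpair : ∀ ij : Fin G.N × Fin G.N, ∑ F ∈ M.bifFaces γ ij.1 ij.2,
      2 * |M.faceInt F.1 fun x => avgBif κ v ij.1 ij.2 F x * jumpBif v ij.1 ij.2 F x| ≤
      δ * (24 * C * g) + δ⁻¹ * ∑ F ∈ M.bifFaces γ ij.1 ij.2,
        1 / M.len F.1 * M.faceInt F.1 fun x => jumpBif v ij.1 ij.2 F x ^ 2 := by
    intro ij
    have hsum1 := sum_fst_energy_le (fun F hF => mem_bifFaces hF) v (S := M.bifFaces γ ij.1 ij.2)
    have hsum2 := sum_snd_energy_le (fun F hF => mem_bifFaces hF) v (S := M.bifFaces γ ij.1 ij.2)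
    have l1 := hle ij.1
    have l2 := hle ij.2
    calc _ ≤ ∑ F ∈ M.bifFaces γ ij.1 ij.2,
          (δ * (2 * C * (energy v ij.1 F.1.1 + energy v ij.2 F.2.1))
          + δ⁻¹ * (1 / M.len F.1 * M.faceInt F.1 fun x => jumpBif v ij.1 ij.2 F x ^ 2)) :=
          Finset.sum_le_sum fun F hF => two_mul_abs_faceInt_le F.1 hδ
            (continuous_jumpBif v (mem_bifFaces hF)) (ae_avgBif_le hM v (mem_bifFaces hF))
      _ = δ * (2 * C) * (∑ F ∈ M.bifFaces γ ij.1 ij.2, energy v ij.1 F.1.1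
            + ∑ F ∈ M.bifFaces γ ij.1 ij.2, energy v ij.2 F.2.1)
          + δ⁻¹ * ∑ F ∈ M.bifFaces γ ij.1 ij.2,
            1 / M.len F.1 * M.faceInt F.1 fun x => jumpBif v ij.1 ij.2 F x ^ 2 := by
          rw [Finset.sum_add_distrib, ← Finset.mul_sum, ← Finset.mul_sum, ← Finset.mul_sum,
            Finset.sum_add_distrib]
          ring
      _ ≤ δ * (2 * C) * (6 * g + 6 * g)
          + δ⁻¹ * ∑ F ∈ M.bifFaces γ ij.1 ij.2,
            1 / M.len F.1 * M.faceInt F.1 fun x => jumpBif v ij.1 ij.2 F x ^ 2 := by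
          refine add_le_add_left (mul_le_mul_of_nonneg_left ?_ (by positivity)) _
          linarith
      _ = _ := by ring
  calc 2 * |avgJump κ v v γ| ≤ 2 * ∑ ij ∈ G.D γ, ∑ F ∈ M.bifFaces γ ij.1 ij.2,
        |M.faceInt F.1 fun x => avgBif κ v ij.1 ij.2 F x * jumpBif v ij.1 ij.2 F x| := by
        rw [avgJump, abs_mul]
        refine mul_le_mul_of_nonneg_left ?_ zero_le_two
        refine (mul_le_of_le_one_left (abs_nonneg _) (abs_one_div_card_le_one _)).trans
          ((Finset.abs_sum_le_sum_abs _ _).trans ?_)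
        exact Finset.sum_le_sum fun ij _ => Finset.abs_sum_le_sum_abs _ _
    _ ≤ ∑ ij ∈ G.D γ, (δ * (24 * C * g) + δ⁻¹ * ∑ F ∈ M.bifFaces γ ij.1 ij.2,
        1 / M.len F.1 * M.faceInt F.1 fun x => jumpBif v ij.1 ij.2 F x ^ 2) := by
        rw [Finset.mul_sum]
        refine Finset.sum_le_sum fun ij _ => ?_
        rw [Finset.mul_sum]
        exact hpair ij
    _ = (G.D γ).card * (δ * (24 * C * g)) + δ⁻¹ * penSeg γ v := by
        rw [Finset.sum_add_distrib, Finset.sum_const, nsmul_eq_mul, penSeg,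
          Finset.mul_sum (s := G.D γ)]
    _ ≤ (G.N ^ 2 : ℝ) * (δ * (24 * C * g)) + δ⁻¹ * penSeg γ v := by
        have : ((G.D γ).card : ℝ) ≤ (G.N ^ 2 : ℝ) := by
          have := Finset.card_le_univ (G.D γ)
          rw [Fintype.card_prod, Fintype.card_fin, ← sq] at this
          exact_mod_cast this
        gcongr
    _ = _ := by ring

theorem two_mul_abs_sum_avgJump_le {κ : Fin G.N → E2 → ℝ} {C : ℝ} (hC : 0 ≤ C)
    (hM : FluxBound κ M p C) {δ : ℝ} (hδ : 0 < δ) (v : M.V p) :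
    2 * |∑ γ ∈ G.bifs, avgJump κ v v γ| ≤
      δ * (24 * G.N ^ 2 * G.bifs.card * C) * ∑ i, ∑ K, energy v i K
        + δ⁻¹ * penBif (fun _ => 1) v := by
  have hγ := two_mul_abs_avgJump_le hC hM hδ v
  generalize ∑ i, ∑ K, energy v i K = g at *
  calc _ ≤ 2 * ∑ γ ∈ G.bifs, |avgJump κ v v γ| := by
        gcongr; exact Finset.abs_sum_le_sum_abs _ _
    _ ≤ ∑ γ ∈ G.bifs, (δ * (24 * G.N ^ 2 * C) * g + δ⁻¹ * penSeg γ v) := by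
        rw [Finset.mul_sum]
        exact Finset.sum_le_sum fun γ _ => hγ γ
    _ = G.bifs.card * (δ * (24 * G.N ^ 2 * C) * g) + δ⁻¹ * penBif (fun _ => 1) v := by
        rw [Finset.sum_add_distrib, Finset.sum_const, nsmul_eq_mul, penBif, Finset.mul_sum]
        simp_rw [one_mul]
    _ = _ := by ring

/-! ### The DG norm and the diagonal of the form on a plane-network -/

theorem dgNorm_sq {ηF : Fin G.N → Sym2 E2 → ℝ} {ηΓ : Sym2 E3 → ℝ} (hF : ∀ i F, 0 < ηF i F)
    (hΓ : ∀ γ, 0 < ηΓ γ) (v : M.V p) :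
    dgNorm ηF ηΓ v ^ 2 = ∑ i, ∑ K, energy v i K + (∑ i, penSurf ηF i v + penBif ηΓ v) := by
  have e : ∀ i, dgSqSurf ηF i v = ∑ K, energy v i K + penSurf ηF i v := fun i => by
    rw [dgSqSurf, penSurf, add_assoc]; rfl
  have h0 : 0 ≤ ∑ i, ∑ K, energy v i K + (∑ i, penSurf ηF i v + penBif ηΓ v) :=
    add_nonneg (Finset.sum_nonneg fun i _ => Finset.sum_nonneg fun K _ => energy_nonneg v i K)
      (add_nonneg (Finset.sum_nonneg fun i _ => penSurf_nonneg (hF i) v) (penBif_nonneg hΓ v))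
  rw [dgNorm]
  simp_rw [e]
  rw [Finset.sum_add_distrib, add_assoc]
  exact Real.sq_sqrt h0

theorem a_self (κ : Fin G.N → E2 → ℝ) (ε : Fin G.N → ℝ) (ε₀ : ℝ) (ηF : Fin G.N → Sym2 E2 → ℝ)
    (ηΓ : Sym2 E3 → ℝ) (v : M.V p) :
    a κ ε ε₀ ηF ηΓ v v =
      ∑ i, ((∑ K, ∫ x in (M.tri i K).carrier, κ i x * inner ℝ (grad v i K x) (grad v i K x))
        - (1 + ε i) * consSurf κ i v v + penSurf ηF i v)
      - (1 + ε₀) * (∑ γ ∈ G.bifs, avgJump κ v v γ) + penBif ηΓ v := by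
  have e : ∀ i, aSurf κ ε ηF i v v =
      (∑ K, ∫ x in (M.tri i K).carrier, κ i x * inner ℝ (grad v i K x) (grad v i K x))
        - (1 + ε i) * consSurf κ i v v + penSurf ηF i v := fun i => by
    rw [aSurf, consSurf, penSurf]
    simp_rw [← sq]
    ring
  rw [a, penBif]
  simp_rw [e, jumpJump, penSeg, ← sq]
  ring

theorem integrableOn_coeff_mul {κ : Fin G.N → E2 → ℝ} (hm : ∀ i, Measurable (κ i)) {c : ℝ}
    (hc : ∀ i, ∀ᵐ x ∂(volume.restrict (G.dom i)), κ i x ∈ Icc (-c) c)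
    (i : Fin G.N) (K : Fin (M.n i)) {f : E2 → ℝ} (hf : Continuous f) :
    IntegrableOn (fun x => κ i x * f x) (M.tri i K).carrier := by
  refine Integrable.bdd_mul (c := c) (integrableOn_carrier _ hf) (hm i).aestronglyMeasurable ?_
  filter_upwards [M.ae_of_ae_surf K (hc i)] with x hx
  exact abs_le.2 hx

theorem mul_energy_le {κ : Fin G.N → E2 → ℝ} (hm : ∀ i, Measurable (κ i)) {b c : ℝ}
    (hc : ∀ i, ∀ᵐ x ∂(volume.restrict (G.dom i)), κ i x ∈ Icc (-c) c)
    (hb : ∀ i, ∀ᵐ x ∂(volume.restrict (G.dom i)), b ≤ κ i x)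
    (v : M.V p) (i : Fin G.N) (K : Fin (M.n i)) :
    b * energy v i K ≤
      ∫ x in (M.tri i K).carrier, κ i x * inner ℝ (grad v i K x) (grad v i K x) := by
  rw [energy, ← integral_const_mul]
  have hg := continuous_grad v i K
  refine integral_mono_ae (integrableOn_carrier _ ((hg.norm.pow 2).const_mul b))
    (integrableOn_coeff_mul hm hc i K (hg.inner hg)) ?_
  filter_upwards [M.ae_of_ae_surf K (hb i)] with x hx
  rw [real_inner_self_eq_norm_sq]
  exact mul_le_mul_of_nonneg_right hx (sq_nonneg _)

/-! ### Bilinearity -/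

theorem isLin_flux (κ : Fin G.N → E2 → ℝ) (i : Fin G.N) (K : Fin (M.n i)) (n x : E2) :
    IsLin fun v : M.V p => flux κ v i K n x := (isLin_inner_grad i K x n).const_mul _

theorem integrableOn_flux {κ : Fin G.N → E2 → ℝ} (hm : ∀ i, Measurable (κ i)) {c : ℝ}
    (hc : ∀ i, ∀ᵐ x ∂(volume.restrict (G.dom i)), κ i x ∈ Icc (-c) c) (hκ : M.HasTraces κ)
    (v : M.V p) {i : Fin G.N} (F : M.Loc i) (n : E2) :
    IntegrableOn (fun t => flux κ v i F.1 n (pt F t)) (Icc (0 : ℝ) 1) := by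
  have h1 : Continuous fun t => inner ℝ (grad v i F.1 (pt F t)) n :=
    ((continuous_grad v i F.1).comp (continuous_pt F)).inner continuous_const
  exact Integrable.bdd_mul (c := c) (h1.continuousOn.integrableOn_compact isCompact_Icc)
    (aemeasurable_kTrace hm hκ F).aestronglyMeasurable (ae_abs_kTrace_le hκ hc F)

theorem integrableOn_flux_transfer {κ : Fin G.N → E2 → ℝ} (hm : ∀ i, Measurable (κ i)) {c : ℝ}
    (hc : ∀ i, ∀ᵐ x ∂(volume.restrict (G.dom i)), κ i x ∈ Icc (-c) c) (hκ : M.HasTraces κ)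
    (v : M.V p) {i j : Fin G.N} {F : M.Loc i × M.Loc j} (hF : M.edge3 F.1 = M.edge3 F.2) (n : E2) :
    IntegrableOn (fun t => flux κ v j F.2.1 n (transfer G i j (pt F.1 t))) (Icc (0 : ℝ) 1) := by
  obtain ⟨τ, -, hτ, h⟩ := exists_param hF
  simp_rw [h]
  exact hτ.integrable_comp_of_integrable (integrableOn_flux hm hc hκ v F.2 n)

theorem isBilin_faceInt {V : Type*} [AddCommGroup V] [Module ℝ V] {i : Fin G.N} (F : M.Loc i)
    {g j : V → E2 → ℝ} (hg : ∀ x, IsLin fun v => g v x) (hj : ∀ x, IsLin fun v => j v x)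
    (hgi : ∀ v, IntegrableOn (fun t => g v (pt F t)) (Icc (0 : ℝ) 1))
    (hjc : ∀ v, Continuous fun t => j v (pt F t)) :
    IsBilin fun w v => M.faceInt F fun x => g w x * j v x := by
  simp_rw [faceInt_eq]
  exact (IsBilin.integral (fun t => (hg _).mul (hj _)) fun w v =>
    (hgi w).mul_continuousOn (hjc v).continuousOn isCompact_Icc).const_mul _

theorem isBilin_faceInt_of_continuous {V : Type*} [AddCommGroup V] [Module ℝ V] {i : Fin G.N}
    (F : M.Loc i) {j : V → E2 → ℝ} (hj : ∀ x, IsLin fun v => j v x)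
    (hjc : ∀ v, Continuous fun t => j v (pt F t)) :
    IsBilin fun w v => M.faceInt F fun x => j w x * j v x :=
  isBilin_faceInt F hj hj (fun v => (hjc v).continuousOn.integrableOn_compact isCompact_Icc) hjc

theorem isLin_jumpInt (i : Fin G.N) (F : M.Loc i × M.Loc i) (x : E2) :
    IsLin fun v : M.V p => jumpInt v i F x := (isLin_val _ _ _).sub (isLin_val _ _ _)

theorem isLin_jumpBif (i j : Fin G.N) (F : M.Loc i × M.Loc j) (x : E2) :
    IsLin fun v : M.V p => jumpBif v i j F x := (isLin_val _ _ _).sub (isLin_val _ _ _)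

theorem isBilin_consInt {κ : Fin G.N → E2 → ℝ} (hm : ∀ i, Measurable (κ i)) {c : ℝ}
    (hc : ∀ i, ∀ᵐ x ∂(volume.restrict (G.dom i)), κ i x ∈ Icc (-c) c) (hκ : M.HasTraces κ)
    (i : Fin G.N) :
    IsBilin fun w v : M.V p =>
      ∑ F ∈ M.intFaces i, M.faceInt F.1 fun x => avgInt κ w i F x * jumpInt v i F x := by
  refine .sum _ fun F hF => isBilin_faceInt F.1 (fun x => ?_) (isLin_jumpInt i F) (fun v => ?_)
    fun v => (continuous_jumpInt v i F).comp (continuous_pt F.1)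
  · exact ((isLin_flux _ _ _ _ _).const_mul _).add' ((isLin_flux _ _ _ _ _).const_mul _)
  -- The flux of the second triangle is integrable along its own parametrization of the edge; the
  -- transfer moves this to the parametrization of the first.
  · have h2 := integrableOn_flux_transfer hm hc hκ v (mem_intFaces hF) (M.normal F.1)
    simp_rw [transfer_self] at h2
    exact ((integrableOn_flux hm hc hκ v F.1 _).const_mul _).add (h2.const_mul _)

theorem isBilin_consBdry {κ : Fin G.N → E2 → ℝ} (hm : ∀ i, Measurable (κ i)) {c : ℝ}
    (hc : ∀ i, ∀ᵐ x ∂(volume.restrict (G.dom i)), κ i x ∈ Icc (-c) c) (hκ : M.HasTraces κ)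
    (i : Fin G.N) :
    IsBilin fun w v : M.V p => ∑ F ∈ M.bdryFaces i,
      M.faceInt F fun x => flux κ w i F.1 (M.normal F) x * val v i F.1 x :=
  .sum _ fun F _ => isBilin_faceInt F (fun _ => isLin_flux _ _ _ _ _) (fun _ => isLin_val _ _ _)
    (fun v => integrableOn_flux hm hc hκ v F _)
    fun v => (continuous_val v i _).comp (continuous_pt F)

theorem isBilin_aSurf {κ : Fin G.N → E2 → ℝ} (hm : ∀ i, Measurable (κ i)) {c : ℝ}
    (hc : ∀ i, ∀ᵐ x ∂(volume.restrict (G.dom i)), κ i x ∈ Icc (-c) c) (hκ : M.HasTraces κ)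
    (ε : Fin G.N → ℝ) (ηF : Fin G.N → Sym2 E2 → ℝ) (i : Fin G.N) :
    IsBilin fun w v : M.V p => aSurf κ ε ηF i w v := by
  have hjumpc : ∀ F (v : M.V p), Continuous fun t => jumpInt v i F (pt F.1 t) := fun F v =>
    (continuous_jumpInt v i F).comp (continuous_pt F.1)
  have hvalc : ∀ (F : M.Loc i) (v : M.V p), Continuous fun t => val v i F.1 (pt F t) :=
    fun F v => (continuous_val v i _).comp (continuous_pt F)
  have hI := isBilin_consInt (p := p) hm hc hκ i
  have hB := isBilin_consBdry (p := p) hm hc hκ i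
  have hV : IsBilin fun w v : M.V p =>
      ∑ K, ∫ x in (M.tri i K).carrier, κ i x * inner ℝ (grad w i K x) (grad v i K x) := by
    refine .sum _ fun K _ => ?_
    refine IsBilin.integral (f := fun x w v => κ i x * inner ℝ (grad w i K x) (grad v i K x))
      (fun x => ?_) fun w v => ?_
    · exact (isBilin_inner_grad i K x).const_mul _
    · exact integrableOn_coeff_mul hm hc i K ((continuous_grad w i K).inner (continuous_grad v i K))
  have hP : IsBilin fun w v : M.V p => ∑ F ∈ M.intFaces i, ηF i (M.edge F.1) / M.len F.1 *
      M.faceInt F.1 fun x => jumpInt w i F x * jumpInt v i F x :=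
    .sum _ fun F _ => (isBilin_faceInt_of_continuous F.1 (j := fun v x => jumpInt v i F x)
      (isLin_jumpInt i F) (hjumpc F)).const_mul _
  have hQ : IsBilin fun w v : M.V p => ∑ F ∈ M.bdryFaces i, ηF i (M.edge F) / M.len F *
      M.faceInt F fun x => val w i F.1 x * val v i F.1 x :=
    .sum _ fun F _ =>
      (isBilin_faceInt_of_continuous F (j := fun v x => val v i F.1 x)
        (fun x => isLin_val i F.1 x) (hvalc F)).const_mul _
  unfold aSurf
  have h := (((((hV.sub hI).sub (hI.swap.const_mul (ε i))).add hP).sub hB).sub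
    (hB.swap.const_mul (ε i))).add hQ
  exact h

theorem isBilin_avgJump {κ : Fin G.N → E2 → ℝ} (hm : ∀ i, Measurable (κ i)) {c : ℝ}
    (hc : ∀ i, ∀ᵐ x ∂(volume.restrict (G.dom i)), κ i x ∈ Icc (-c) c) (hκ : M.HasTraces κ)
    (γ : Sym2 E3) : IsBilin fun w v : M.V p => avgJump κ w v γ := by
  refine IsBilin.const_mul (.sum _ fun _ _ => .sum _ fun F hF => isBilin_faceInt F.1
    (fun x => ?_) (isLin_jumpBif _ _ F) (fun v => ?_) fun v => ?_) _
  · exact (isLin_flux _ _ _ _ _).sub (isLin_flux _ _ _ _ _)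
  · exact (integrableOn_flux hm hc hκ v F.1 _).sub
      (integrableOn_flux_transfer hm hc hκ v (mem_bifFaces hF) _)
  · exact continuous_jumpBif v (mem_bifFaces hF)

theorem isBilin_jumpJump (γ : Sym2 E3) : IsBilin fun w v : M.V p => jumpJump w v γ :=
  .sum _ fun _ _ => .sum _ fun F hF => .const_mul (isBilin_faceInt_of_continuous F.1
    (isLin_jumpBif _ _ F) fun v => continuous_jumpBif v (mem_bifFaces hF)) _

theorem isBilin_a {κ : Fin G.N → E2 → ℝ} (hm : ∀ i, Measurable (κ i)) {c : ℝ}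
    (hc : ∀ i, ∀ᵐ x ∂(volume.restrict (G.dom i)), κ i x ∈ Icc (-c) c) (hκ : M.HasTraces κ)
    (ε : Fin G.N → ℝ) (ε₀ : ℝ) (ηF : Fin G.N → Sym2 E2 → ℝ) (ηΓ : Sym2 E3 → ℝ) :
    IsBilin fun w v : M.V p => a κ ε ε₀ ηF ηΓ w v := by
  have hA := fun γ => isBilin_avgJump (p := p) hm hc hκ γ
  have h1 : IsBilin fun w v : M.V p => ∑ γ ∈ G.bifs, avgJump κ w v γ := .sum _ fun γ _ => hA γ
  have h2 : IsBilin fun w v : M.V p => ∑ i, aSurf κ ε ηF i w v :=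
    .sum _ fun i _ => isBilin_aSurf hm hc hκ ε ηF i
  have h3 : IsBilin fun w v : M.V p => ∑ γ ∈ G.bifs, ηΓ γ * jumpJump w v γ :=
    .sum _ fun γ _ => (isBilin_jumpJump γ).const_mul _
  exact ((h2.sub h1).sub (h1.swap.const_mul _)).add h3

theorem isLin_load {f : Fin G.N → E2 → ℝ}
    (hf : ∀ i, MemLp (f i) 2 (volume.restrict (G.dom i))) : IsLin fun v : M.V p => load f v := by
  refine .sum _ fun i _ => .sum _ fun K _ => ?_
  refine IsLin.integral (fun x => (isLin_val i K x).const_mul _) fun v => ?_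
  have hfin : IsFiniteMeasure (volume.restrict (interior (M.tri i K).carrier)) :=
    ⟨by rw [Measure.restrict_apply_univ]
        exact (measure_mono interior_subset).trans_lt (M.tri i K).isCompact_carrier.measure_lt_top⟩
  have h1 : Integrable (f i) (volume.restrict (M.tri i K).carrier) := by
    rw [restrict_carrier]
    exact ((hf i).mono_measure (Measure.restrict_mono_set _ (M.interior_carrier_subset i K))).integrable
      one_le_two
  exact IntegrableOn.mul_continuousOn h1 (continuous_val v i K).continuousOn
    (M.tri i K).isCompact_carrier

end PlaneDG.Mesh

/-! ## Connectedness of a triangulated domain -/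

namespace PlaneDG

theorem nonempty_diff_finite {U F : Set E2} (hU : IsOpen U) (hne : U.Nonempty) (hF : F.Finite) :
    (U \ F).Nonempty := by
  obtain ⟨x, hx⟩ := hne
  exact ((infinite_of_mem_nhds x (hU.mem_nhds hx)).sdiff hF).nonempty

/-- A ball is homeomorphic to the plane, which stays connected when a countable set is removed. -/
theorem isPreconnected_ball_diff_finite (c : E2) {r : ℝ} (hr : 0 < r) {F : Set E2}
    (hF : F.Finite) : IsPreconnected (Metric.ball c r \ F) := by
  let e := OpenPartialHomeomorph.univBall c r
  have hs : e.source = univ := OpenPartialHomeomorph.univBall_source c r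
  have ht : e.target = Metric.ball c r := OpenPartialHomeomorph.univBall_target c hr
  have hinj : Function.Injective e := by
    have := e.injOn
    rwa [hs, injOn_univ] at this
  have hrank : 1 < Module.rank ℝ E2 := by
    rw [← Module.finrank_eq_rank, finrank_euclideanSpace_fin]
    norm_num
  have hc : IsPreconnected (e ⁻¹' F)ᶜ :=
    ((hF.preimage hinj.injOn).countable.isConnected_compl_of_one_lt_rank hrank).isPreconnected
  have himg : e '' (e ⁻¹' F)ᶜ = Metric.ball c r \ F := by
    rw [← preimage_compl, image_preimage_eq_inter_range, ← ht, ← e.image_source_eq_target, hs,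
      image_univ, inter_comm]
    rfl
  rw [← himg]
  refine hc.image e ?_
  have := e.continuousOn
  rw [hs] at this
  exact this.mono (subset_univ _)

/-- If two closed sets split `U \ F` without a common point there, each punctured ball in `U`, being
connected, lies in one of them. The centres of such balls form two open sets that cover `U`, so by
connectedness some point belongs to both, and a nearby point of `U \ F` lies in both closed sets. -/
theorem isPreconnected_diff_finite {U F : Set E2} (hU : IsOpen U) (hc : IsPreconnected U)
    (hF : F.Finite) : IsPreconnected (U \ F) := by
  rw [isPreconnected_closed_iff]
  intro t t' ht ht' hsub hnt hnt'
  by_contra hne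
  rw [not_nonempty_iff_eq_empty] at hne
  have hno : ∀ x ∈ U \ F, x ∈ t → x ∈ t' → False := fun x hx h1 h2 =>
    (hne ▸ (⟨hx, h1, h2⟩ : x ∈ (U \ F) ∩ (t ∩ t')) : x ∈ (∅ : Set E2))
  let u : Set E2 → Set E2 := fun s => {x | ∃ r > 0, Metric.ball x r \ F ⊆ s}
  have hu : ∀ s, IsOpen (u s) := fun s => by
    rw [Metric.isOpen_iff]
    rintro x ⟨r, hr, h⟩
    refine ⟨r, hr, fun y hy => ⟨r - dist y x, sub_pos.2 hy, ?_⟩⟩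
    exact (sdiff_subset_sdiff_left (Metric.ball_subset_ball' (by linarith))).trans h
  have hcov : ∀ x ∈ U, x ∈ u t ∨ x ∈ u t' := by
    intro x hx
    obtain ⟨r, hr, hb⟩ := Metric.isOpen_iff.1 hU x hx
    have hsub' : Metric.ball x r \ F ⊆ U \ F := sdiff_subset_sdiff_left hb
    by_cases h1 : ((Metric.ball x r \ F) ∩ t).Nonempty
    · by_cases h2 : ((Metric.ball x r \ F) ∩ t').Nonempty
      · obtain ⟨z, hz, hz1, hz2⟩ := isPreconnected_closed_iff.1
          (isPreconnected_ball_diff_finite x hr hF) t t' ht ht' (hsub'.trans hsub) h1 h2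
        exact (hno z (hsub' hz) hz1 hz2).elim
      · exact .inl ⟨r, hr, fun z hz => (hsub (hsub' hz)).resolve_right fun h => h2 ⟨z, hz, h⟩⟩
    · exact .inr ⟨r, hr, fun z hz => (hsub (hsub' hz)).resolve_left fun h => h1 ⟨z, hz, h⟩⟩
  have hmem : ∀ {s x}, x ∈ U \ F → x ∈ u s → x ∈ s := by
    rintro s x hx ⟨r, hr, h⟩
    exact h ⟨Metric.mem_ball_self hr, hx.2⟩
  obtain ⟨x, hx, hxt⟩ := hnt
  obtain ⟨x', hx', hxt'⟩ := hnt'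
  obtain ⟨z, hz, ⟨r, hr, h1⟩, r', hr', h2⟩ := hc (u t) (u t') (hu t) (hu t') hcov
    ⟨x, hx.1, (hcov x hx.1).resolve_right fun h => hno x hx hxt (hmem hx h)⟩
    ⟨x', hx'.1, (hcov x' hx'.1).resolve_left fun h => hno x' hx' (hmem hx' h) hxt'⟩
  obtain ⟨y, ⟨⟨hy, hy'⟩, hyU⟩, hyF⟩ := nonempty_diff_finite
    ((Metric.isOpen_ball.inter Metric.isOpen_ball).inter hU)
    ⟨z, ⟨Metric.mem_ball_self hr, Metric.mem_ball_self hr'⟩, hz⟩ hF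
  exact hno y ⟨hyU, hyF⟩ (h1 ⟨hy, hyF⟩) (h2 ⟨hy', hyF⟩)

namespace Tri

theorem bary_eq_zero_of_mem_convexHull {T : Tri} {s : Set E2} {e : Fin 3}
    (hs : ∀ y ∈ s, T.bary e y = 0) {x : E2} (hx : x ∈ convexHull ℝ s) : T.bary e x = 0 := by
  have h1 : s ⊆ T.bary e ⁻¹' {0} := hs
  exact convexHull_min h1 ((convex_singleton (0 : ℝ)).affine_preimage (T.bary e)) hx

theorem eq_points {T : Tri} {k : Fin 3} {x : E2} (h1 : T.bary (k + 1) x = 0)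
    (h2 : T.bary (k + 2) x = 0) : x = T.points k := by
  have h := T.sum_bary x
  rw [sum_eq_rotate k, h1, h2] at h
  refine T.ext_bary (forall_rotate k ?_ ?_ ?_)
  · rw [bary_self]; linarith
  · rw [h1, bary_points, if_neg (ne_add_one k).symm]
  · rw [h2, bary_points, if_neg (ne_add_two k).symm]

end Tri

namespace Mesh

variable {G : Network} {M : Mesh G} {p : ℕ}

/-- Two different triangles that have a point in common that is not a vertex of the first one
share an edge through that point. -/
theorem exists_common_edge {i : Fin G.N} {K K' : Fin (M.n i)} (hne : K ≠ K') {x : E2}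
    (hx : x ∈ (M.tri i K).carrier) (hx' : x ∈ (M.tri i K').carrier)
    (hv : ∀ k, x ≠ (M.tri i K).points k) :
    ∃ e e', (M.tri i K).edge e = (M.tri i K').edge e' ∧ (M.tri i K).bary e x = 0 := by
  set T := M.tri i K with hT
  set T' := M.tri i K' with hT'
  have hconv : x ∈ convexHull ℝ (range T.points ∩ range T'.points) := by
    rw [← M.conforming i hne]; exact ⟨hx, hx'⟩
  -- By conformity `x` is a convex combination of common vertices, so a vertex that is not shared
  -- has coordinate zero.
  have hz : ∀ k, T.points k ∉ range T'.points → T.bary k x = 0 := by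
    intro k hk
    refine Tri.bary_eq_zero_of_mem_convexHull ?_ hconv
    rintro _ ⟨⟨l, rfl⟩, hl⟩
    rw [Tri.bary_points, if_neg]
    rintro rfl
    exact hk hl
  -- If all vertices were shared, the first triangle would lie in the second and their interiors
  -- would overlap.
  have hex : ∃ e, T.points e ∉ range T'.points := by
    by_contra! hall
    have hsub : T.carrier ⊆ T'.carrier := convexHull_mono (range_subset_iff.2 hall)
    obtain ⟨z, hz⟩ := T.interior_nonempty
    exact Set.disjoint_left.1 (M.disjoint_interior i hne) hz (interior_mono hsub hz)
  obtain ⟨e, he⟩ := hex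
  have e3 : ∀ e : Fin 3, e + 2 + 1 = e ∧ e + 2 + 2 = e + 1 ∧ e + 1 + 1 = e + 2 ∧ e + 1 + 2 = e := by
    decide
  have h0 := hz e he
  -- With a second unshared vertex, two coordinates of `x` would vanish and `x` would be a vertex.
  have h1 : T.points (e + 1) ∈ range T'.points := by
    by_contra h
    exact hv (e + 2) (Tri.eq_points (by rw [(e3 e).1]; exact h0)
      (by rw [(e3 e).2.1]; exact hz _ h))
  have h2 : T.points (e + 2) ∈ range T'.points := by
    by_contra h
    exact hv (e + 1) (Tri.eq_points (by rw [(e3 e).2.2.1]; exact hz _ h)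
      (by rw [(e3 e).2.2.2]; exact h0))
  obtain ⟨a, ha⟩ := h1
  obtain ⟨b, hb⟩ := h2
  have hab : a ≠ b := by
    rintro rfl
    exact Tri.add_one_ne_add_two e (T.independent.injective (ha.symm.trans hb))
  have hdec : ∀ a b : Fin 3, a ≠ b → ∃ e', (a = e' + 1 ∧ b = e' + 2) ∨ (a = e' + 2 ∧ b = e' + 1) := by
    decide
  obtain ⟨e', he'⟩ := hdec a b hab
  refine ⟨e, e', ?_, h0⟩
  rw [Tri.edge, Tri.edge, Tri.fst, Tri.snd, Tri.fst, Tri.snd, ← ha, ← hb]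
  rcases he' with ⟨rfl, rfl⟩ | ⟨rfl, rfl⟩
  · rfl
  · exact Sym2.eq_swap

/-- The vertices of the mesh of a surface. -/
def vertices (M : Mesh G) (i : Fin G.N) : Set E2 := ⋃ K, range (M.tri i K).points

theorem finite_vertices (M : Mesh G) (i : Fin G.N) : (M.vertices i).Finite :=
  Set.finite_iUnion fun _ => Set.finite_range _

theorem ne_points {i : Fin G.N} {x : E2} (hx : x ∉ M.vertices i) (K : Fin (M.n i)) (k : Fin 3) :
    x ≠ (M.tri i K).points k := fun h => hx (mem_iUnion.2 ⟨K, k, h.symm⟩)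

theorem isClosed_biUnion_carrier (M : Mesh G) (i : Fin G.N) (S : Set (Fin (M.n i))) :
    IsClosed (⋃ K ∈ S, (M.tri i K).carrier) :=
  S.toFinite.isClosed_biUnion fun K _ => (M.tri i K).isCompact_carrier.isClosed

/-- A function on the triangles of a surface that agrees on triangles with a common edge is
constant. -/
theorem eq_of_eq_on_adjacent {i : Fin G.N} {α : Type*} {k : Fin (M.n i) → α}
    (hk : ∀ K K' e e', K ≠ K' → (M.tri i K).edge e = (M.tri i K').edge e' → k K = k K')
    (K₀ K₁ : Fin (M.n i)) : k K₀ = k K₁ := by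
  by_contra hne
  -- The vertices are removed because triangles may meet in a vertex without sharing an edge.
  have hpre : IsPreconnected (G.dom i \ M.vertices i) :=
    isPreconnected_diff_finite (G.polygonal i).1 (G.polygonal i).2.1.isPreconnected
      (M.finite_vertices i)
  have hmeet : ∀ (S : Set (Fin (M.n i))) K, K ∈ S →
      ((G.dom i \ M.vertices i) ∩ ⋃ K ∈ S, (M.tri i K).carrier).Nonempty := by
    intro S K hK
    obtain ⟨x, hx, hxv⟩ := nonempty_diff_finite isOpen_interior (M.tri i K).interior_nonempty
      (M.finite_vertices i)
    exact ⟨x, ⟨M.interior_carrier_subset i K hx, hxv⟩, mem_biUnion hK (interior_subset hx)⟩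
  -- The triangles with the value of `K₀` and the others form two closed sets; by connectedness they
  -- meet at a point that is no vertex, hence along a common edge.
  obtain ⟨x, hx, hxA, hxB⟩ := isPreconnected_closed_iff.1 hpre
    (⋃ K ∈ {K | k K = k K₀}, (M.tri i K).carrier) (⋃ K ∈ {K | k K ≠ k K₀}, (M.tri i K).carrier)
    (M.isClosed_biUnion_carrier i _) (M.isClosed_biUnion_carrier i _)
    (by
      rintro x ⟨hx, -⟩
      have := subset_closure hx
      rw [← M.cover i] at this
      obtain ⟨K, hK⟩ := mem_iUnion.1 this
      by_cases h : k K = k K₀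
      · exact .inl (mem_biUnion (show K ∈ {K | k K = k K₀} from h) hK)
      · exact .inr (mem_biUnion (show K ∈ {K | k K ≠ k K₀} from h) hK))
    (hmeet _ K₀ rfl) (hmeet _ K₁ (Ne.symm hne))
  obtain ⟨K, hK, hxK⟩ := mem_iUnion₂.1 hxA
  obtain ⟨K', hK', hxK'⟩ := mem_iUnion₂.1 hxB
  have hKK : K ≠ K' := by rintro rfl; exact hK' hK
  obtain ⟨e, e', h, -⟩ := exists_common_edge hKK hxK hxK' (ne_points hx.2 K)
  exact hK' ((hk K K' e e' hKK h).symm.trans hK)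

/-! ### Edges in the boundary -/

/-- A polygonal domain is the interior of its closure. The boundary can thus be tested on the
closure, which is what the triangles cover. -/
theorem frontier_eq (G : Network) (i : Fin G.N) :
    frontier (G.dom i) = frontier (closure (G.dom i)) := by
  rw [isClosed_closure.frontier_eq, (G.polygonal i).2.2.1, (G.polygonal i).1.frontier_eq]

/-- If the open edge `F` contains a boundary point then the edge lies in the boundary. -/
theorem seg_edge_subset_frontier {i : Fin G.N} (F : M.Loc i) {t : ℝ} (ht : t ∈ Ioo (0 : ℝ) 1)
    (hz : pt F t ∈ frontier (G.dom i)) : seg (M.edge F) ⊆ frontier (G.dom i) := by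
  have hnv : ∀ s ∈ Ioo (0 : ℝ) 1, ∀ k, pt F s ≠ (M.tri i F.1).points k := by
    intro s hs k h
    have b1 := Tri.bary_edgePt_one (M.tri i F.1) F.2 s
    have b2 := Tri.bary_edgePt_two (M.tri i F.1) F.2 s
    rw [show (M.tri i F.1).edgePt F.2 s = pt F s from rfl, h, Tri.bary_points] at b1 b2
    split_ifs at b1 b2 <;> linarith [hs.1, hs.2]
  -- Another triangle at a point of the open edge shares the whole edge. On the opposite side it
  -- would make `pt F t` an interior point; on the same side it would be the triangle itself.
  have honly : ∀ s ∈ Ioo (0 : ℝ) 1, ∀ K, pt F s ∈ (M.tri i K).carrier → K = F.1 := by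
    intro s hs K hK
    by_contra hne
    obtain ⟨e, e', h, h0⟩ := exists_common_edge (Ne.symm hne)
      (pt_mem F (Ioo_subset_Icc_self hs)) hK (hnv s hs)
    have he : e = F.2 := by
      have b1 := Tri.bary_edgePt_one (M.tri i F.1) F.2 s
      have b2 := Tri.bary_edgePt_two (M.tri i F.1) F.2 s
      by_contra hne'
      have h3 : ∀ e f : Fin 3, e ≠ f → e = f + 1 ∨ e = f + 2 := by decide
      rcases h3 _ _ hne' with rfl | rfl
      · rw [show (M.tri i F.1).edgePt F.2 s = pt F s from rfl, h0] at b1; linarith [hs.2]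
      · rw [show (M.tri i F.1).edgePt F.2 s = pt F s from rfl, h0] at b2; linarith [hs.1]
    subst he
    rcases lt_or_gt_of_ne (Tri.bary_apex_ne_zero h) with hs' | hs'
    · have hn := Tri.union_mem_nhds h hs' ht
      have : closure (G.dom i) ∈ 𝓝 (pt F t) :=
        mem_of_superset hn (union_subset (M.carrier_subset i _) (M.carrier_subset i _))
      rw [frontier_eq] at hz
      exact hz.2 (mem_interior_iff_mem_nhds.2 this)
    · exact hne (congrArg Prod.fst (eq_of_same_side (F := F) (F' := (K, e')) h hs')).symm
  have hopen : ∀ s ∈ Ioo (0 : ℝ) 1, pt F s ∈ frontier (G.dom i) := by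
    intro s hs
    have hmem := pt_mem F (Ioo_subset_Icc_self hs)
    rw [frontier_eq, isClosed_closure.frontier_eq]
    refine ⟨M.carrier_subset i _ hmem, fun hint => ?_⟩
    have hcl := M.isClosed_biUnion_carrier i {K | K ≠ F.1}
    have hnot : pt F s ∉ ⋃ K ∈ {K | K ≠ F.1}, (M.tri i K).carrier := by
      intro h
      obtain ⟨K, hK, hx⟩ := mem_iUnion₂.1 h
      exact hK (honly s hs K hx)
    -- If the point were interior to the closure, the single triangle containing it would be a
    -- neighbourhood, although one barycentric coordinate vanishes there.
    have hN : (M.tri i F.1).carrier ∈ 𝓝 (pt F s) := by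
      filter_upwards [mem_interior_iff_mem_nhds.1 hint, hcl.isOpen_compl.mem_nhds hnot] with y hy hy'
      rw [← M.cover i] at hy
      obtain ⟨K, hK⟩ := mem_iUnion.1 hy
      have : K = F.1 := by
        by_contra hne
        exact hy' (mem_biUnion (show K ∈ {K | K ≠ F.1} from hne) hK)
      rwa [this] at hK
    have hI := mem_interior_iff_mem_nhds.2 hN
    rw [Tri.interior_carrier_eq] at hI
    exact (hI F.2).ne' (Tri.bary_edgePt_zero _ _ _)
  have hclosed : IsClosed (pt F ⁻¹' frontier (G.dom i)) := isClosed_frontier.preimage (continuous_pt F)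
  have hIcc : Icc (0 : ℝ) 1 ⊆ pt F ⁻¹' frontier (G.dom i) := by
    rw [← closure_Ioo zero_ne_one]
    exact closure_minimal hopen hclosed
  rw [edge, Tri.seg_edge]
  rintro _ ⟨s, hs, rfl⟩
  exact hIcc hs

/-- Every boundary point lies on a mesh edge in the boundary. -/
theorem exists_edge_subset_frontier (M : Mesh G) {i : Fin G.N} {y : E2}
    (hy : y ∈ frontier (G.dom i)) :
    ∃ F : M.Loc i, seg (M.edge F) ⊆ frontier (G.dom i) ∧ y ∈ seg (M.edge F) := by
  -- In a ball around `y` that avoids `Z`, any triangle or edge that occurs contains `y`.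
  let Z : Set E2 := (⋃ K ∈ {K | y ∉ (M.tri i K).carrier}, (M.tri i K).carrier) ∪
    ⋃ F ∈ {F : M.Loc i | y ∉ seg (M.edge F)}, seg (M.edge F)
  have hsegc : ∀ F : M.Loc i, IsClosed (seg (M.edge F)) := fun F => by
    rw [edge, Tri.seg_edge]
    exact (isCompact_Icc.image (Tri.continuous_edgePt _ _)).isClosed
  have hZ : IsClosed Z := (M.isClosed_biUnion_carrier i _).union
    ((Set.toFinite _).isClosed_biUnion fun F _ => hsegc F)
  have hyZ : y ∉ Z := by
    rintro (h | h)
    · obtain ⟨K, hK, h⟩ := mem_iUnion₂.1 h; exact hK h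
    · obtain ⟨F, hF, h⟩ := mem_iUnion₂.1 h; exact hF h
  obtain ⟨ρ, hρ, hball⟩ := Metric.isOpen_iff.1 hZ.isOpen_compl y hyZ
  have hpre := isPreconnected_ball_diff_finite y hρ (M.finite_vertices i)
  set C := closure (G.dom i) with hC
  rw [frontier_eq, isClosed_closure.frontier_eq] at hy
  have hne1 : ((Metric.ball y ρ \ M.vertices i) ∩ C).Nonempty := by
    have h1 : (Metric.ball y ρ ∩ G.dom i).Nonempty :=
      mem_closure_iff.1 hy.1 _ Metric.isOpen_ball (Metric.mem_ball_self hρ)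
    obtain ⟨x, ⟨hx, hx'⟩, hxv⟩ := nonempty_diff_finite
      (Metric.isOpen_ball.inter (G.polygonal i).1) h1 (M.finite_vertices i)
    exact ⟨x, ⟨hx, hxv⟩, subset_closure hx'⟩
  have hne2 : ((Metric.ball y ρ \ M.vertices i) ∩ closure Cᶜ).Nonempty := by
    have h1 : (Metric.ball y ρ ∩ Cᶜ).Nonempty := by
      by_contra h
      refine hy.2 (mem_interior.2 ⟨_, fun x hx => ?_, Metric.isOpen_ball, Metric.mem_ball_self hρ⟩)
      by_contra hx'
      exact h ⟨x, hx, hx'⟩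
    obtain ⟨x, ⟨hx, hx'⟩, hxv⟩ := nonempty_diff_finite
      (Metric.isOpen_ball.inter isClosed_closure.isOpen_compl) h1 (M.finite_vertices i)
    exact ⟨x, ⟨hx, hxv⟩, subset_closure hx'⟩
  -- Connectedness of the ball without the mesh vertices yields a boundary point `z` that is not a
  -- vertex. It lies inside an edge of a triangle, and that edge passes through `y`.
  obtain ⟨z, ⟨hzb, hzv⟩, hzC, hzC'⟩ := isPreconnected_closed_iff.1 hpre C (closure Cᶜ)
    isClosed_closure isClosed_closure (fun x _ => (em (x ∈ C)).imp id fun h => subset_closure h)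
    hne1 hne2
  rw [closure_compl] at hzC'
  have hzC2 := hzC
  rw [hC, ← M.cover i] at hzC2
  obtain ⟨K, hK⟩ := mem_iUnion.1 hzC2
  have hnint : z ∉ interior (M.tri i K).carrier := fun h =>
    hzC' (interior_mono (M.carrier_subset i K) h)
  rw [Tri.interior_carrier_eq] at hnint
  have hK' := hK
  rw [Tri.carrier_eq] at hK'
  obtain ⟨e, he⟩ : ∃ e, (M.tri i K).bary e z = 0 := by
    by_contra! h
    exact hnint fun e => lt_of_le_of_ne (hK' e) (Ne.symm (h e))
  let F : M.Loc i := (K, e)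
  have hseg : z ∈ seg (M.edge F) := Tri.mem_seg_edge _ hK he
  have hyF : y ∈ seg (M.edge F) := by
    by_contra h
    exact hball hzb (.inr (mem_biUnion (show F ∈ {F : M.Loc i | y ∉ seg (M.edge F)} from h) hseg))
  refine ⟨F, ?_, hyF⟩
  have hsum := (M.tri i K).sum_bary z
  rw [Tri.sum_eq_rotate e, he, zero_add] at hsum
  have e3 : ∀ e : Fin 3, e + 2 + 1 = e ∧ e + 2 + 2 = e + 1 ∧ e + 1 + 1 = e + 2 ∧ e + 1 + 2 = e := by
    decide
  have h1 : (M.tri i K).bary (e + 1) z ≠ 0 := fun h => ne_points hzv K (e + 2)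
    (Tri.eq_points (by rw [(e3 e).1]; exact he) (by rw [(e3 e).2.1]; exact h))
  have h2 : (M.tri i K).bary (e + 2) z ≠ 0 := fun h => ne_points hzv K (e + 1)
    (Tri.eq_points (by rw [(e3 e).2.2.1]; exact h) (by rw [(e3 e).2.2.2]; exact he))
  have p1 := lt_of_le_of_ne (hK' (e + 1)) (Ne.symm h1)
  have p2 := lt_of_le_of_ne (hK' (e + 2)) (Ne.symm h2)
  refine seg_edge_subset_frontier F (t := (M.tri i K).bary (e + 2) z) ⟨p2, by linarith⟩ ?_
  rw [pt, Tri.edgePt_eq _ he, frontier_eq, isClosed_closure.frontier_eq]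
  exact ⟨hzC, hzC'⟩

/-- A boundary point off the bifurcations lies on a mesh edge in the boundary. Were that edge
contained in a bifurcation, the point would be as well. -/
theorem bdryFaces_nonempty (M : Mesh G) {i : Fin G.N}
    (h : ((G.emb i '' frontier (G.dom i)) \ G.bifSet).Nonempty) : (M.bdryFaces i).Nonempty := by
  obtain ⟨_, ⟨y, hy, rfl⟩, hb⟩ := h
  obtain ⟨F, hF, hyF⟩ := M.exists_edge_subset_frontier hy
  refine ⟨F, ?_⟩
  classical
  simp only [bdryFaces, Finset.mem_filter, Finset.mem_univ, true_and]
  refine ⟨hF, fun γ hγ hsub => hb (mem_biUnion hγ (hsub ?_))⟩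
  rw [edge3]
  change _ ∈ seg ((M.edge F).map (G.emb i).toAffineMap)
  rw [seg_map]
  exact mem_image_of_mem _ hyF

end Mesh

end PlaneDG

/-! ### Plane-networks: coercivity and well-posedness -/

namespace PlaneDG.Mesh

variable {G : Network} {M : Mesh G} {p : ℕ}

theorem exists_eq_C_of_energy_eq_zero {v : M.V p} {i : Fin G.N} {K : Fin (M.n i)}
    (h : energy v i K = 0) : ∃ k, (v i K : MvPolynomial (Fin 2) ℝ) = MvPolynomial.C k := by
  have hg := (continuous_grad v i K).norm.pow 2
  have h0 := eqOn_zero_of_setIntegral_eq_zero isOpen_interior interior_subset hg.continuousOn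
    (fun x => sq_nonneg _) (integrableOn_carrier _ hg) h
  refine ⟨_, eq_C_of_pderiv_eq_zero fun l => eq_zero_of_polyVal_eq_zero isOpen_interior
    (M.tri i K).interior_nonempty fun x hx => ?_⟩
  have h1 : grad v i K x = 0 := norm_eq_zero.1 (pow_eq_zero_iff two_ne_zero |>.1 (h0 hx))
  rw [← grad_apply, h1, PiLp.zero_apply]

theorem eq_zero_of_faceInt_sq {i : Fin G.N} {F : M.Loc i} {c k : ℝ} (hc : 0 < c)
    (h : c * M.faceInt F (fun _ => k ^ 2) = 0) : k = 0 := by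
  rw [faceInt_eq] at h
  simp only [integral_const, measureReal_restrict_apply_univ, Real.volume_real_Icc, sub_zero,
    max_eq_left zero_le_one, one_smul] at h
  have hl := (M.len_pos F).ne'
  simpa [hc.ne', hl] using h

theorem eq_zero_of_dgNorm_eq_zero (hG : G.ReachesBoundary) {ηF : Fin G.N → Sym2 E2 → ℝ}
    {ηΓ : Sym2 E3 → ℝ} (hF : ∀ i F, 0 < ηF i F) (hΓ : ∀ γ, 0 < ηΓ γ) {v : M.V p}
    (hv : dgNorm ηF ηΓ v ^ 2 = 0) : v = 0 := by
  have gnn : ∀ i, 0 ≤ ∑ K, energy v i K := fun i => Finset.sum_nonneg fun K _ => energy_nonneg v i K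
  have pnn : ∀ i, 0 ≤ penSurf ηF i v := fun i => penSurf_nonneg (hF i) v
  have bnn := penBif_nonneg hΓ v
  have gs : 0 ≤ ∑ i, ∑ K, energy v i K := Finset.sum_nonneg fun i _ => gnn i
  have ps : 0 ≤ ∑ i, penSurf ηF i v := Finset.sum_nonneg fun i _ => pnn i
  rw [dgNorm_sq hF hΓ] at hv
  have hg0 : ∑ i, ∑ K, energy v i K = 0 := by linarith
  have hp0 : ∑ i, penSurf ηF i v = 0 := by linarith
  have hb0 : penBif ηΓ v = 0 := by linarith
  have hconst : ∀ i K, ∃ k, (v i K : MvPolynomial (Fin 2) ℝ) = MvPolynomial.C k := fun i K => by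
    apply exists_eq_C_of_energy_eq_zero
    have := (Finset.sum_eq_zero_iff_of_nonneg fun i _ => gnn i).1 hg0 i (Finset.mem_univ i)
    exact (Finset.sum_eq_zero_iff_of_nonneg fun K _ => energy_nonneg v i K).1 this K
      (Finset.mem_univ K)
  choose k hk using hconst
  have hval : ∀ i K x, val v i K x = k i K := fun i K x => by rw [val, hk, MvPolynomial.eval_C]
  have hpi : ∀ i, penSurf ηF i v = 0 := fun i =>
    (Finset.sum_eq_zero_iff_of_nonneg fun i _ => pnn i).1 hp0 i (Finset.mem_univ i)
  have nnI : ∀ i, ∀ F ∈ M.intFaces i, 0 ≤ ηF i (M.edge F.1) / M.len F.1 *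
      M.faceInt F.1 fun x => jumpInt v i F x ^ 2 := fun i F _ =>
    mul_nonneg (div_pos (hF _ _) (M.len_pos _)).le (faceInt_sq_nonneg _ _)
  have nnB : ∀ i, ∀ F ∈ M.bdryFaces i, 0 ≤ ηF i (M.edge F) / M.len F *
      M.faceInt F fun x => val v i F.1 x ^ 2 := fun i F _ =>
    mul_nonneg (div_pos (hF _ _) (M.len_pos _)).le (faceInt_sq_nonneg _ _)
  have hsplit := fun i => (add_eq_zero_iff_of_nonneg (Finset.sum_nonneg (nnI i))
    (Finset.sum_nonneg (nnB i))).1 (hpi i)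
  have hint : ∀ i, ∀ F ∈ M.intFaces i, k i F.1.1 = k i F.2.1 := by
    intro i F hFi
    have h := (Finset.sum_eq_zero_iff_of_nonneg (nnI i)).1 (hsplit i).1 F hFi
    simp_rw [jumpInt, hval] at h
    exact sub_eq_zero.1 (eq_zero_of_faceInt_sq (div_pos (hF _ _) (M.len_pos _)) h)
  -- Triangulations have no linear order of neighbours, so the constants are identified through
  -- connectedness of the domain without the mesh vertices.
  have hsame : ∀ i K K', k i K = k i K' := fun i => eq_of_eq_on_adjacent fun K K' e e' hne h => by
    rcases lt_or_gt_of_ne hne with hlt | hlt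
    · exact hint i ((K, e), (K', e')) (Finset.mem_filter.2 ⟨Finset.mem_univ _, hlt, h⟩)
    · exact (hint i ((K', e'), (K, e)) (Finset.mem_filter.2 ⟨Finset.mem_univ _, hlt, h.symm⟩)).symm
  have hlt : ∀ γ ∈ G.bifs, ∀ i ∈ G.I γ, ∀ j ∈ G.I γ, i < j → ∀ K K', k i K = k j K' := by
    intro γ hγ i hi j hj hij K K'
    have h1 := (Finset.sum_eq_zero_iff_of_nonneg fun γ _ =>
      mul_nonneg (hΓ γ).le (penSeg_nonneg γ v)).1 hb0 γ hγ
    have h2 := (mul_eq_zero.1 h1).resolve_left (hΓ γ).ne'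
    have nn : ∀ ij : Fin G.N × Fin G.N, ∀ F ∈ M.bifFaces γ ij.1 ij.2,
        0 ≤ 1 / M.len F.1 * M.faceInt F.1 fun x => jumpBif v ij.1 ij.2 F x ^ 2 := fun ij F _ =>
      mul_nonneg (one_div_nonneg.2 (M.len_pos _).le) (faceInt_sq_nonneg _ _)
    have h3 := (Finset.sum_eq_zero_iff_of_nonneg fun ij _ => Finset.sum_nonneg (nn ij)).1 h2 (i, j)
      (Finset.mem_filter.2 ⟨Finset.mem_product.2 ⟨hi, hj⟩, hij⟩)
    obtain ⟨γ₁, γ₂⟩ := γ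
    -- The partition at an end point of `γ` provides a mesh edge on surface `i`, and matching
    -- provides the same edge on `j`; one common edge suffices to compare the constants.
    obtain ⟨K₁, e₁, hsub, -⟩ := M.bif_partition _ hγ i hi γ₁ (subset_convexHull ℝ _ (by simp))
    obtain ⟨K₂, e₂, he⟩ := M.bif_match _ hγ i hi j hj K₁ e₁ hsub
    have hmem : (((K₁, e₁), (K₂, e₂)) : M.Loc i × M.Loc j) ∈ M.bifFaces s(γ₁, γ₂) i j := by
      classical
      simp only [bifFaces, Finset.mem_filter, Finset.mem_univ, true_and]
      exact ⟨he.symm, hsub⟩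
    have h4 := (Finset.sum_eq_zero_iff_of_nonneg (nn (i, j))).1 h3 _ hmem
    simp_rw [jumpBif, hval] at h4
    rw [hsame i K K₁, hsame j K' K₂]
    exact sub_eq_zero.1 (eq_zero_of_faceInt_sq (one_div_pos.2 (M.len_pos _)) h4)
  have hlink : ∀ i j, G.Linked i j → ∀ K K', k i K = k j K' := by
    rintro i j ⟨γ, hγ, hi, hj⟩ K K'
    rcases lt_trichotomy i j with h | rfl | h
    · exact hlt γ hγ i hi j hj h K K'
    · exact hsame i K K'
    · exact (hlt γ hγ j hj i hi h K' K).symm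
  -- The chain passes through intermediate surfaces, each of which must have a triangle to carry the
  -- constant.
  have hinh : ∀ i, Nonempty (Fin (M.n i)) := by
    intro i
    obtain ⟨x, hx⟩ := (G.polygonal i).2.1.nonempty
    have := subset_closure hx
    rw [← M.cover i] at this
    exact ⟨(mem_iUnion.1 this).choose⟩
  have hall : ∀ i K, k i K = 0 := by
    intro i
    obtain ⟨j, hij, hj⟩ := hG i
    obtain ⟨F, hFj⟩ := M.bdryFaces_nonempty hj
    have hj0 : ∀ K, k j K = 0 := by
      intro K
      have h := (Finset.sum_eq_zero_iff_of_nonneg (nnB j)).1 (hsplit j).2 F hFj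
      simp_rw [hval] at h
      rw [hsame j K F.1]
      exact eq_zero_of_faceInt_sq (div_pos (hF _ _) (M.len_pos _)) h
    clear hj hFj F
    induction hij using Relation.ReflTransGen.head_induction_on with
    | refl => exact hj0
    | head h _ ih =>
      intro K
      obtain ⟨K'⟩ := hinh _
      rw [hlink _ _ h K K', ih]
  funext i K
  apply Subtype.ext
  rw [hk, hall, map_zero]
  rfl

theorem coercive_and_wellposed {κ : Fin G.N → E2 → ℝ} (hκ : G.IsCoefficient κ) (p : ℕ) (σ : ℝ) :
    ∃ η₀ > 0, ∃ C > 0, ∀ M : Mesh G, M.ShapeRegular σ → M.HasTraces κ →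
      ∀ (ε : Fin G.N → ℝ) (ε₀ : ℝ) (ηF : Fin G.N → Sym2 E2 → ℝ) (ηΓ : Sym2 E3 → ℝ),
        (∀ i, ε i ∈ ({-1, 0, 1} : Set ℝ)) → ε₀ ∈ ({-1, 0, 1} : Set ℝ) →
        (∀ i, ε i = -1 → ∀ F, 0 < ηF i F) →
        (∀ i, ε i = 0 ∨ ε i = 1 → ∀ F, η₀ ≤ ηF i F) →
        (∀ γ, η₀ ≤ ηΓ γ) →
        (∀ v : M.V p, dgNorm ηF ηΓ v ^ 2 ≤ C * a κ ε ε₀ ηF ηΓ v v) ∧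
        (G.ReachesBoundary → ∀ f : Fin G.N → E2 → ℝ,
          (∀ i, MemLp (f i) 2 (volume.restrict (G.dom i))) →
          ∃! u : M.V p, ∀ v : M.V p, a κ ε ε₀ ηF ηΓ u v = load f v) := by
  obtain ⟨hm, ⟨b, hb0, hb⟩, ⟨c, hc'⟩⟩ := hκ
  have hc : ∀ i, ∀ᵐ x ∂(volume.restrict (G.dom i)), κ i x ∈ Icc (-c) c := by
    intro i
    filter_upwards [hb i, hc' i] with x h1 h2
    exact ⟨by linarith, h2⟩
  obtain ⟨B, hB, hflux⟩ := exists_fluxBound hc p σ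
  -- `R`, `δ` and `η₀` are chosen as for edge-networks; `σ` enters only through the flux constant
  -- `B`.
  let R : ℝ := 9 * B + 24 * G.N ^ 2 * G.bifs.card * B + 1
  have hR : 0 < R := by positivity
  let δ : ℝ := b / (4 * R)
  have hδ : 0 < δ := by positivity
  have hδR : δ * R = b / 4 := by simp only [δ]; field_simp
  have hδ1 : δ * (9 * B) ≤ b / 4 := by
    rw [← hδR]
    refine mul_le_mul_of_nonneg_left ?_ hδ.le
    have : 0 ≤ 24 * (G.N : ℝ) ^ 2 * G.bifs.card * B := by positivity
    simp only [R]; linarith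
  have hδ2 : δ * (24 * G.N ^ 2 * G.bifs.card * B) ≤ b / 4 := by
    rw [← hδR]
    refine mul_le_mul_of_nonneg_left ?_ hδ.le
    simp only [R]; linarith
  refine ⟨4 * δ⁻¹, by positivity, 2 / b + 4 / 3, by positivity, ?_⟩
  intro M hσ hT ε ε₀ ηF ηΓ hε hε₀ hN hη hηΓ
  have hδi : 0 < δ⁻¹ := inv_pos.2 hδ
  have hF : ∀ i F, 0 < ηF i F := fun i F => by
    rcases hε i with h | h
    · exact hN i h F
    · exact lt_of_lt_of_le (by positivity) (hη i h F)
  have hΓ : ∀ γ, 0 < ηΓ γ := fun γ => lt_of_lt_of_le (by positivity) (hηΓ γ)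
  have hcoer : ∀ v : M.V p, dgNorm ηF ηΓ v ^ 2 ≤ (2 / b + 4 / 3) * a κ ε ε₀ ηF ηΓ v v := by
    intro v
    have gnn : ∀ i, 0 ≤ ∑ K, energy v i K := fun i =>
      Finset.sum_nonneg fun K _ => energy_nonneg v i K
    have key := interior_penalty_coercive (c := b) (y := ∑ γ ∈ G.bifs, avgJump κ v v γ)
      (z := penBif ηΓ v) (ε₀ := ε₀) (ε := ε)
      (A := fun i =>
        ∑ K, ∫ x in (M.tri i K).carrier, κ i x * inner ℝ (grad v i K x) (grad v i K x))
      (g := fun i => ∑ K, energy v i K) (x := fun i => consSurf κ i v v)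
      (j := fun i => penSurf ηF i v)
      (fun i => by
        rw [Finset.mul_sum]
        exact Finset.sum_le_sum fun K _ => mul_energy_le hm hc hb v i K)
      (penBif_nonneg hΓ v) (fun i => penSurf_nonneg (hF i) v) hε hε₀
      (fun i => mul_nonneg hb0.le (gnn i))
      (fun i hi => by
        refine (two_mul_abs_consSurf_le hB (hflux M hσ hT) hδ v i).trans ?_
        refine add_le_add (mul_le_mul_of_nonneg_right hδ1 (gnn i)) ?_
        have := penSurf_one_le (hη i hi) v
        linarith)
      (by
        refine (two_mul_abs_sum_avgJump_le hB (hflux M hσ hT) hδ v).trans ?_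
        refine add_le_add (mul_le_mul_of_nonneg_right hδ2 (Finset.sum_nonneg fun i _ => gnn i)) ?_
        have := penBif_one_le hηΓ v
        linarith)
    rw [← a_self κ ε ε₀ ηF ηΓ v] at key
    rw [dgNorm_sq hF hΓ]
    have g0 : 0 ≤ ∑ i, ∑ K, energy v i K := Finset.sum_nonneg fun i _ => gnn i
    have q0 : 0 ≤ ∑ i, penSurf ηF i v + penBif ηΓ v :=
      add_nonneg (Finset.sum_nonneg fun i _ => penSurf_nonneg (hF i) v) (penBif_nonneg hΓ v)
    exact le_mul_of_energy_le hb0 g0 q0 key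
  refine ⟨hcoer, fun hG f hf => (isBilin_a hm hc hT ε ε₀ ηF ηΓ).existsUnique_of_definite ?_
    (isLin_load hf)⟩
  intro u hu
  have h1 := hcoer u
  rw [hu, mul_zero] at h1
  exact eq_zero_of_dgNorm_eq_zero hG hF hΓ (le_antisymm h1 (sq_nonneg _))

end PlaneDG.Mesh

theorem mainTheorem5 :
    (∀ (G : EdgeDG.Network) (κ : Fin G.N → ℝ → ℝ), G.IsCoefficient κ →
      ∀ (p : ℕ) (σ : ℝ), ∃ η₀ > 0, ∃ C > 0,
        ∀ M : EdgeDG.Mesh G, M.ShapeRegular σ → M.HasTraces κ →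
        ∀ (ε : Fin G.N → ℝ) (ε₀ : ℝ) (ηF : Fin G.N → ℝ → ℝ) (ηΓ : Fin G.numVert → ℝ),
          (∀ i, ε i ∈ ({-1, 0, 1} : Set ℝ)) → ε₀ ∈ ({-1, 0, 1} : Set ℝ) →
          (∀ i, ε i = -1 → ∀ F, 0 < ηF i F) →
          (∀ i, ε i = 0 ∨ ε i = 1 → ∀ F, η₀ ≤ ηF i F) →
          (∀ γ, η₀ ≤ ηΓ γ) →
          (∀ v : M.V p,
            EdgeDG.Mesh.dgNorm ηF ηΓ v ^ 2 ≤ C * EdgeDG.Mesh.a κ ε ε₀ ηF ηΓ v v) ∧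
          (G.ReachesBoundary → ∀ f : Fin G.N → ℝ → ℝ,
            (∀ i, MeasureTheory.MemLp (f i) 2
              (MeasureTheory.volume.restrict (Set.Ioo (G.left i) (G.right i)))) →
            ∃! u : M.V p, ∀ v : M.V p,
              EdgeDG.Mesh.a κ ε ε₀ ηF ηΓ u v = EdgeDG.Mesh.load f v)) ∧
    (∀ (G : PlaneDG.Network) (κ : Fin G.N → PlaneDG.E2 → ℝ), G.IsCoefficient κ →
      ∀ (p : ℕ) (σ : ℝ), ∃ η₀ > 0, ∃ C > 0,
        ∀ M : PlaneDG.Mesh G, M.ShapeRegular σ → M.HasTraces κ →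
        ∀ (ε : Fin G.N → ℝ) (ε₀ : ℝ) (ηF : Fin G.N → Sym2 PlaneDG.E2 → ℝ)
          (ηΓ : Sym2 PlaneDG.E3 → ℝ),
          (∀ i, ε i ∈ ({-1, 0, 1} : Set ℝ)) → ε₀ ∈ ({-1, 0, 1} : Set ℝ) →
          (∀ i, ε i = -1 → ∀ F, 0 < ηF i F) →
          (∀ i, ε i = 0 ∨ ε i = 1 → ∀ F, η₀ ≤ ηF i F) →
          (∀ γ, η₀ ≤ ηΓ γ) →
          (∀ v : M.V p,
            PlaneDG.Mesh.dgNorm ηF ηΓ v ^ 2 ≤ C * PlaneDG.Mesh.a κ ε ε₀ ηF ηΓ v v) ∧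
          (G.ReachesBoundary → ∀ f : Fin G.N → PlaneDG.E2 → ℝ,
            (∀ i, MeasureTheory.MemLp (f i) 2
              (MeasureTheory.volume.restrict (G.dom i))) →
            ∃! u : M.V p, ∀ v : M.V p,
              PlaneDG.Mesh.a κ ε ε₀ ηF ηΓ u v = PlaneDG.Mesh.load f v)) :=
  ⟨fun _ _ hκ p σ => EdgeDG.Mesh.coercive_and_wellposed hκ p σ,
    fun _ _ hκ p σ => PlaneDG.Mesh.coercive_and_wellposed hκ p σ⟩
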